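/- For $d\ge 3$ let $A_d^{(2)}$ be the configuration of the $d+1$ lattice points $a_j=(j,\binom j2)\in\mathbb Z^2$, $0\le j\le d$ (written $(1,a_j)$ as columns of a $3\times(d+1)$ matrix), let $P(d)\subset\mathbb R^2$ be its convex hull, and let $\overline{A_d^{(2)}}=P(d)\cap\mathbb Z^2$, with $N+1$ elements. For a finite configuration $B\subset\mathbb Z^2$ let $X_B\subset\mathbb P^{|B|-1}$ be the complex toric variety of $B$, that is, the Zariski closure of the set of points $(t^b)_{b\in B}$ with $t\in(\mathbb C^*)^2$. For every $d\ge 3$, $X_{\overline{A_d^{(2)}}}\subset\mathbb P^N$ is a surface, and the coordinate projection $X_{\overline{A_d^{(2)}}}\to X_{A_d^{(2)}}\subset\mathbb P^d$ is everywhere defined and is the normalization of $X_{A_d^{(2)}}$. Moreover: 1. $X_{\overline{A_3^{(2)}}}$ is a nonsingular surface of degree $4$ in $\mathbb P^5$. 2. For $d\ge 4$, $X_{\overline{A_d^{(2)}}}$ has exactly two singular points, namely the torus-fixed points corresponding to the vertices $(0,0)$ and $(d,\binom d2)$ of $P(d)$. Both have toric multiplicity $d-1$ if $d$ is even and $\frac12(d-1)$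 if $d$ is odd. Here the toric multiplicity of the torus-fixed point corresponding to a vertex $v$ of the polygon is the multiplicity of the cone at $v$: the index in $\mathbb Z^2$ of the subgroup generated by the primitive lattice vectors along the two edges at $v$, i.e. the absolute value of the determinant of these two vectors (for even $d$ this differs from the Hilbert–Samuel multiplicity of the local ring). -/

import Mathlib

open scoped LinearAlgebra.Projectivization

noncomputable section

namespace ToricInterp

/-! ### Projective algebraic sets over the complex numbers

Points of projective space with coordinates indexed by `ι` are elements of `ℙ ℂ (ι → ℂ)`.
For a homogeneous polynomial the vanishing of its value at the chosen representative `p.rep`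
does not depend on the representative. -/

variable {ι κ : Type}

/-- The homogeneous vanishing ideal of a set of points of projective space. -/
def vanishingIdeal (X : Set (ℙ ℂ (ι → ℂ))) : Ideal (MvPolynomial ι ℂ) :=
  Ideal.span {f | (∃ n, f.IsHomogeneous n) ∧ ∀ p ∈ X, MvPolynomial.eval p.rep f = 0}

/-- The Zariski closure of a set of points of projective space. -/
def zariskiClosure (S : Set (ℙ ℂ (ι → ℂ))) : Set (ℙ ℂ (ι → ℂ)) :=
  {p | ∀ (n : ℕ) (f : MvPolynomial ι ℂ), f.IsHomogeneous n →
    (∀ q ∈ S, MvPolynomial.eval q.rep f = 0) → MvPolynomial.eval p.rep f = 0}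

/-- The homogeneous coordinate ring. -/
abbrev coordRing (X : Set (ℙ ℂ (ι → ℂ))) : Type :=
  MvPolynomial ι ℂ ⧸ vanishingIdeal X

/-- `X` has dimension `r`: its homogeneous coordinate ring, which is the coordinate ring of the
affine cone over `X`, has Krull dimension `r + 1`. -/
def HasDim (X : Set (ℙ ℂ (ι → ℂ))) (r : ℕ) : Prop :=
  ringKrullDim (coordRing X) = ((r + 1 : ℕ) : WithBot ℕ∞)

/-- The Hilbert function: the dimension of the degree `n` part of the coordinate ring. -/
def hilbertFunction (X : Set (ℙ ℂ (ι → ℂ))) (n : ℕ) : ℕ :=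
  Module.finrank ℂ ((MvPolynomial.homogeneousSubmodule ι ℂ n).map
    (Ideal.Quotient.mkₐ ℂ (vanishingIdeal X)).toLinearMap)

/-- `X` has degree `e`: the Hilbert polynomial has leading term `(e / r!) n ^ r`. -/
def HasDegree (X : Set (ℙ ℂ (ι → ℂ))) (e : ℕ) : Prop :=
  ∃ P : Polynomial ℚ,
    (∀ᶠ n : ℕ in Filter.atTop, (hilbertFunction X n : ℚ) = P.eval (n : ℚ)) ∧
    P.leadingCoeff * (P.natDegree.factorial : ℚ) = e

/-- The tangent space at (a representative of) `p` to the affine cone over `X`: the common kernel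
of the differentials at `p` of the polynomials in the ideal of `X`. Its projectivization is the
embedded projective tangent space of `X` at `p`. -/
def coneTangentSpace [Fintype ι] (X : Set (ℙ ℂ (ι → ℂ))) (p : ℙ ℂ (ι → ℂ)) :
    Submodule ℂ (ι → ℂ) where
  carrier := {v | ∀ f ∈ vanishingIdeal X,
    ∑ i, v i * MvPolynomial.eval p.rep (MvPolynomial.pderiv i f) = 0}
  add_mem' := by
    intro v w hv hw f hf
    simp only [Pi.add_apply, add_mul, Finset.sum_add_distrib, hv f hf, hw f hf, add_zero]
  zero_mem' := by
    intro f _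
    simp
  smul_mem' := by
    intro c v hv f hf
    simp only [Pi.smul_apply, smul_eq_mul, mul_assoc, ← Finset.mul_sum, hv f hf, mul_zero]

/-- The Jacobian criterion as a definition: a point `p` of an (irreducible) projective variety `X`
is nonsingular if the embedded tangent space at `p` has the same dimension as `X`. -/
def IsNonsingularAt [Fintype ι] (X : Set (ℙ ℂ (ι → ℂ))) (p : ℙ ℂ (ι → ℂ)) : Prop :=
  ringKrullDim (coordRing X) = ((Module.finrank ℂ (coneTangentSpace X p) : ℕ) : WithBot ℕ∞)

/-- The set of singular points. -/
def singularLocus [Fintype ι] (X : Set (ℙ ℂ (ι → ℂ))) : Set (ℙ ℂ (ι → ℂ)) :=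
  {p ∈ X | ¬ IsNonsingularAt X p}

/-! ### Normalization -/

/-- The coordinate ring of the affine chart `x_i ≠ 0` of `X`, obtained by setting `x_i = 1`. -/
abbrev chartRing (X : Set (ℙ ℂ (ι → ℂ))) (i : ι) : Type :=
  MvPolynomial ι ℂ ⧸ (vanishingIdeal X ⊔ Ideal.span {MvPolynomial.X i - 1})

/-- The homomorphism `φ` exhibits `S` as the integral closure of the domain `R` in its field of
fractions. -/
def IsNormalizationHom {R S : Type} [CommRing R] [CommRing S] (φ : R →+* S) : Prop :=
  IsDomain S ∧ IsIntegrallyClosed S ∧ Function.Injective φ ∧ φ.IsIntegral ∧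
    ∀ s : S, ∃ a b : R, b ≠ 0 ∧ φ b * s = φ a

/-- The coordinate projection `(y_k)_k ↦ (y_{e i})_i` is everywhere defined on `Y` and is the
normalization `Y → X`: over each (nonempty) affine chart `x_i ≠ 0` of `X`, whose preimage is the
affine chart `y_{e i} ≠ 0` of `Y`, it corresponds to the integral closure of the chart ring
of `X` in its field of fractions. -/
def IsNormalizationByProjection (e : ι → κ) (Y : Set (ℙ ℂ (κ → ℂ)))
    (X : Set (ℙ ℂ (ι → ℂ))) : Prop :=
  (∀ q ∈ Y, ∃ i, q.rep (e i) ≠ 0) ∧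
  ∀ i : ι, (∃ p ∈ X, p.rep i ≠ 0) →
    ∃ φ : chartRing X i →ₐ[ℂ] chartRing Y (e i),
      (∀ j : ι, φ (Ideal.Quotient.mk _ (MvPolynomial.X j)) =
        Ideal.Quotient.mk _ (MvPolynomial.X (e j))) ∧
      IsNormalizationHom φ.toRingHom

/-! ### Projective toric varieties -/

variable {m : ℕ}

/-- The vector of monomials `(t ^ a_j)_j`. -/
def monomialVector (a : ι → Fin m → ℤ) (t : Fin m → ℂˣ) : ι → ℂ :=
  fun j => ∏ i, ((t i ^ a j i : ℂˣ) : ℂ)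

/-- The toric variety `X_A` of the configuration `A` of the points `(1, a_j)`: the Zariski closure
of the set of all points `(t ^ a_j)_j` with `t` in the torus. -/
def toricVariety (a : ι → Fin m → ℤ) : Set (ℙ ℂ (ι → ℂ)) :=
  zariskiClosure {p | ∃ (t : Fin m → ℂˣ) (h : monomialVector a t ≠ 0),
    p = Projectivization.mk ℂ (monomialVector a t) h}

/-- A lattice point as a point of real space. -/
def toReal (u : Fin m → ℤ) : Fin m → ℝ := fun i => (u i : ℝ)

/-- The lattice polytope spanned by the points `a_j`. -/
def polytope (a : ι → Fin m → ℤ) : Set (Fin m → ℝ) :=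
  convexHull ℝ (Set.range fun j => toReal (a j))

/-- The set of lattice points of the polytope spanned by the points `a_j`. -/
def latticePoints (a : ι → Fin m → ℤ) : Set (Fin m → ℤ) :=
  {u | toReal u ∈ polytope a}

theorem finite_latticePoints [Finite ι] (a : ι → Fin m → ℤ) : (latticePoints a).Finite := by
  have hb : Bornology.IsBounded (polytope a) :=
    isBounded_convexHull.2 (Set.finite_range _).isBounded
  obtain ⟨R, hR⟩ := hb.exists_norm_le
  refine (Set.finite_Icc (fun _ : Fin m => -⌈R⌉) (fun _ => ⌈R⌉)).subset ?_
  intro u hu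
  have h1 : ∀ i, |(u i : ℝ)| ≤ ⌈R⌉ := fun i =>
    ((norm_le_pi_norm (toReal u) i).trans (hR _ hu)).trans (Int.le_ceil R)
  refine ⟨fun i => ?_, fun i => ?_⟩
  · have := (abs_le.1 (h1 i)).1
    exact_mod_cast this
  · have := (abs_le.1 (h1 i)).2
    exact_mod_cast this

instance [Finite ι] (a : ι → Fin m → ℤ) : Fintype (latticePoints a) :=
  (finite_latticePoints a).fintype

/-- The configuration of all lattice points in the convex hull of the configuration `a`. -/
def saturation (a : ι → Fin m → ℤ) : latticePoints a → Fin m → ℤ := fun u => u.1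

/-- Each point of the configuration `a`, as one of the lattice points of its convex hull. -/
def toLatticePoint (a : ι → Fin m → ℤ) (j : ι) : latticePoints a :=
  ⟨a j, subset_convexHull ℝ _ ⟨j, rfl⟩⟩

open Classical in
/-- The point of projective space whose only nonzero coordinate is the one with index `i`. For a
vertex of the polytope it is the corresponding torus-fixed point of the toric variety. -/
def coordPoint (i : ι) : ℙ ℂ (ι → ℂ) :=
  Projectivization.mk ℂ (Pi.single i 1) (by simp)

/-- The primitive lattice vectors along the edges of the polytope that start at `v`. -/
def edgeVectors (a : ι → Fin m → ℤ) (v : Fin m → ℤ) : Set (Fin m → ℤ) :=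
  {u | (∀ (k : ℤ) (w : Fin m → ℤ), u = k • w → IsUnit k) ∧
    ∃ n : ℕ, 0 < n ∧ IsExtreme ℝ (polytope a) (segment ℝ (toReal v) (toReal (v + n • u)))}

/-- The multiplicity of the torus-fixed point of a normal toric surface that belongs to the vertex
`v` of its polygon: the index, in the lattice, of the subgroup generated by the primitive vectors
along the edges at `v`, that is, the absolute value of the determinant of these two vectors. -/
def vertexMultiplicity (a : ι → Fin m → ℤ) (v : Fin m → ℤ) : ℕ :=
  (AddSubgroup.closure (edgeVectors a v)).index

/-! ### The second toric interpolant of the rational normal curve -/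

/-- The points `a_j = (j, j(j-1)/2)`, for `0 ≤ j ≤ d`; the columns of the matrix `A_d^{(2)}` are
the vectors `(1, a_j)`. -/
def interpolantPoints (d : ℕ) : Fin (d + 1) → Fin 2 → ℤ :=
  fun j => ![(j.1 : ℤ), ((j.1.choose 2 : ℕ) : ℤ)]

/-- The toric surface of `A_d^{(2)}`, in `d`-dimensional projective space. -/
abbrev interpolant (d : ℕ) : Set (ℙ ℂ (Fin (d + 1) → ℂ)) :=
  toricVariety (interpolantPoints d)

/-- The toric surface of the configuration of all lattice points in the convex hull of
`A_d^{(2)}`. -/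
abbrev satInterpolant (d : ℕ) : Set (ℙ ℂ (latticePoints (interpolantPoints d) → ℂ)) :=
  toricVariety (saturation (interpolantPoints d))

/-- The torus-fixed point belonging to the vertex `a_j` of the polygon. -/
abbrev fixedPoint (d : ℕ) (j : Fin (d + 1)) : ℙ ℂ (latticePoints (interpolantPoints d) → ℂ) :=
  coordPoint (toLatticePoint (interpolantPoints d) j)

end ToricInterp

end

/-! The proof turns every assertion into combinatorics of lattice points. The bridge is
`mem_vanishingIdeal_toricVariety`: the homogeneous ideal of a toric variety is the kernel of the map
sending each variable to the Laurent monomial with exponent (1, a_j), because distinct characters of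
the torus are linearly independent. Coordinate rings and chart rings thus become semigroup rings
inside Laurent polynomial rings. Conversely, a linear map whose value on a monomial depends only on
the weight kills the ideal (`linearMap_eq_zero_of_mem_ker`); points, algebra maps and tangent
vectors are all produced in this way.

The polygon has the short lower edges from a_j to a_{j+1} and one long upper edge from a_0 to a_d.
Its lattice points are the u with u_0(u_0 - 1) ≤ 2u_1 ≤ (d - 1)u_0 (`mem_latticePoints_iff`). At an
inner vertex the two short edges form a lattice basis (`innerCorner`), so only the two ends of the
long edge can be singular.

Normalization (`isNormalizationByProjection_of_lattice`): some multiple n·u of each lattice point is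
a sum of n points a_j, so the new coordinates are integral and have no base points. The points a_0,
a_1, a_2 generate the plane lattice affinely, so the fraction fields agree. The chart semigroups
consist of all lattice points of a cone, and integral elements keep their support in the cone
(`SupportGE.of_isIntegralElem`), so the charts are normal.

Dimension: three coordinates at a unimodular corner generate the others up to fractions, which
bounds the dimension of the cone by three. Killing all coordinates off the edge a_0 a_1 leaves a
polynomial ring in two variables, which gives the opposite bound.

Singularities: tangent vectors are points over the dual numbers. At a unimodular corner they are
parametrized by three coordinates (`UnimodularCorner.finrank_coneTangentSpace`). This settles the
charts of the inner vertices and the interior of the long edge. At either end, for d ≥ 4, the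
semigroup has three irreducible elements, which together with the Euler direction give a tangent
space of dimension at least four (`exists_irreducible`, `four_le_finrank_coneTangentSpace`).

For d = 3 both end corners are unimodular, and the dilates of the polygon are trapezoids with 2n² +
3n + 1 lattice points, each a sum of n lattice points of the polygon; this gives degree 4. The
multiplicities are determinants of a primitive vector (g, q) on the long edge, with g = 2 for even d
and g = 1 for odd d, against a short edge (`edgeVectors_eq`, `index_closure_pair`). -/

noncomputable section

namespace ToricInterp

variable {ι κ : Type} {m : ℕ}

/-! ### Monomial homomorphisms into group algebras -/

section MonomialHom

variable {G H : Type} [AddCommMonoid G] [AddCommMonoid H]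

/-- The homomorphism of a polynomial ring into a monoid algebra that sends the variables to the
monomials with exponents `b i`. -/
def monomialHom (b : ι → G) : MvPolynomial ι ℂ →ₐ[ℂ] AddMonoidAlgebra ℂ G :=
  MvPolynomial.aeval fun i => AddMonoidAlgebra.single (b i) 1

@[simp]
theorem monomialHom_X (b : ι → G) (i : ι) :
    monomialHom b (MvPolynomial.X i) = AddMonoidAlgebra.single (b i) 1 := by
  simp [monomialHom]

theorem monomialHom_monomial (b : ι → G) (e : ι →₀ ℕ) (c : ℂ) :
    monomialHom b (MvPolynomial.monomial e c) =
      AddMonoidAlgebra.single (Finsupp.weight b e) c := by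
  induction e using Finsupp.induction generalizing c with
  | zero =>
    simp only [map_zero]
    change monomialHom b (MvPolynomial.C c) = _
    rw [← MvPolynomial.algebraMap_eq, AlgHom.commutes]
    rfl
  | single_add i n e hi hn ih =>
    have h1 : (MvPolynomial.monomial (Finsupp.single i n + e) c : MvPolynomial ι ℂ) =
        MvPolynomial.X i ^ n * MvPolynomial.monomial e c := by
      rw [MvPolynomial.X_pow_eq_monomial, MvPolynomial.monomial_mul, one_mul]
    rw [h1, map_mul, map_pow, monomialHom_X, ih, AddMonoidAlgebra.single_pow,
      AddMonoidAlgebra.single_mul_single, map_add, Finsupp.weight_single]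
    simp

/-- The linear map on a monoid algebra with prescribed values on monomials. -/
def linearExtension {G : Type} {V : Type*} [AddCommGroup V] [Module ℂ V] (h : G → V) :
    AddMonoidAlgebra ℂ G →ₗ[ℂ] V where
  toFun x := x.coeff.sum fun g c => c • h g
  map_add' x y := by
    rw [AddMonoidAlgebra.coeff_add, Finsupp.sum_add_index'] <;> simp [add_smul]
  map_smul' c x := by
    rw [AddMonoidAlgebra.coeff_smul, Finsupp.sum_smul_index] <;>
      simp [Finsupp.smul_sum, mul_smul]

@[simp]
theorem linearExtension_single {G : Type} {V : Type*} [AddCommGroup V] [Module ℂ V] (h : G → V)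
    (g : G) (c : ℂ) : linearExtension h (AddMonoidAlgebra.single g c) = c • h g := by
  simp [linearExtension]

/-- A linear map on polynomials whose value on a monomial depends only on its weight vanishes on
the kernel of the monomial homomorphism. -/
theorem linearMap_eq_zero_of_mem_ker {V : Type*} [AddCommGroup V] [Module ℂ V] {b : ι → G}
    (L : MvPolynomial ι ℂ →ₗ[ℂ] V)
    (hL : ∀ e e' : ι →₀ ℕ, Finsupp.weight b e = Finsupp.weight b e' →
      L (MvPolynomial.monomial e 1) = L (MvPolynomial.monomial e' 1))
    {f : MvPolynomial ι ℂ} (hf : monomialHom b f = 0) : L f = 0 := by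
  classical
  -- The value of `L` on one chosen monomial of weight g; by `hL` the choice is immaterial. So `L`
  -- factors linearly through the monoid algebra, even when it is not multiplicative. Off the
  -- weights that occur, the value 0 is arbitrary.
  let h : G → V := fun g =>
    if hg : ∃ e, Finsupp.weight b e = g then L (MvPolynomial.monomial hg.choose 1) else 0
  have key : L = (linearExtension h) ∘ₗ (monomialHom b).toLinearMap := by
    refine MvPolynomial.linearMap_ext fun e => LinearMap.ext_ring ?_
    have he : ∃ e', Finsupp.weight b e' = Finsupp.weight b e := ⟨e, rfl⟩
    simp only [LinearMap.comp_apply, AlgHom.toLinearMap_apply]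
    rw [monomialHom_monomial, linearExtension_single, one_smul]
    simp only [h, dif_pos he]
    exact hL _ _ he.choose_spec.symm
  rw [key, LinearMap.comp_apply, AlgHom.toLinearMap_apply, hf, map_zero]

theorem aeval_eq_zero_of_mem_ker {R : Type*} [CommRing R] [Algebra ℂ R] {b : ι → G} (g : ι → R)
    (hg : ∀ e e' : ι →₀ ℕ, Finsupp.weight b e = Finsupp.weight b e' →
      (e.prod fun i n => g i ^ n) = e'.prod fun i n => g i ^ n)
    {f : MvPolynomial ι ℂ} (hf : monomialHom b f = 0) : MvPolynomial.aeval g f = 0 :=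
  linearMap_eq_zero_of_mem_ker (MvPolynomial.aeval g).toLinearMap
    (fun e e' h => by simp [MvPolynomial.aeval_monomial, hg e e' h]) hf

theorem eval_eq_zero_of_mem_ker {b : ι → G} (g : ι → ℂ)
    (hg : ∀ e e' : ι →₀ ℕ, Finsupp.weight b e = Finsupp.weight b e' →
      (e.prod fun i n => g i ^ n) = e'.prod fun i n => g i ^ n)
    {f : MvPolynomial ι ℂ} (hf : monomialHom b f = 0) : MvPolynomial.eval g f = 0 := by
  rw [← MvPolynomial.coe_aeval_eq_eval]
  exact aeval_eq_zero_of_mem_ker g hg hf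

/-- The coefficient functional is constant on weight classes as soon as the class of `e` is a
singleton. -/
theorem coeff_eq_zero_of_mem_ker {b : ι → G} {e : ι →₀ ℕ}
    (he : ∀ e', Finsupp.weight b e' = Finsupp.weight b e → e' = e)
    {f : MvPolynomial ι ℂ} (hf : monomialHom b f = 0) : MvPolynomial.coeff e f = 0 := by
  classical
  refine linearMap_eq_zero_of_mem_ker (MvPolynomial.lcoeff ℂ e) (fun e₁ e₂ h => ?_) hf
  have h12 : e₁ = e ↔ e₂ = e := ⟨fun h1 => he _ (by rw [← h, h1]), fun h2 => he _ (by rw [h, h2])⟩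
  simp [MvPolynomial.coeff_monomial, h12]

theorem weight_comp (φ : G →+ H) (b : ι → G) (e : ι →₀ ℕ) :
    Finsupp.weight (fun i => φ (b i)) e = φ (Finsupp.weight b e) := by
  simp [Finsupp.weight_apply, map_finsuppSum]

theorem monomialHom_comp_eq_zero {b : ι → G} (φ : G →+ H) {f : MvPolynomial ι ℂ}
    (hf : monomialHom b f = 0) : monomialHom (fun i => φ (b i)) f = 0 :=
  linearMap_eq_zero_of_mem_ker (monomialHom fun i => φ (b i)).toLinearMap
    (fun e e' h => by
      simp only [AlgHom.toLinearMap_apply]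
      rw [monomialHom_monomial, monomialHom_monomial, weight_comp, weight_comp, h]) hf

end MonomialHom

/-! ### The ideal of a toric variety -/

/-- The exponent vectors `(1, a_j)`. -/
def homogenized (a : ι → Fin m → ℤ) : ι → ℤ × (Fin m → ℤ) := fun j => (1, a j)

/-- The exponent vectors `a_j - v`. -/
def translated (a : ι → Fin m → ℤ) (v : Fin m → ℤ) : ι → Fin m → ℤ := fun j => a j - v

theorem weight_homogenized (a : ι → Fin m → ℤ) (e : ι →₀ ℕ) :
    Finsupp.weight (homogenized a) e = ((e.degree : ℤ), Finsupp.weight a e) := by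
  refine Prod.ext ?_ ?_
  · simp [Finsupp.weight_apply, Finsupp.sum, Prod.fst_sum, homogenized, Finsupp.degree_apply]
  · simp [Finsupp.weight_apply, Finsupp.sum, Prod.snd_sum, homogenized]

theorem weight_homogenized_eq_iff (a : ι → Fin m → ℤ) (e e' : ι →₀ ℕ) :
    Finsupp.weight (homogenized a) e = Finsupp.weight (homogenized a) e' ↔
      e.degree = e'.degree ∧ Finsupp.weight a e = Finsupp.weight a e' := by
  simp [weight_homogenized]

theorem weight_translated (a : ι → Fin m → ℤ) (v : Fin m → ℤ) (e : ι →₀ ℕ) :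
    Finsupp.weight (translated a v) e = Finsupp.weight a e - e.degree • v := by
  simp [Finsupp.weight_apply, Finsupp.sum, translated, smul_sub, Finsupp.degree_apply, Finset.sum_smul]

/-- The additive map (n, w) ↦ w - n v carries homogenized weights to translated ones. -/
theorem monomialHom_translated_eq_zero {a : ι → Fin m → ℤ} (v : Fin m → ℤ)
    {f : MvPolynomial ι ℂ} (hf : monomialHom (homogenized a) f = 0) :
    monomialHom (translated a v) f = 0 := by
  have := monomialHom_comp_eq_zero
    (AddMonoidHom.mk' (fun p : ℤ × (Fin m → ℤ) => p.2 - p.1 • v) (by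
      intro p q; simp only [Prod.snd_add, Prod.fst_add, add_smul]; abel)) hf
  have h1 : translated a v = fun i => a i - v := rfl
  simpa [homogenized, h1] using this

/-- In a fixed degree n no information is lost by dehomogenizing: w ↦ (n, w + n v) recovers the
homogenized weight. -/
theorem monomialHom_homogenized_eq_zero {a : ι → Fin m → ℤ} (v : Fin m → ℤ)
    {f : MvPolynomial ι ℂ} {n : ℕ} (hn : f.IsHomogeneous n)
    (hf : monomialHom (translated a v) f = 0) : monomialHom (homogenized a) f = 0 := by
  let L : AddMonoidAlgebra ℂ (Fin m → ℤ) →ₗ[ℂ] AddMonoidAlgebra ℂ (ℤ × (Fin m → ℤ)) :=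
    linearExtension fun w => AddMonoidAlgebra.single ((n : ℤ), w + n • v) 1
  have key : L (monomialHom (translated a v) f) = monomialHom (homogenized a) f := by
    rw [f.as_sum]
    simp only [map_sum]
    refine Finset.sum_congr rfl fun e he => ?_
    have hdeg : e.degree = n := by
      have h1 := hn (MvPolynomial.mem_support_iff.1 he)
      rw [← h1, Finsupp.degree_eq_weight_one]
      rfl
    rw [monomialHom_monomial, monomialHom_monomial, linearExtension_single, weight_homogenized,
      weight_translated, hdeg]
    simp
  rw [← key, hf, map_zero]

theorem homogeneousComponent_mem_ker {a : ι → Fin m → ℤ} {f : MvPolynomial ι ℂ}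
    (hf : monomialHom (homogenized a) f = 0) (n : ℕ) :
    monomialHom (homogenized a) (MvPolynomial.homogeneousComponent n f) = 0 := by
  refine linearMap_eq_zero_of_mem_ker
    ((monomialHom (homogenized a)).toLinearMap ∘ₗ MvPolynomial.homogeneousComponent n)
    (fun e e' h => ?_) hf
  have hd := ((weight_homogenized_eq_iff a e e').1 h).1
  simp only [LinearMap.comp_apply, AlgHom.toLinearMap_apply]
  by_cases hn : e.degree = n
  · rw [MvPolynomial.homogeneousComponent_of_mem (m := n) (n := e.degree),
      MvPolynomial.homogeneousComponent_of_mem (m := n) (n := e.degree), if_pos hn.symm,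
      if_pos hn.symm, monomialHom_monomial, monomialHom_monomial, h]
    · exact MvPolynomial.isHomogeneous_monomial _ hd.symm
    · exact MvPolynomial.isHomogeneous_monomial _ rfl
  · rw [MvPolynomial.homogeneousComponent_of_mem (m := n) (n := e.degree),
      MvPolynomial.homogeneousComponent_of_mem (m := n) (n := e.degree), if_neg (Ne.symm hn),
      if_neg (Ne.symm hn)]
    · exact MvPolynomial.isHomogeneous_monomial _ hd.symm
    · exact MvPolynomial.isHomogeneous_monomial _ rfl

/-- The character `t ↦ t ^ w` of the torus. -/
def torusCharacter (w : Fin m → ℤ) : (Fin m → ℂˣ) →* ℂ :=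
  (Units.coeHom ℂ).comp
    { toFun := fun t => ∏ i, t i ^ w i
      map_one' := by simp
      map_mul' := fun s t => by simp [mul_zpow, Finset.prod_mul_distrib] }

theorem torusCharacter_injective : Function.Injective (torusCharacter (m := m)) := by
  classical
  intro w w' h
  funext i
  -- The torus element with 2 in place i and 1 elsewhere isolates the exponent `w i`, because the
  -- integral powers of 2 are distinct.
  have h2 := DFunLike.congr_fun h (Pi.mulSingle i (Units.mk0 2 two_ne_zero))
  have h3 : ∀ w : Fin m → ℤ, torusCharacter w (Pi.mulSingle i (Units.mk0 2 two_ne_zero)) =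
      (2 : ℂ) ^ w i := by
    intro w
    change ((∏ j, _ : ℂˣ) : ℂ) = _
    rw [Finset.prod_eq_single i]
    · simp
    · intro j _ hj
      simp [hj]
    · simp
  rw [h3, h3] at h2
  have h4 : ((2 : ℝ) : ℂ) ^ w i = ((2 : ℝ) : ℂ) ^ w' i := by simpa using h2
  rw [← Complex.ofReal_zpow, ← Complex.ofReal_zpow] at h4
  exact zpow_right_injective₀ (by norm_num) (by norm_num) (Complex.ofReal_injective h4)

theorem monomialVector_eq (a : ι → Fin m → ℤ) (t : Fin m → ℂˣ) (j : ι) :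
    monomialVector a t j = torusCharacter (a j) t := by
  simp [monomialVector, torusCharacter]

theorem torusCharacter_add (v w : Fin m → ℤ) (t : Fin m → ℂˣ) :
    torusCharacter (v + w) t = torusCharacter v t * torusCharacter w t := by
  simp [torusCharacter, zpow_add, Finset.prod_mul_distrib]

theorem torusCharacter_weight (a : ι → Fin m → ℤ) (t : Fin m → ℂˣ) (e : ι →₀ ℕ) :
    (e.prod fun j n => monomialVector a t j ^ n) = torusCharacter (Finsupp.weight a e) t := by
  induction e using Finsupp.induction with
  | zero => simp [torusCharacter]
  | single_add i n e hi hn ih =>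
    rw [Finsupp.prod_add_index' (by simp) (by simp [pow_add]), ih, map_add, torusCharacter_add,
      Finsupp.weight_single, Finsupp.prod_single_index (by simp), monomialVector_eq]
    congr 1
    simp [torusCharacter, Finset.prod_pow, zpow_mul, mul_comm]

theorem monomialVector_ne_zero [Nonempty ι] (a : ι → Fin m → ℤ) (t : Fin m → ℂˣ) :
    monomialVector a t ≠ 0 := by
  intro h
  have h1 := congrFun h (Classical.arbitrary ι)
  rw [monomialVector_eq] at h1
  exact Units.ne_zero _ h1

theorem prod_smul_pow (c : ℂ) (g : ι → ℂ) (e : ι →₀ ℕ) :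
    (e.prod fun j n => (c • g) j ^ n) = c ^ e.degree * e.prod fun j n => g j ^ n := by
  simp [Finsupp.prod, mul_pow, Finset.prod_mul_distrib, Finset.prod_pow_eq_pow_sum, Finsupp.degree_apply]

theorem eval_smul_of_isHomogeneous {f : MvPolynomial ι ℂ} {n : ℕ} (hf : f.IsHomogeneous n)
    (c : ℂ) (g : ι → ℂ) : MvPolynomial.eval (c • g) f = c ^ n * MvPolynomial.eval g f := by
  rw [MvPolynomial.eval_eq, MvPolynomial.eval_eq, Finset.mul_sum]
  refine Finset.sum_congr rfl fun e he => ?_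
  have hdeg : e.degree = n := by
    have h1 := hf (MvPolynomial.mem_support_iff.1 he)
    rw [← h1, Finsupp.degree_eq_weight_one]
    rfl
  have := prod_smul_pow c g e
  simp only [Finsupp.prod] at this
  rw [this, hdeg]
  ring

/-- Dedekind's independence of characters: on the torus, `f` is the linear combination of characters
whose coefficients are those of its image. -/
theorem monomialHom_eq_zero_of_eval [Nonempty ι] {a : ι → Fin m → ℤ} {f : MvPolynomial ι ℂ}
    (hf : ∀ t, MvPolynomial.eval (monomialVector a t) f = 0) : monomialHom a f = 0 := by
  have hli := (linearIndependent_monoidHom (Fin m → ℂˣ) ℂ).comp _ (torusCharacter_injective (m := m))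
  have key : ∀ x : AddMonoidAlgebra ℂ (Fin m → ℤ), ∀ t,
      (Finsupp.linearCombination ℂ
        (fun w => (torusCharacter w : (Fin m → ℂˣ) → ℂ)) x.coeff) t =
      linearExtension (fun w => torusCharacter w t) x := by
    intro x t
    simp [Finsupp.linearCombination_apply, Finsupp.sum, linearExtension]
  have hev : ∀ t, linearExtension (fun w => torusCharacter w t) (monomialHom a f) = 0 := by
    intro t
    rw [← hf t]
    conv_rhs => rw [← MvPolynomial.coe_aeval_eq_eval]
    have : (linearExtension fun w => torusCharacter w t) ∘ₗ (monomialHom a).toLinearMap =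
        (MvPolynomial.aeval (monomialVector a t)).toLinearMap := by
      refine MvPolynomial.linearMap_ext fun e => LinearMap.ext_ring ?_
      simp only [LinearMap.comp_apply, AlgHom.toLinearMap_apply]
      rw [monomialHom_monomial, linearExtension_single, one_smul, MvPolynomial.aeval_monomial,
        torusCharacter_weight]
      simp
    exact LinearMap.congr_fun this f
  have h0 := (linearIndependent_iff.1 hli) (monomialHom a f).coeff (by
    funext t
    exact (key _ t).trans (hev t))
  exact AddMonoidAlgebra.coeff_injective (by simpa using h0)

/-- The binomials span the ideal, so a point that satisfies them all lies on the variety. -/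
theorem mem_toricVariety_of_prod [Nonempty ι] {a : ι → Fin m → ℤ} {p : ℙ ℂ (ι → ℂ)}
    (hp : ∀ e e' : ι →₀ ℕ, e.degree = e'.degree → Finsupp.weight a e = Finsupp.weight a e' →
      (e.prod fun i n => p.rep i ^ n) = e'.prod fun i n => p.rep i ^ n) :
    p ∈ toricVariety a := by
  intro n f hn hf
  refine eval_eq_zero_of_mem_ker (b := homogenized a) _ (fun e e' h => ?_) ?_
  · rw [weight_homogenized_eq_iff] at h
    exact hp e e' h.1 h.2
  · refine monomialHom_homogenized_eq_zero 0 hn ?_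
    have : translated a 0 = a := by funext j; simp [translated]
    rw [this]
    refine monomialHom_eq_zero_of_eval fun t => ?_
    have h1 := hf _ ⟨t, monomialVector_ne_zero a t, rfl⟩
    obtain ⟨c, hc⟩ := Projectivization.exists_smul_eq_mk_rep ℂ _ (monomialVector_ne_zero a t)
    rw [← hc, Units.smul_def, eval_smul_of_isHomogeneous hn] at h1
    exact (mul_eq_zero.1 h1).resolve_left (pow_ne_zero _ c.ne_zero)

theorem eval_rep_of_mem_vanishingIdeal {X : Set (ℙ ℂ (ι → ℂ))} {p : ℙ ℂ (ι → ℂ)} (hp : p ∈ X)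
    {f : MvPolynomial ι ℂ} (hf : f ∈ vanishingIdeal X) : MvPolynomial.eval p.rep f = 0 := by
  have : vanishingIdeal X ≤ RingHom.ker (MvPolynomial.eval p.rep) :=
    Ideal.span_le.2 fun f hf => hf.2 p hp
  exact this hf

/-- One direction tests homogeneous generators on torus points. The other splits an element of the
kernel into homogeneous components, which stay in the kernel since the degree is part of the weight.
-/
theorem mem_vanishingIdeal_toricVariety [Nonempty ι] (a : ι → Fin m → ℤ) (f : MvPolynomial ι ℂ) :
    f ∈ vanishingIdeal (toricVariety a) ↔ monomialHom (homogenized a) f = 0 := by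
  constructor
  · intro hf
    have : vanishingIdeal (toricVariety a) ≤
        RingHom.ker (monomialHom (homogenized a)).toRingHom := by
      refine Ideal.span_le.2 ?_
      rintro f ⟨⟨n, hn⟩, hf⟩
      refine monomialHom_homogenized_eq_zero 0 hn ?_
      have h0 : translated a 0 = a := by funext j; simp [translated]
      rw [h0]
      refine monomialHom_eq_zero_of_eval fun t => ?_
      have hmem : Projectivization.mk ℂ (monomialVector a t) (monomialVector_ne_zero a t) ∈
          toricVariety a := fun n f _ hf => hf _ ⟨t, monomialVector_ne_zero a t, rfl⟩
      have h1 := hf _ hmem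
      obtain ⟨c, hc⟩ := Projectivization.exists_smul_eq_mk_rep ℂ _ (monomialVector_ne_zero a t)
      rw [← hc, Units.smul_def, eval_smul_of_isHomogeneous hn] at h1
      exact (mul_eq_zero.1 h1).resolve_left (pow_ne_zero _ c.ne_zero)
    exact this hf
  · intro hf
    rw [← MvPolynomial.sum_homogeneousComponent f]
    refine Ideal.sum_mem _ fun n _ => Ideal.subset_span
      ⟨⟨n, MvPolynomial.homogeneousComponent_isHomogeneous n f⟩, fun p hp => ?_⟩
    refine hp n _ (MvPolynomial.homogeneousComponent_isHomogeneous n f) ?_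
    rintro q ⟨t, ht, rfl⟩
    refine eval_eq_zero_of_mem_ker _ (fun e e' h => ?_) (homogeneousComponent_mem_ker hf n)
    rw [weight_homogenized_eq_iff] at h
    obtain ⟨c, hc⟩ := Projectivization.exists_smul_eq_mk_rep ℂ _ ht
    rw [← hc, Units.smul_def, prod_smul_pow, prod_smul_pow, torusCharacter_weight,
      torusCharacter_weight, h.1, h.2]

/-! ### Integral closedness of rings of Laurent polynomials with prescribed supports -/

/-- A fraction integral over `R` becomes integral over `L`, hence an element of `L`, since `L` is
normal. It is still integral over `R`, so it suffices that `R` is integrally closed inside `L`. -/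
theorem isIntegrallyClosed_of_injective {R L : Type*} [CommRing R] [IsDomain R] [CommRing L]
    [IsDomain L] [IsIntegrallyClosed L] (ψ : R →+* L) (hψ : Function.Injective ψ)
    (h : ∀ x : L, ψ.IsIntegralElem x → x ∈ ψ.range) : IsIntegrallyClosed R := by
  rw [isIntegrallyClosed_iff (FractionRing R)]
  rintro x ⟨p, hp, hpx⟩
  let Ψ : FractionRing R →+* FractionRing L := IsFractionRing.map hψ
  have hΨ : ∀ r, Ψ (algebraMap R _ r) = algebraMap L _ (ψ r) := fun r =>
    IsLocalization.map_eq _ r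
  have hcomp : Ψ.comp (algebraMap R (FractionRing R)) =
      (algebraMap L (FractionRing L)).comp ψ := RingHom.ext hΨ
  have h1 : ((p.map ψ).eval₂ (algebraMap L (FractionRing L)) (Ψ x)) = 0 := by
    rw [Polynomial.eval₂_map, ← hcomp, ← Polynomial.hom_eval₂, hpx, map_zero]
  obtain ⟨s, hs⟩ := (isIntegrallyClosed_iff (FractionRing L)).1 inferInstance
    (⟨p.map ψ, hp.map ψ, h1⟩ : IsIntegral L (Ψ x))
  have h2 : ψ.IsIntegralElem s := by
    refine ⟨p, hp, IsFractionRing.injective L (FractionRing L) ?_⟩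
    rw [map_zero, Polynomial.hom_eval₂, hs, ← Polynomial.eval₂_map, h1]
  obtain ⟨y, hy⟩ := h s h2
  refine ⟨y, Ψ.injective ?_⟩
  rw [hΨ, hy, hs]

/-- The exponent vectors of the coordinates of the torus. -/
def standardExponents (m : ℕ) : Fin m → Fin m → ℤ := fun i => Pi.single i 1

theorem weight_standardExponents (e : Fin m →₀ ℕ) (i : Fin m) :
    Finsupp.weight (standardExponents m) e i = e i := by
  classical
  rw [Finsupp.weight_eq_sum, Finset.sum_apply, Finset.sum_eq_single i]
  · simp [standardExponents]
  · intro j _ hj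
    simp [standardExponents, Pi.single_eq_of_ne hj.symm]
  · simp

theorem monomialHom_standardExponents_injective :
    Function.Injective (monomialHom (standardExponents m)) := by
  rw [injective_iff_map_eq_zero]
  intro f hf
  ext e
  rw [MvPolynomial.coeff_zero]
  refine coeff_eq_zero_of_mem_ker (fun e' h => Finsupp.ext fun i => ?_) hf
  have := congrFun h i
  rw [weight_standardExponents, weight_standardExponents] at this
  exact_mod_cast this

/-- Laurent polynomials inherit normality from the polynomial ring through this localization. -/
theorem isLocalization_laurent :
    letI := (monomialHom (standardExponents m)).toRingHom.toAlgebra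
    IsLocalization.Away (∏ i, MvPolynomial.X i : MvPolynomial (Fin m) ℂ)
      (AddMonoidAlgebra ℂ (Fin m → ℤ)) := by
  let _ := (monomialHom (standardExponents m)).toRingHom.toAlgebra
  have hmap : ∀ f : MvPolynomial (Fin m) ℂ,
      algebraMap (MvPolynomial (Fin m) ℂ) (AddMonoidAlgebra ℂ (Fin m → ℤ)) f =
        monomialHom (standardExponents m) f := fun f => rfl
  have hprod : (∏ i, MvPolynomial.X i : MvPolynomial (Fin m) ℂ) =
      MvPolynomial.monomial (Finsupp.equivFunOnFinite.symm fun _ => 1) 1 := by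
    rw [MvPolynomial.monomial_eq, Finsupp.prod_fintype _ _ (by simp)]
    simp
  have himg : ∀ n : ℕ, monomialHom (standardExponents m)
      ((∏ i, MvPolynomial.X i : MvPolynomial (Fin m) ℂ) ^ n) =
        AddMonoidAlgebra.single (fun _ => (n : ℤ)) 1 := by
    intro n
    rw [hprod, MvPolynomial.monomial_pow, monomialHom_monomial, one_pow]
    congr 1
    funext i
    rw [weight_standardExponents]
    simp
  refine IsLocalization.Away.mk _ ?_ ?_ ?_
  · rw [hmap, ← pow_one (∏ i, MvPolynomial.X i : MvPolynomial (Fin m) ℂ), himg]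
    refine IsUnit.of_mul_eq_one (AddMonoidAlgebra.single (fun _ => (-1 : ℤ)) 1) ?_
    rw [AddMonoidAlgebra.single_mul_single, AddMonoidAlgebra.one_def]
    congr 1
    simp
  · intro z
    induction z using AddMonoidAlgebra.induction_linear with
    | zero => exact ⟨0, 0, by simp⟩
    | add x y hx hy =>
      obtain ⟨n, f, hf⟩ := hx
      obtain ⟨k, g, hg⟩ := hy
      refine ⟨n + k, f * (∏ i, MvPolynomial.X i) ^ k + g * (∏ i, MvPolynomial.X i) ^ n, ?_⟩
      rw [map_add, map_mul, map_mul, map_pow, map_pow, ← hf, ← hg]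
      ring
    | single w c =>
      -- Adding the sum of all absolute values to every exponent makes all of them nonnegative at
      -- once.
      refine ⟨∑ i, (w i).natAbs, MvPolynomial.monomial (Finsupp.equivFunOnFinite.symm
        fun i => (w i + (∑ i, (w i).natAbs : ℕ)).toNat) c, ?_⟩
      rw [← map_pow, hmap, hmap, himg, monomialHom_monomial, AddMonoidAlgebra.single_mul_single,
        mul_one]
      congr 1
      funext i
      rw [weight_standardExponents]
      have : (w i).natAbs ≤ ∑ i, (w i).natAbs :=
        Finset.single_le_sum (f := fun i => (w i).natAbs) (fun _ _ => Nat.zero_le _)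
          (Finset.mem_univ i)
      simp only [Pi.add_apply, Finsupp.equivFunOnFinite_symm_apply_apply]
      omega
  · intro f g hfg
    exact ⟨0, by rw [monomialHom_standardExponents_injective hfg]⟩

instance isIntegrallyClosed_laurent : IsIntegrallyClosed (AddMonoidAlgebra ℂ (Fin m → ℤ)) := by
  let _ := (monomialHom (standardExponents m)).toRingHom.toAlgebra
  have := isLocalization_laurent (m := m)
  refine isIntegrallyClosed_of_isLocalization (R := MvPolynomial (Fin m) ℂ)
    (S := AddMonoidAlgebra ℂ (Fin m → ℤ))
    (Submonoid.powers (∏ i, MvPolynomial.X i : MvPolynomial (Fin m) ℂ)) ?_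
  rw [Submonoid.powers_le]
  exact mem_nonZeroDivisors_of_ne_zero (Finset.prod_ne_zero_iff.2 fun i _ => MvPolynomial.X_ne_zero i)

section Supports

variable {G : Type} [AddCommGroup G]

/-- The Laurent polynomials all of whose exponents satisfy `c ≤ l w`. -/
def SupportGE (l : G →+ ℤ) (c : ℤ) (x : AddMonoidAlgebra ℂ G) : Prop :=
  ∀ w, x.coeff w ≠ 0 → c ≤ l w

theorem SupportGE.add {l : G →+ ℤ} {c : ℤ} {x y : AddMonoidAlgebra ℂ G} (hx : SupportGE l c x)
    (hy : SupportGE l c y) : SupportGE l c (x + y) := by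
  intro w hw
  by_contra h
  refine hw ?_
  rw [AddMonoidAlgebra.coeff_add, Finsupp.add_apply, not_not.1 (mt (hx w) h),
    not_not.1 (mt (hy w) h), add_zero]

theorem supportGE_zero (l : G →+ ℤ) (c : ℤ) : SupportGE l c 0 := by
  intro w hw
  simp at hw

theorem supportGE_single {l : G →+ ℤ} {c : ℤ} {w : G} (h : c ≤ l w) (r : ℂ) :
    SupportGE l c (AddMonoidAlgebra.single w r) := by
  classical
  intro v hv
  rw [AddMonoidAlgebra.coeff_single, Finsupp.single_apply] at hv
  obtain rfl : w = v := by
    by_contra hne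
    simp [hne] at hv
  exact h

theorem SupportGE.sum {α : Type*} {l : G →+ ℤ} {c : ℤ} (s : Finset α)
    {f : α → AddMonoidAlgebra ℂ G} (hf : ∀ a ∈ s, SupportGE l c (f a)) :
    SupportGE l c (∑ a ∈ s, f a) := by
  classical
  induction s using Finset.induction with
  | empty => simpa using supportGE_zero l c
  | insert a s ha ih =>
    rw [Finset.sum_insert ha]
    exact (hf a (by simp)).add (ih fun b hb => hf b (by simp [hb]))

theorem SupportGE.mul {l : G →+ ℤ} {c c' : ℤ} {x y : AddMonoidAlgebra ℂ G} (hx : SupportGE l c x)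
    (hy : SupportGE l c' y) : SupportGE l (c + c') (x * y) := by
  rw [AddMonoidAlgebra.mul_def]
  refine SupportGE.sum _ fun a ha => SupportGE.sum _ fun b hb => supportGE_single ?_ _
  rw [map_add]
  exact add_le_add (hx a (Finsupp.mem_support_iff.1 ha)) (hy b (Finsupp.mem_support_iff.1 hb))

theorem SupportGE.pow {l : G →+ ℤ} {c : ℤ} {x : AddMonoidAlgebra ℂ G} (hx : SupportGE l c x)
    (n : ℕ) : SupportGE l (n * c) (x ^ n) := by
  induction n with
  | zero => simpa [AddMonoidAlgebra.one_def] using supportGE_single (l := l) (c := 0) (w := 0) (by simp) 1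
  | succ n ih =>
    rw [pow_succ]
    convert ih.mul hx using 1
    push_cast
    ring

/-- The least term of a power is the power of the least term: for an order compatible with addition,
it arises from only one product of terms, so nothing cancels it. -/
theorem coeff_nsmul_pow_of_isLeast {Γ : Type*} [AddCommMonoid Γ] [LinearOrder Γ]
    [IsOrderedCancelAddMonoid Γ] {D : G →+ Γ} (hD : Function.Injective D)
    {x : AddMonoidAlgebra ℂ G} {w : G} (hw : ∀ v, x.coeff v ≠ 0 → D w ≤ D v) (n : ℕ) :
    (x ^ n).coeff (n • w) = x.coeff w ^ n ∧ ∀ v, (x ^ n).coeff v ≠ 0 → D (n • w) ≤ D v := by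
  classical
  induction n with
  | zero =>
    refine ⟨by simp [AddMonoidAlgebra.one_def], fun v hv => ?_⟩
    rw [pow_zero, AddMonoidAlgebra.one_def, AddMonoidAlgebra.coeff_single,
      Finsupp.single_apply] at hv
    have : (0 : G) = v := by
      by_contra hne
      simp [hne] at hv
    simp [← this]
  | succ n ih =>
    have hu : UniqueAdd (x ^ n).coeff.support x.coeff.support (n • w) w := by
      intro a b ha hb hab
      have h1 := ih.2 a (Finsupp.mem_support_iff.1 ha)
      have h2 := hw b (Finsupp.mem_support_iff.1 hb)
      have h3 : D a + D b = D (n • w) + D w := by rw [← map_add, hab, map_add]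
      have h4 : D (n • w) = D a := by
        refine le_antisymm h1 ?_
        by_contra hlt
        exact absurd h3 (ne_of_gt (add_lt_add_of_lt_of_le (not_le.1 hlt) h2))
      have h5 : n • w = a := hD h4
      subst h5
      exact ⟨rfl, add_left_cancel hab⟩
    refine ⟨?_, fun v hv => ?_⟩
    · rw [pow_succ, succ_nsmul, AddMonoidAlgebra.coeff_mul_add_of_uniqueAdd hu, ih.1, pow_succ]
    · by_contra hlt
      refine hv ?_
      rw [pow_succ, AddMonoidAlgebra.coeff_mul]
      refine Finset.sum_eq_zero fun a ha => Finset.sum_eq_zero fun b hb => if_neg ?_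
      rintro rfl
      refine hlt ?_
      rw [succ_nsmul, map_add, map_add]
      exact add_le_add (ih.2 a (Finsupp.mem_support_iff.1 ha))
        (hw b (Finsupp.mem_support_iff.1 hb))

/-- A Laurent polynomial that is integral over a ring of Laurent polynomials with support in a
half-space has its support in this half-space. -/
theorem SupportGE.of_isIntegralElem {R : Type*} [CommRing R] (ψ : R →+* AddMonoidAlgebra ℂ G)
    {l l' : G →+ ℤ} (hl : Function.Injective fun w => (l w, l' w))
    (hψ : ∀ r, SupportGE l 0 (ψ r)) {x : AddMonoidAlgebra ℂ G} (hx : ψ.IsIntegralElem x) :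
    SupportGE l 0 x := by
  classical
  -- The order is by `l` first; `l'` only breaks ties, so that the least exponent is unique.
  let D : G →+ Lex (ℤ × ℤ) := AddMonoidHom.mk' (fun w => toLex (l w, l' w)) (by
    intro v w
    simp only [map_add]
    rfl)
  have hD : Function.Injective D := fun v w h => hl (toLex.injective h)
  by_cases hx0 : x.coeff.support.Nonempty
  swap
  · intro w hw
    exact absurd ⟨w, Finsupp.mem_support_iff.2 hw⟩ hx0
  obtain ⟨w, hw, hmin⟩ := x.coeff.support.exists_min_image D hx0
  have hmin' : ∀ v, x.coeff v ≠ 0 → D w ≤ D v := fun v hv =>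
    hmin v (Finsupp.mem_support_iff.2 hv)
  have hlmin : SupportGE l (l w) x := by
    intro v hv
    have := hmin' v hv
    rcases (Prod.Lex.le_iff).1 this with h | h
    · exact h.le
    · exact h.1.le
  by_cases h0 : 0 ≤ l w
  · exact fun v hv => h0.trans (hlmin v hv)
  exfalso
  obtain ⟨p, hp, hpx⟩ := hx
  have hcoeff := (coeff_nsmul_pow_of_isLeast hD hmin' p.natDegree).1
  have hne : (x ^ p.natDegree).coeff (p.natDegree • w) ≠ 0 := by
    rw [hcoeff]
    exact pow_ne_zero _ (Finsupp.mem_support_iff.1 hw)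
  have hsum : x ^ p.natDegree =
      ∑ i ∈ Finset.range p.natDegree, ψ (-p.coeff i) * x ^ i := by
    rw [Polynomial.eval₂_eq_sum_range, Finset.sum_range_succ, hp.coeff_natDegree, map_one,
      one_mul] at hpx
    rw [eq_neg_of_add_eq_zero_right hpx, ← Finset.sum_neg_distrib]
    exact Finset.sum_congr rfl fun i _ => by rw [map_neg, neg_mul]
  -- With l w < 0, the lower powers of `x` cannot reach the value natDegree · l w attained by the
  -- least term of the top power. The subtraction is in ℤ, so degree zero needs no separate
  -- treatment.
  have hge : SupportGE l ((p.natDegree - 1 : ℤ) * l w) (x ^ p.natDegree) := by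
    rw [hsum]
    refine SupportGE.sum _ fun i hi => ?_
    have h1 := (hψ (-p.coeff i)).mul (hlmin.pow i)
    intro v hv
    refine le_trans ?_ (h1 v hv)
    have hi' : (i : ℤ) ≤ p.natDegree - 1 := by
      have := Finset.mem_range.1 hi
      omega
    nlinarith
  have := hge _ hne
  rw [map_nsmul, nsmul_eq_mul] at this
  nlinarith

end Supports

/-! ### Affine charts of toric varieties -/

theorem monomial_mem_of_congr {R : Type*} [CommRing R] (i : ι) (e : ι →₀ ℕ) (n : ℕ) (c : R) :
    MvPolynomial.monomial (e + Finsupp.single i n) c - MvPolynomial.monomial e c ∈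
      Ideal.span {(MvPolynomial.X i - 1 : MvPolynomial ι R)} := by
  have h1 : (MvPolynomial.monomial (e + Finsupp.single i n) c : MvPolynomial ι R) =
      MvPolynomial.monomial e c * MvPolynomial.X i ^ n := by
    rw [MvPolynomial.X_pow_eq_monomial, MvPolynomial.monomial_mul, mul_one]
  rw [h1, ← mul_sub_one, Ideal.mem_span_singleton]
  exact Dvd.dvd.mul_left 
    (by simpa using sub_dvd_pow_sub_pow (MvPolynomial.X i : MvPolynomial ι R) 1 n) _

/-- Setting x_i = 1 amounts to subtracting a_i from all exponents. For the converse, `f` is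
homogenized with powers of x_i, which changes it only modulo x_i - 1. -/
theorem mem_chartIdeal [Nonempty ι] (a : ι → Fin m → ℤ) (i : ι) (f : MvPolynomial ι ℂ) :
    f ∈ vanishingIdeal (toricVariety a) ⊔ Ideal.span {MvPolynomial.X i - 1} ↔
      monomialHom (translated a (a i)) f = 0 := by
  have hle : vanishingIdeal (toricVariety a) ⊔ Ideal.span {MvPolynomial.X i - 1} ≤
      RingHom.ker (monomialHom (translated a (a i))).toRingHom := by
    refine sup_le (fun f hf => ?_) ?_
    · exact monomialHom_translated_eq_zero _ ((mem_vanishingIdeal_toricVariety a f).1 hf)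
    · rw [Ideal.span_le, Set.singleton_subset_iff]
      change monomialHom (translated a (a i)) (MvPolynomial.X i - 1) = 0
      rw [map_sub, monomialHom_X, map_one, AddMonoidAlgebra.one_def, translated, sub_self, sub_self]
  refine ⟨fun hf => hle hf, fun hf => ?_⟩
  have hdeg : ∀ e ∈ f.support, e.degree ≤ f.totalDegree := fun e he => by
    have := MvPolynomial.le_totalDegree he
    rwa [Finsupp.degree_apply]
  let f' : MvPolynomial ι ℂ := ∑ e ∈ f.support,
    MvPolynomial.monomial (e + Finsupp.single i (f.totalDegree - e.degree)) (f.coeff e)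
  have hsub : f' - f ∈ Ideal.span {(MvPolynomial.X i - 1 : MvPolynomial ι ℂ)} := by
    have : f' - f = ∑ e ∈ f.support,
        (MvPolynomial.monomial (e + Finsupp.single i (f.totalDegree - e.degree)) (f.coeff e) -
          MvPolynomial.monomial e (f.coeff e)) := by
      rw [Finset.sum_sub_distrib, ← f.as_sum]
    rw [this]
    exact Ideal.sum_mem _ fun e _ => monomial_mem_of_congr i e _ _
  have hhom : f'.IsHomogeneous f.totalDegree := by
    refine MvPolynomial.IsHomogeneous.sum _ _ _ fun e he => ?_
    refine MvPolynomial.isHomogeneous_monomial _ ?_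
    rw [map_add, Finsupp.degree_single]
    have := hdeg e he
    omega
  have h1 : monomialHom (translated a (a i)) f' = 0 := by
    have h2 : monomialHom (translated a (a i)) (f' - f) = 0 := hle (Ideal.mem_sup_right hsub)
    rwa [map_sub, hf, sub_zero] at h2
  have h3 : f' ∈ vanishingIdeal (toricVariety a) :=
    (mem_vanishingIdeal_toricVariety a f').2 (monomialHom_homogenized_eq_zero _ hhom h1)
  have h4 : f = f' - (f' - f) := by ring
  rw [h4]
  exact sub_mem (Ideal.mem_sup_left h3) (Ideal.mem_sup_right hsub)

/-- The embedding of a chart ring of a toric variety into the ring of Laurent polynomials. -/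
def chartEmbedding [Nonempty ι] (a : ι → Fin m → ℤ) (i : ι) :
    chartRing (toricVariety a) i →ₐ[ℂ] AddMonoidAlgebra ℂ (Fin m → ℤ) :=
  Ideal.Quotient.liftₐ _ (monomialHom (translated a (a i))) fun f hf =>
    (mem_chartIdeal a i f).1 hf

theorem chartEmbedding_mk [Nonempty ι] (a : ι → Fin m → ℤ) (i : ι) (f : MvPolynomial ι ℂ) :
    chartEmbedding a i (Ideal.Quotient.mk _ f) = monomialHom (translated a (a i)) f := rfl

theorem chartEmbedding_injective [Nonempty ι] (a : ι → Fin m → ℤ) (i : ι) :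
    Function.Injective (chartEmbedding a i) := by
  rw [injective_iff_map_eq_zero]
  intro x hx
  obtain ⟨f, rfl⟩ := Ideal.Quotient.mk_surjective x
  rw [chartEmbedding_mk] at hx
  exact Ideal.Quotient.eq_zero_iff_mem.2 ((mem_chartIdeal a i f).2 hx)

instance isDomain_chartRing [Nonempty ι] (a : ι → Fin m → ℤ) (i : ι) :
    IsDomain (chartRing (toricVariety a) i) :=
  (chartEmbedding_injective a i).isDomain (chartEmbedding a i)

theorem supportGE_monomialHom {a : ι → Fin m → ℤ} {l : (Fin m → ℤ) →+ ℤ} (h : ∀ j, 0 ≤ l (a j))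
    (f : MvPolynomial ι ℂ) : SupportGE l 0 (monomialHom a f) := by
  rw [f.as_sum, map_sum]
  refine SupportGE.sum _ fun e _ => ?_
  rw [monomialHom_monomial]
  refine supportGE_single ?_ _
  rw [Finsupp.weight_apply, map_finsuppSum]
  refine Finset.sum_nonneg fun j _ => ?_
  change 0 ≤ l (e j • a j)
  rw [map_nsmul]
  exact nsmul_nonneg (h j) _

/-- The chart ring at a point whose difference vectors generate the monoid of all lattice points of
a two-sided cone is integrally closed. -/
theorem isIntegrallyClosed_chartRing [Nonempty ι] (a : ι → Fin m → ℤ) (i : ι)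
    (l l' : (Fin m → ℤ) →+ ℤ) (hl : Function.Injective fun w => (l w, l' w))
    (h : ∀ j, 0 ≤ l (a j - a i)) (h' : ∀ j, 0 ≤ l' (a j - a i))
    (hgen : ∀ w, 0 ≤ l w → 0 ≤ l' w →
      w ∈ AddSubmonoid.closure (Set.range fun j => a j - a i)) :
    IsIntegrallyClosed (chartRing (toricVariety a) i) := by
  refine isIntegrallyClosed_of_injective (chartEmbedding a i).toRingHom
    (chartEmbedding_injective a i) fun x hx => ?_
  have hsupp : ∀ (l : (Fin m → ℤ) →+ ℤ), (∀ j, 0 ≤ l (a j - a i)) →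
      ∀ r, SupportGE l 0 ((chartEmbedding a i).toRingHom r) := by
    intro l hl r
    obtain ⟨f, rfl⟩ := Ideal.Quotient.mk_surjective r
    exact supportGE_monomialHom hl f
  -- The half-space lemma is applied to both functionals, each breaking ties for the other; together
  -- they confine the support to the cone.
  have h1 := SupportGE.of_isIntegralElem _ hl (hsupp l h) hx
  have h2 := SupportGE.of_isIntegralElem _ (l := l') (l' := l)
    (fun v w hvw => hl (Prod.ext (congrArg Prod.snd hvw) (congrArg Prod.fst hvw)))
    (hsupp l' h') hx
  have hsingle : ∀ w ∈ AddSubmonoid.closure (Set.range fun j => a j - a i),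
      AddMonoidAlgebra.single w (1 : ℂ) ∈ (chartEmbedding a i).range := by
    intro w hw
    induction hw using AddSubmonoid.closure_induction with
    | mem w hw =>
      obtain ⟨j, rfl⟩ := hw
      refine ⟨Ideal.Quotient.mk _ (MvPolynomial.X j), ?_⟩
      change monomialHom _ _ = _
      rw [monomialHom_X]
      rfl
    | zero => exact one_mem _
    | add v w _ _ hv hw =>
      have := mul_mem hv hw
      rwa [AddMonoidAlgebra.single_mul_single, one_mul] at this
  have hx' : x ∈ (chartEmbedding a i).range := by
    have hsum : x = ∑ w ∈ x.coeff.support, x.coeff w • AddMonoidAlgebra.single w (1 : ℂ) := by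
      conv_lhs => rw [← AddMonoidAlgebra.sum_coeff_single x]
      simp [Finsupp.sum]
    rw [hsum]
    refine Subalgebra.sum_mem _ fun w hw => Subalgebra.smul_mem _ (hsingle w ?_) _
    exact hgen w (h1 w (Finsupp.mem_support_iff.1 hw)) (h2 w (Finsupp.mem_support_iff.1 hw))
  obtain ⟨r, hr⟩ := hx'
  exact ⟨r, hr⟩

/-! ### Coordinate projections of toric varieties -/

theorem weight_mapDomain (a : ι → Fin m → ℤ) (b : κ → Fin m → ℤ) (e : ι → κ)
    (hab : ∀ j, b (e j) = a j) (c : ι →₀ ℕ) :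
    Finsupp.weight b (c.mapDomain e) = Finsupp.weight a c := by
  rw [Finsupp.weight_apply, Finsupp.weight_apply, Finsupp.sum_mapDomain_index (by simp)
    (by simp [add_smul])]
  simp [hab]

theorem degree_mapDomain (e : ι → κ) (c : ι →₀ ℕ) : (c.mapDomain e).degree = c.degree := by
  change (c.mapDomain e).sum (fun _ n => n) = c.sum fun _ n => n
  rw [Finsupp.sum_mapDomain_index (by simp) (by simp)]

theorem eval_monomial_eq_of_mem_toricVariety [Nonempty ι] {a : ι → Fin m → ℤ} {p : ℙ ℂ (ι → ℂ)}
    (hp : p ∈ toricVariety a) {e e' : ι →₀ ℕ} (hdeg : e.degree = e'.degree)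
    (hw : Finsupp.weight a e = Finsupp.weight a e') :
    (e.prod fun i n => p.rep i ^ n) = e'.prod fun i n => p.rep i ^ n := by
  have h1 : MvPolynomial.monomial e (1 : ℂ) - MvPolynomial.monomial e' 1 ∈
      vanishingIdeal (toricVariety a) := by
    rw [mem_vanishingIdeal_toricVariety, map_sub, monomialHom_monomial, monomialHom_monomial,
      (weight_homogenized_eq_iff a e e').2 ⟨hdeg, hw⟩, sub_self]
  have h2 := eval_rep_of_mem_vanishingIdeal hp h1
  rw [map_sub, MvPolynomial.eval_monomial, MvPolynomial.eval_monomial, one_mul, one_mul] at h2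
  exact sub_eq_zero.1 h2

/-- A coordinate projection of toric varieties is a normalization if the source has normal charts,
its coordinates are integral, and the two configurations generate the same lattice. -/
theorem isNormalizationByProjection_of_lattice [Nonempty ι] [Nonempty κ] {a : ι → Fin m → ℤ}
    {b : κ → Fin m → ℤ} {e : ι → κ} (hab : ∀ j, b (e j) = a j)
    (hnormal : ∀ i, IsIntegrallyClosed (chartRing (toricVariety b) (e i)))
    (hint : ∀ u, ∃ n, 0 < n ∧ ∃ c : ι →₀ ℕ, c.degree = n ∧ Finsupp.weight a c = n • b u)
    (hlat : ∀ u, ∃ c c' : ι →₀ ℕ, c.degree + 1 = c'.degree ∧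
      Finsupp.weight a c + b u = Finsupp.weight a c') :
    IsNormalizationByProjection e (toricVariety b) (toricVariety a) := by
  classical
  refine ⟨fun q hq => ?_, fun i _ => ?_⟩
  · by_contra! hzero
    refine q.rep_nonzero (funext fun u => ?_)
    obtain ⟨n, hn, c, hc, hcu⟩ := hint u
    -- At a base point, the n-th power of the coordinate y_u equals a monomial of positive degree in
    -- the projected coordinates, all of which vanish.
    have h1 := eval_monomial_eq_of_mem_toricVariety hq (e := Finsupp.single u n)
      (e' := c.mapDomain e) (by rw [degree_mapDomain, hc, Finsupp.degree_single])
      (by rw [weight_mapDomain a b e hab, hcu, Finsupp.weight_single])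
    rw [Finsupp.prod_single_index (h := fun i n => q.rep i ^ n) (pow_zero _),
      Finsupp.prod_mapDomain_index (by simp) (by simp [pow_add])] at h1
    have h2 : (c.prod fun j k => q.rep (e j) ^ k) = 0 := by
      have hc0 : c ≠ 0 := by
        rintro rfl
        simp at hc
        omega
      obtain ⟨j, hj⟩ := Finsupp.support_nonempty_iff.2 hc0
      exact Finset.prod_eq_zero hj (by simp [hzero j, Finsupp.mem_support_iff.1 hj])
    rw [h2] at h1
    exact eq_zero_of_pow_eq_zero h1
  · have hren : ∀ f : MvPolynomial ι ℂ, monomialHom (translated b (b (e i)))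
        (MvPolynomial.rename e f) = monomialHom (translated a (a i)) f := by
      intro f
      rw [monomialHom, MvPolynomial.aeval_rename]
      have : ((fun u => AddMonoidAlgebra.single (translated b (b (e i)) u) (1 : ℂ)) ∘ e) =
          fun j => AddMonoidAlgebra.single (translated a (a i) j) (1 : ℂ) := by
        funext j
        simp [translated, hab]
      rw [this]
      rfl
    let φ : chartRing (toricVariety a) i →ₐ[ℂ] chartRing (toricVariety b) (e i) :=
      Ideal.quotientMapₐ _ (MvPolynomial.rename e) fun f hf => by
        rw [Ideal.mem_comap]
        refine (mem_chartIdeal b (e i) _).2 ?_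
        have h1 := (mem_chartIdeal a i f).1 hf
        rw [← hren] at h1
        exact h1
    have hφ : ∀ f, φ (Ideal.Quotient.mk _ f) = Ideal.Quotient.mk _ (MvPolynomial.rename e f) :=
      fun f => rfl
    have hinj : Function.Injective φ := by
      rw [injective_iff_map_eq_zero]
      intro x hx
      obtain ⟨f, rfl⟩ := Ideal.Quotient.mk_surjective x
      rw [hφ, Ideal.Quotient.eq_zero_iff_mem] at hx
      refine Ideal.Quotient.eq_zero_iff_mem.2 ((mem_chartIdeal a i f).2 ?_)
      rw [← hren]
      exact (mem_chartIdeal b (e i) _).1 hx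
    -- In a chart only the translated weights have to agree; the degrees of the two monomials may
    -- differ.
    have hmon : ∀ (c : ι →₀ ℕ) (c' : κ →₀ ℕ),
        Finsupp.weight a c - c.degree • a i = Finsupp.weight b c' - c'.degree • a i →
        φ (Ideal.Quotient.mk _ (MvPolynomial.monomial c 1)) =
          Ideal.Quotient.mk _ (MvPolynomial.monomial c' 1) := by
      intro c c' h
      refine chartEmbedding_injective b (e i) ?_
      rw [hφ, chartEmbedding_mk, chartEmbedding_mk, hren, monomialHom_monomial,
        monomialHom_monomial, weight_translated, weight_translated, h, hab]
    refine ⟨φ, fun j => by rw [hφ, MvPolynomial.rename_X], inferInstance, hnormal i, hinj, ?_, ?_⟩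
    · intro s
      obtain ⟨f, rfl⟩ := Ideal.Quotient.mk_surjective s
      induction f using MvPolynomial.induction_on with
      | C r =>
        have : φ.toRingHom (Ideal.Quotient.mk _ (MvPolynomial.C r)) =
            Ideal.Quotient.mk _ (MvPolynomial.C r) := by
          change φ _ = _
          rw [hφ, MvPolynomial.rename_C]
        rw [← this]
        exact RingHom.isIntegralElem_map _
      | add f g hf hg =>
        rw [map_add]
        exact RingHom.IsIntegralElem.add _ hf hg
      | mul_X f u hf =>
        rw [map_mul]
        refine RingHom.IsIntegralElem.mul _ hf ?_
        -- The n-th power of y_u is the image of the monomial x^c, which gives a monic equation for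
        -- y_u.
        obtain ⟨n, hn, c, hc, hcu⟩ := hint u
        refine @IsIntegral.of_pow _ _ _ _ φ.toRingHom.toAlgebra _ _ hn ?_
        rw [← map_pow, MvPolynomial.X_pow_eq_monomial]
        rw [← hmon c (Finsupp.single u n) (by
          rw [hcu, hc, Finsupp.weight_single, Finsupp.degree_single])]
        exact RingHom.isIntegralElem_map φ.toRingHom
    · intro s
      obtain ⟨f, rfl⟩ := Ideal.Quotient.mk_surjective s
      induction f using MvPolynomial.induction_on with
      | C r => exact ⟨Ideal.Quotient.mk _ (MvPolynomial.C r), 1, one_ne_zero, by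
          rw [map_one, one_mul]; exact (congrArg _ (MvPolynomial.rename_C e r)).symm⟩
      | add f g hf hg =>
        obtain ⟨x, y, hy, h1⟩ := hf
        obtain ⟨x', y', hy', h2⟩ := hg
        refine ⟨x * y' + x' * y, y * y', mul_ne_zero hy hy', ?_⟩
        rw [map_add, map_add, map_mul, map_mul, map_mul, ← h1, ← h2]
        ring
      | mul_X f u hf =>
        obtain ⟨x, y, hy, h1⟩ := hf
        -- In the field of fractions y_u is the quotient of x^c' by x^c.
        obtain ⟨c, c', hdeg, hc⟩ := hlat u
        refine ⟨x * Ideal.Quotient.mk _ (MvPolynomial.monomial c' 1),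
          y * Ideal.Quotient.mk _ (MvPolynomial.monomial c 1), mul_ne_zero hy ?_, ?_⟩
        · intro h0
          have h2 := (mem_chartIdeal a i _).1 (Ideal.Quotient.eq_zero_iff_mem.1 h0)
          rw [monomialHom_monomial] at h2
          simp at h2
        · have h2 := hmon c (c.mapDomain e) (by rw [degree_mapDomain, weight_mapDomain a b e hab])
          have h3 := hmon c' (c.mapDomain e + Finsupp.single u 1) (by
            rw [map_add, map_add, degree_mapDomain, weight_mapDomain a b e hab,
              Finsupp.weight_single, Finsupp.degree_single, ← hdeg, ← hc, one_smul])
          have h4 : (MvPolynomial.monomial (c.mapDomain e + Finsupp.single u 1) (1 : ℂ)) =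
              MvPolynomial.monomial (c.mapDomain e) 1 * MvPolynomial.X u := by
            rw [MvPolynomial.X, MvPolynomial.monomial_mul, one_mul]
          change φ _ * _ = φ _
          change φ y * _ = φ x at h1
          rw [map_mul, map_mul, map_mul, h2, h3, h4, map_mul, ← h1]
          ring

/-! ### The dimension of a toric variety -/

/-- The embedding of the homogeneous coordinate ring of a toric variety into the ring of Laurent
polynomials. -/
def coordEmbedding [Nonempty ι] (a : ι → Fin m → ℤ) :
    coordRing (toricVariety a) →ₐ[ℂ] AddMonoidAlgebra ℂ (ℤ × (Fin m → ℤ)) :=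
  Ideal.Quotient.liftₐ _ (monomialHom (homogenized a)) fun f hf =>
    (mem_vanishingIdeal_toricVariety a f).1 hf

theorem coordEmbedding_mk [Nonempty ι] (a : ι → Fin m → ℤ) (f : MvPolynomial ι ℂ) :
    coordEmbedding a (Ideal.Quotient.mk _ f) = monomialHom (homogenized a) f := rfl

theorem coordEmbedding_injective [Nonempty ι] (a : ι → Fin m → ℤ) :
    Function.Injective (coordEmbedding a) := by
  rw [injective_iff_map_eq_zero]
  intro x hx
  obtain ⟨f, rfl⟩ := Ideal.Quotient.mk_surjective x
  rw [coordEmbedding_mk] at hx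
  exact Ideal.Quotient.eq_zero_iff_mem.2 ((mem_vanishingIdeal_toricVariety a f).2 hx)

instance isDomain_coordRing [Nonempty ι] (a : ι → Fin m → ℤ) :
    IsDomain (coordRing (toricVariety a)) :=
  (coordEmbedding_injective a).isDomain (coordEmbedding a)

theorem mk_monomial_eq [Nonempty ι] {a : ι → Fin m → ℤ} {c c' : ι →₀ ℕ}
    (hdeg : c.degree = c'.degree) (hw : Finsupp.weight a c = Finsupp.weight a c') :
    (Ideal.Quotient.mk _ (MvPolynomial.monomial c 1) : coordRing (toricVariety a)) =
      Ideal.Quotient.mk _ (MvPolynomial.monomial c' 1) := by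
  refine coordEmbedding_injective a ?_
  rw [coordEmbedding_mk, coordEmbedding_mk, monomialHom_monomial, monomialHom_monomial,
    (weight_homogenized_eq_iff a c c').2 ⟨hdeg, hw⟩]

theorem mk_monomial_ne_zero [Nonempty ι] (a : ι → Fin m → ℤ) (c : ι →₀ ℕ) :
    (Ideal.Quotient.mk _ (MvPolynomial.monomial c 1) : coordRing (toricVariety a)) ≠ 0 := by
  intro h
  have h1 := congrArg (coordEmbedding a) h
  rw [coordEmbedding_mk, monomialHom_monomial] at h1
  simp at h1

/-- Incomparability: in an integral extension, strict inclusions of primes stay strict after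
contraction. -/
theorem ringKrullDim_le_of_isIntegral {R S : Type*} [CommRing R] [CommRing S] (f : R →+* S)
    (hf : f.IsIntegral) : ringKrullDim S ≤ ringKrullDim R := by
  let _ := f.toAlgebra
  refine Order.krullDim_le_of_strictMono (PrimeSpectrum.comap f) fun p q hpq => ?_
  obtain ⟨h1, x, hx, hx'⟩ := SetLike.lt_iff_le_and_exists.1
    (show p.asIdeal < q.asIdeal from hpq)
  exact Ideal.comap_lt_comap_of_integral_mem_sdiff (R := R) h1 ⟨hx, hx'⟩ (hf x)

/-- The Krull dimension of a finitely generated domain over a field that is algebraic over the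
subalgebra generated by `s` is at most the cardinality of `s`. -/
theorem ringKrullDim_le_card_of_isAlgebraic {k R : Type} [Field k] [CommRing R] [IsDomain R]
    [Algebra k R] [Algebra.FiniteType k R] (s : Finset R)
    (hs : ∀ x : R, IsAlgebraic (Algebra.adjoin k (s : Set R)) x) :
    ringKrullDim R ≤ (s.card : WithBot ℕ∞) := by
  -- Noether normalization: the number n of variables bounds the dimension from above and is itself
  -- at most the transcendence degree, hence at most the size of `s`.
  obtain ⟨n, g, hinj, hint⟩ := exists_integral_inj_algHom_of_fg k R
  have : Algebra.IsAlgebraic (Algebra.adjoin k (s : Set R)) R := ⟨hs⟩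
  have h1 := Algebra.IsAlgebraic.trdeg_le_cardinalMk (R := k) (A := R) (s : Set R)
  have h2 := trdeg_le_of_injective g hinj
  rw [MvPolynomial.trdeg_of_isDomain] at h2
  have h3 := h2.trans h1
  have h4 : n ≤ s.card := by simpa using h3
  refine (ringKrullDim_le_of_isIntegral g.toRingHom hint).trans ?_
  rw [MvPolynomial.ringKrullDim_of_isNoetherianRing, ringKrullDim_eq_zero_of_field, zero_add,
    Nat.card_eq_fintype_card, Fintype.card_fin]
  exact_mod_cast h4

theorem isAlgebraic_of_mul_eq {R S : Type*} [CommRing R] [IsDomain R] [CommRing S] [Algebra R S]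
    {x : S} {r r' : R} (hr : r ≠ 0) (h : algebraMap R S r * x = algebraMap R S r') :
    IsAlgebraic R x := by
  refine ⟨Polynomial.C r * Polynomial.X - Polynomial.C r', fun h0 => hr ?_, by simp [h]⟩
  have := congrArg (fun p => Polynomial.coeff p 1) h0
  simpa using this

/-- Every coordinate is a quotient of two monomials in the coordinates of `s`, hence algebraic over
the algebra they generate. -/
theorem ringKrullDim_coordRing_le [Fintype ι] [DecidableEq ι] [Nonempty ι]
    (a : ι → Fin m → ℤ) (s : Finset ι)
    (hs : ∀ u, ∃ c c' : ι →₀ ℕ, c.support ⊆ s ∧ c'.support ⊆ s ∧ c.degree + 1 = c'.degree ∧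
      Finsupp.weight a c + a u = Finsupp.weight a c') :
    ringKrullDim (coordRing (toricVariety a)) ≤ (s.card : WithBot ℕ∞) := by
  classical
  let y : ι → coordRing (toricVariety a) := fun u => Ideal.Quotient.mk _ (MvPolynomial.X u)
  have hmem : ∀ c : ι →₀ ℕ, c.support ⊆ s →
      (Ideal.Quotient.mk _ (MvPolynomial.monomial c 1) : coordRing (toricVariety a)) ∈
        Algebra.adjoin ℂ ((s.image y : Finset (coordRing (toricVariety a))) :
          Set (coordRing (toricVariety a))) := by
    intro c hc
    rw [MvPolynomial.monomial_eq, map_one, one_mul, Finsupp.prod, map_prod]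
    refine Subalgebra.prod_mem _ fun u hu => ?_
    rw [map_pow]
    refine Subalgebra.pow_mem _ (Algebra.subset_adjoin ?_) _
    exact Finset.mem_coe.2 (Finset.mem_image_of_mem y (hc hu))
  refine (ringKrullDim_le_card_of_isAlgebraic (k := ℂ) (s.image y) fun x => ?_).trans
    (by exact_mod_cast Finset.card_image_le)
  obtain ⟨f, rfl⟩ := Ideal.Quotient.mk_surjective x
  induction f using MvPolynomial.induction_on with
  | C r =>
    exact isAlgebraic_algebraMap (algebraMap ℂ (Algebra.adjoin ℂ ((s.image y :
      Finset (coordRing (toricVariety a))) : Set (coordRing (toricVariety a)))) r)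
  | add f g hf hg =>
    rw [map_add]
    exact hf.add hg
  | mul_X f u hf =>
    rw [map_mul]
    refine hf.mul ?_
    obtain ⟨c, c', hc, hc', hdeg, hw⟩ := hs u
    refine isAlgebraic_of_mul_eq (r := ⟨_, hmem c hc⟩) (r' := ⟨_, hmem c' hc'⟩) (fun h0 =>
      mk_monomial_ne_zero a c (congrArg Subtype.val h0)) ?_
    change Ideal.Quotient.mk _ _ * Ideal.Quotient.mk _ _ = Ideal.Quotient.mk _ _
    rw [← map_mul, MvPolynomial.X, MvPolynomial.monomial_mul, one_mul]
    refine mk_monomial_eq ?_ ?_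
    · rw [map_add, Finsupp.degree_single, hdeg]
    · rw [map_add, Finsupp.weight_single, one_smul, hw]

theorem degree_single_add_single (u v : ι) (k n : ℕ) :
    (Finsupp.single u k + Finsupp.single v n).degree = k + n := by
  rw [map_add, Finsupp.degree_single, Finsupp.degree_single]

theorem weight_single_add_single (a : ι → Fin m → ℤ) (u v : ι) (k n : ℕ) :
    Finsupp.weight a (Finsupp.single u k + Finsupp.single v n) = k • a u + n • a v := by
  rw [map_add, Finsupp.weight_single, Finsupp.weight_single]

/-- An affine functional that is nonnegative on the configuration vanishes on a weight only if it
vanishes on all points involved. -/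
theorem functional_eq_zero_of_mem_support {a : ι → Fin m → ℤ} {l : (Fin m → ℤ) →+ ℤ} {r : ℤ}
    (hl : ∀ u, r ≤ l (a u)) {e : ι →₀ ℕ} :
    l (Finsupp.weight a e) = e.degree * r ↔ ∀ u ∈ e.support, l (a u) = r := by
  have h1 : l (Finsupp.weight a e) - e.degree * r = ∑ u ∈ e.support, e u * (l (a u) - r) := by
    rw [Finsupp.weight_apply, map_finsuppSum, Finsupp.degree_apply]
    push_cast
    rw [Finset.sum_mul, Finsupp.sum, ← Finset.sum_sub_distrib]
    refine Finset.sum_congr rfl fun u _ => ?_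
    rw [map_nsmul, nsmul_eq_mul]
    ring
  rw [← sub_eq_zero, h1, Finset.sum_eq_zero_iff_of_nonneg fun u _ =>
    mul_nonneg (by positivity) (sub_nonneg.2 (hl u))]
  refine forall₂_congr fun u hu => ?_
  have : (e u : ℤ) ≠ 0 := by exact_mod_cast Finsupp.mem_support_iff.1 hu
  rw [mul_eq_zero, or_iff_right this, sub_eq_zero]

/-- A point off an edge with exactly two points of the configuration forces dimension two. -/
theorem le_ringKrullDim_coordRing [Nonempty ι] {a : ι → Fin m → ℤ} {l : (Fin m → ℤ) →+ ℤ} {r : ℤ}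
    (hl : ∀ u, r ≤ l (a u)) {u₀ u₁ u₂ : ι} (h01 : a u₀ ≠ a u₁) (h2 : l (a u₂) ≠ r)
    (hedge : ∀ u, l (a u) = r ↔ u = u₀ ∨ u = u₁) :
    (3 : WithBot ℕ∞) ≤ ringKrullDim (coordRing (toricVariety a)) := by
  classical
  have hne : u₀ ≠ u₁ := fun h => h01 (by rw [h])
  -- Restriction to the edge: a monomial survives only if all its points lie on the edge, a property
  -- of its degree and weight. With just two distinct points there, degree and weight determine the
  -- exponents, so the quotient is a full polynomial ring.
  let g : ι → MvPolynomial (Fin 2) ℂ := fun u =>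
    if u = u₀ then MvPolynomial.X 0 else if u = u₁ then MvPolynomial.X 1 else 0
  have hg0 : g u₀ = MvPolynomial.X 0 := by simp [g]
  have hg1 : g u₁ = MvPolynomial.X 1 := by simp [g, hne.symm]
  have hg2 : ∀ u, l (a u) ≠ r → g u = 0 := by
    intro u hu
    rw [Ne, hedge, not_or] at hu
    simp [g, hu.1, hu.2]
  have hg : ∀ e e' : ι →₀ ℕ, Finsupp.weight (homogenized a) e =
      Finsupp.weight (homogenized a) e' →
      (e.prod fun i n => g i ^ n) = e'.prod fun i n => g i ^ n := by
    intro e e' h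
    rw [weight_homogenized_eq_iff] at h
    have hzero : ∀ e : ι →₀ ℕ, l (Finsupp.weight a e) ≠ e.degree * r →
        (e.prod fun i n => g i ^ n) = 0 := by
      intro e he
      rw [Ne, functional_eq_zero_of_mem_support hl] at he
      push Not at he
      obtain ⟨u, hu, hur⟩ := he
      refine Finset.prod_eq_zero hu ?_
      beta_reduce
      rw [hg2 u hur, zero_pow (Finsupp.mem_support_iff.1 hu)]
    by_cases he : l (Finsupp.weight a e) = e.degree * r
    · have he' : l (Finsupp.weight a e') = e'.degree * r := by rw [← h.2, ← h.1, he]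
      have hform : ∀ e : ι →₀ ℕ, (∀ u ∈ e.support, l (a u) = r) →
          e = Finsupp.single u₀ (e u₀) + Finsupp.single u₁ (e u₁) := by
        intro e he
        ext u
        by_cases hu : e u = 0
        · rw [hu]
          by_cases h0 : u = u₀
          · subst h0; simp [hu, hne]
          · by_cases h1 : u = u₁
            · subst h1; simp [hu, hne.symm]
            · simp [Ne.symm h0, Ne.symm h1]
        · rcases (hedge u).1 (he u (Finsupp.mem_support_iff.2 hu)) with rfl | rfl
          · simp [hne]
          · simp [hne]
      have e1 := hform e ((functional_eq_zero_of_mem_support hl).1 he)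
      have e2 := hform e' ((functional_eq_zero_of_mem_support hl).1 he')
      generalize e u₀ = k₀ at e1
      generalize e u₁ = k₁ at e1
      generalize e' u₀ = n₀ at e2
      generalize e' u₁ = n₁ at e2
      subst e1 e2
      rw [degree_single_add_single, degree_single_add_single, weight_single_add_single,
        weight_single_add_single] at h
      obtain ⟨h3, h4⟩ := h
      have h5 : ((k₀ : ℤ) - n₀) • (a u₀ - a u₁) = 0 := by
        have h6 : (k₁ : ℤ) = n₀ + n₁ - k₀ := by omega
        simp only [← natCast_zsmul] at h4
        rw [h6] at h4
        have h7 := sub_eq_zero.2 h4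
        rw [← h7]
        module
      have h6 : (k₀ : ℤ) - n₀ = 0 := by
        by_contra hk
        exact h01 (sub_eq_zero.1 ((smul_eq_zero.1 h5).resolve_left hk))
      have h7 : k₀ = n₀ := by omega
      have h8 : k₁ = n₁ := by omega
      rw [h7, h8]
    · rw [hzero e he, hzero e' (by rwa [← h.2, ← h.1])]
  let F : coordRing (toricVariety a) →ₐ[ℂ] MvPolynomial (Fin 2) ℂ :=
    Ideal.Quotient.liftₐ _ (MvPolynomial.aeval g) fun f hf =>
      aeval_eq_zero_of_mem_ker g hg ((mem_vanishingIdeal_toricVariety a f).1 hf)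
  have hF : ∀ u, F (Ideal.Quotient.mk _ (MvPolynomial.X u)) = g u := fun u =>
    MvPolynomial.aeval_X g u
  have hsurj : Function.Surjective F := by
    rw [← AlgHom.range_eq_top, eq_top_iff, ← MvPolynomial.adjoin_range_X, Algebra.adjoin_le_iff]
    rintro _ ⟨i, rfl⟩
    fin_cases i
    · exact ⟨Ideal.Quotient.mk _ (MvPolynomial.X u₀), by
        change F _ = _
        rw [hF, hg0]; rfl⟩
    · exact ⟨Ideal.Quotient.mk _ (MvPolynomial.X u₁), by
        change F _ = _
        rw [hF, hg1]; rfl⟩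
  -- The coordinate off the edge is a nonzero element of the kernel in a domain, so the dimension
  -- drops by at least one.
  have h3 := ringKrullDim_succ_le_of_surjective F.toRingHom hsurj
    (r := Ideal.Quotient.mk _ (MvPolynomial.X u₂))
    (mem_nonZeroDivisors_of_ne_zero (mk_monomial_ne_zero a _))
    (by change F _ = 0; rw [hF, hg2 u₂ h2])
  rw [MvPolynomial.ringKrullDim_of_isNoetherianRing, ringKrullDim_eq_zero_of_field, zero_add,
    Nat.card_eq_fintype_card, Fintype.card_fin] at h3
  refine le_trans (le_of_eq ?_) h3
  norm_num

/-! ### Tangent spaces of toric varieties -/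

/-- The dual number with the given value and derivative. -/
def dual (q r : ℂ) : DualNumber ℂ := TrivSqZeroExt.inl q + TrivSqZeroExt.inr r

@[simp]
theorem fst_dual (q r : ℂ) : (dual q r).fst = q := by simp [dual]

@[simp]
theorem snd_dual (q r : ℂ) : (dual q r).snd = r := by simp [dual]

theorem isUnit_dual {q : ℂ} (hq : q ≠ 0) (r : ℂ) : IsUnit (dual q r) :=
  TrivSqZeroExt.isUnit_iff_isUnit_fst.2 (by simpa using hq)

/-- First-order Taylor expansion. It identifies tangent vectors v at p with solutions p + εv over
the dual numbers, so the weight criterion for the ideal applies to them. -/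
theorem snd_aeval_dualNumber [Fintype ι] (g : ι → DualNumber ℂ) (f : MvPolynomial ι ℂ) :
    (MvPolynomial.aeval g f).fst = MvPolynomial.eval (fun i => (g i).fst) f ∧
    (MvPolynomial.aeval g f).snd =
      ∑ i, (g i).snd * MvPolynomial.eval (fun i => (g i).fst) (MvPolynomial.pderiv i f) := by
  classical
  induction f using MvPolynomial.induction_on with
  | C r =>
    rw [MvPolynomial.aeval_C]
    refine ⟨?_, ?_⟩
    · rw [MvPolynomial.eval_C]; rfl
    · simp only [MvPolynomial.pderiv_C, map_zero, mul_zero, Finset.sum_const_zero]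
      rfl
  | add f h hf hh => simp [hf, hh, mul_add, Finset.sum_add_distrib]
  | mul_X f j hf =>
    refine ⟨by simp [hf], ?_⟩
    rw [map_mul, MvPolynomial.aeval_X, TrivSqZeroExt.snd_mul, hf.1, hf.2]
    simp only [MvPolynomial.pderiv_mul, MvPolynomial.pderiv_X, map_add, map_mul,
      MvPolynomial.eval_X, mul_add, Finset.sum_add_distrib]
    have hsum : ∀ E : MvPolynomial ι ℂ →+* ℂ, ∑ x, (g x).snd *
        (E f * E ((Pi.single x 1 : ι → MvPolynomial ι ℂ) j)) = (g j).snd * E f := by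
      intro E
      rw [Finset.sum_eq_single j]
      · simp
      · intro i _ hi
        simp [Pi.single_eq_of_ne (Ne.symm hi)]
      · simp
    rw [hsum]
    simp only [smul_eq_mul, MulOpposite.smul_eq_mul_unop, MulOpposite.unop_op, Finset.sum_mul]
    rw [add_comm, mul_comm (g j).snd]
    congr 1
    exact Finset.sum_congr rfl fun i _ => by ring

theorem mem_coneTangentSpace_iff [Fintype ι] {X : Set (ℙ ℂ (ι → ℂ))} {p : ℙ ℂ (ι → ℂ)}
    {g : ι → DualNumber ℂ} (hg : ∀ i, (g i).fst = p.rep i) :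
    (fun i => (g i).snd) ∈ coneTangentSpace X p ↔
      ∀ f ∈ vanishingIdeal X, (MvPolynomial.aeval g f).snd = 0 := by
  have : (fun i => (g i).fst) = p.rep := funext hg
  refine forall₂_congr fun f hf => ?_
  rw [(snd_aeval_dualNumber g f).2, this]

theorem snd_aeval_of_mem_coneTangentSpace [Fintype ι] {X : Set (ℙ ℂ (ι → ℂ))} {p : ℙ ℂ (ι → ℂ)}
    {v : ι → ℂ} (hv : v ∈ coneTangentSpace X p) {f : MvPolynomial ι ℂ}
    (hf : f ∈ vanishingIdeal X) :
    (MvPolynomial.aeval (fun i => dual (p.rep i) (v i)) f).snd = 0 :=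
  (mem_coneTangentSpace_iff (g := fun i => dual (p.rep i) (v i))
    (fun _ => fst_dual _ _)).1 (by simpa using hv) f hf

/-- Powers of an element with exponents that are nonnegative or, if the element is a unit,
arbitrary integers. -/
theorem exists_powers {R : Type*} [CommRing R] (s : R) (α : ι → ℤ)
    (h : IsUnit s ∨ ∀ u, 0 ≤ α u) :
    ∃ P : ι → R, (∀ u, α u = 0 → P u = 1) ∧ (∀ u, α u = 1 → P u = s) ∧
      ∀ e e' : ι →₀ ℕ, Finsupp.weight α e = Finsupp.weight α e' →
        (e.prod fun i n => P i ^ n) = e'.prod fun i n => P i ^ n := by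
  rcases h with ⟨s, rfl⟩ | h
  · refine ⟨fun u => ((s ^ α u : Rˣ) : R), fun u hu => by simp [hu], fun u hu => by simp [hu], ?_⟩
    have key : ∀ e : ι →₀ ℕ, (e.prod fun i n => ((s ^ α i : Rˣ) : R) ^ n) =
        ((s ^ Finsupp.weight α e : Rˣ) : R) := by
      intro e
      induction e using Finsupp.induction with
      | zero => simp
      | single_add i n e hi hn ih =>
        rw [Finsupp.prod_add_index' (by simp) (by simp [pow_add]), ih, map_add,
          Finsupp.weight_single, Finsupp.prod_single_index (by simp), zpow_add, Units.val_mul]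
        congr 1
        rw [nsmul_eq_mul, mul_comm, zpow_mul, zpow_natCast, Units.val_pow_eq_pow_val]
    intro e e' hee
    rw [key, key, hee]
  · refine ⟨fun u => s ^ (α u).toNat, fun u hu => by simp [hu], fun u hu => by simp [hu], ?_⟩
    have key : ∀ e : ι →₀ ℕ, 0 ≤ Finsupp.weight α e ∧
        (e.prod fun i n => (s ^ (α i).toNat) ^ n) = s ^ (Finsupp.weight α e).toNat := by
      intro e
      induction e using Finsupp.induction with
      | zero => simp
      | single_add i n e hi hn ih =>
        have h1 : (0 : ℤ) ≤ n • α i := nsmul_nonneg (h i) n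
        rw [Finsupp.prod_add_index' (by simp) (by simp [pow_add]), ih.2, map_add,
          Finsupp.weight_single, Finsupp.prod_single_index (by simp)]
        refine ⟨add_nonneg h1 ih.1, ?_⟩
        rw [Int.toNat_add h1 ih.1, pow_add, ← pow_mul]
        congr 2
        rw [nsmul_eq_mul, Int.toNat_mul (by positivity) (h i), Int.toNat_natCast, mul_comm]
    intro e e' hee
    rw [(key e).2, (key e').2, hee]

/-- The data of a unimodular corner `a w₀ + (ℕ or ℤ) (a w₁ - a w₀) + (ℕ or ℤ) (a w₂ - a w₀)` that
contains the configuration. -/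
structure UnimodularCorner (a : ι → Fin m → ℤ) (w₀ w₁ w₂ : ι) where
  /-- The first coordinate. -/
  α : (Fin m → ℤ) →+ ℤ
  /-- The second coordinate. -/
  β : (Fin m → ℤ) →+ ℤ
  α_one : α (a w₁ - a w₀) = 1
  α_two : α (a w₂ - a w₀) = 0
  β_one : β (a w₁ - a w₀) = 0
  β_two : β (a w₂ - a w₀) = 1
  eq_add : ∀ w, w = α w • (a w₁ - a w₀) + β w • (a w₂ - a w₀)

namespace UnimodularCorner

variable {a : ι → Fin m → ℤ} {w₀ w₁ w₂ : ι} (U : UnimodularCorner a w₀ w₁ w₂)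

/-- The exponents on the left hand side of the binomial relation of a point. -/
def lhs (u : ι) : ι →₀ ℕ :=
  Finsupp.single w₁ (-U.α (a u - a w₀)).toNat + Finsupp.single w₂ (-U.β (a u - a w₀)).toNat +
    Finsupp.single w₀ (U.α (a u - a w₀) + U.β (a u - a w₀) - 1).toNat

/-- The exponents on the right hand side of the binomial relation of a point. -/
def rhs (u : ι) : ι →₀ ℕ :=
  Finsupp.single w₁ (U.α (a u - a w₀)).toNat + Finsupp.single w₂ (U.β (a u - a w₀)).toNat +
    Finsupp.single w₀ (1 - U.α (a u - a w₀) - U.β (a u - a w₀)).toNat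

theorem degree_lhs (u : ι) : (U.lhs u).degree + 1 = (U.rhs u).degree := by
  simp only [lhs, rhs, map_add, Finsupp.degree_single]
  omega

theorem weight_lhs (u : ι) :
    Finsupp.weight a (U.lhs u) + a u = Finsupp.weight a (U.rhs u) := by
  simp only [lhs, rhs, map_add, Finsupp.weight_single]
  have h := U.eq_add (a u - a w₀)
  generalize U.α (a u - a w₀) = x at h
  generalize U.β (a u - a w₀) = y at h
  have h1 : a u = a w₀ + (x • (a w₁ - a w₀) + y • (a w₂ - a w₀)) := by rw [← h]; abel
  have hx : (x.toNat : ℤ) = x + (-x).toNat := by omega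
  have hy : (y.toNat : ℤ) = y + (-y).toNat := by omega
  have hz : ((1 - x - y).toNat : ℤ) = 1 - x - y + (x + y - 1).toNat := by omega
  rw [h1]
  simp only [← natCast_zsmul, hx, hy, hz]
  module

theorem support_lhs [DecidableEq ι] (u : ι) : (U.lhs u).support ⊆ {w₀, w₁, w₂} := by
  intro j hj
  simp only [lhs, Finsupp.mem_support_iff, Finsupp.add_apply, Finsupp.single_apply] at hj
  simp only [Finset.mem_insert, Finset.mem_singleton]
  by_contra! h
  simp [Ne.symm h.1, Ne.symm h.2.1, Ne.symm h.2.2] at hj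

theorem support_rhs [DecidableEq ι] (u : ι) : (U.rhs u).support ⊆ {w₀, w₁, w₂} := by
  intro j hj
  simp only [rhs, Finsupp.mem_support_iff, Finsupp.add_apply, Finsupp.single_apply] at hj
  simp only [Finset.mem_insert, Finset.mem_singleton]
  by_contra! h
  simp [Ne.symm h.1, Ne.symm h.2.1, Ne.symm h.2.2] at hj

theorem prod_add_single {M : Type*} [CommMonoid M] (q : ι → M) (x y z : ℕ) (j₁ j₂ j₃ : ι) :
    ((Finsupp.single j₁ x + Finsupp.single j₂ y + Finsupp.single j₃ z).prod
      fun i n => q i ^ n) = q j₁ ^ x * q j₂ ^ y * q j₃ ^ z := by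
  rw [Finsupp.prod_add_index' (by simp) (by simp [pow_add]),
    Finsupp.prod_add_index' (by simp) (by simp [pow_add]),
    Finsupp.prod_single_index (h := fun i n => q i ^ n) (by simp),
    Finsupp.prod_single_index (h := fun i n => q i ^ n) (by simp),
    Finsupp.prod_single_index (h := fun i n => q i ^ n) (by simp)]

theorem weight_functional (φ : (Fin m → ℤ) →+ ℤ) (e : ι →₀ ℕ) :
    Finsupp.weight (fun u => φ (a u - a w₀)) e =
      φ (Finsupp.weight a e - e.degree • a w₀) := by
  rw [weight_comp φ (fun u => a u - a w₀), ← weight_translated]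
  rfl

theorem relation_mem [Nonempty ι] (u : ι) :
    MvPolynomial.monomial (U.lhs u) (1 : ℂ) * MvPolynomial.X u -
      MvPolynomial.monomial (U.rhs u) 1 ∈ vanishingIdeal (toricVariety a) := by
  rw [mem_vanishingIdeal_toricVariety, map_sub, MvPolynomial.X, MvPolynomial.monomial_mul,
    one_mul, monomialHom_monomial, monomialHom_monomial,
    (weight_homogenized_eq_iff a _ (U.rhs u)).2 ⟨?_, ?_⟩, sub_self]
  · rw [map_add, Finsupp.degree_single, U.degree_lhs]
  · rw [map_add, Finsupp.weight_single, one_smul, U.weight_lhs]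

/-- A corner coordinate may vanish only if its exponent on this side is always zero, that is, if the
corresponding functional is nonnegative on the configuration. -/
theorem prod_lhs_ne_zero {q : ι → ℂ} (h₀ : q w₀ ≠ 0)
    (h₁ : q w₁ ≠ 0 ∨ ∀ u, 0 ≤ U.α (a u - a w₀)) (h₂ : q w₂ ≠ 0 ∨ ∀ u, 0 ≤ U.β (a u - a w₀))
    (u : ι) : ((U.lhs u).prod fun i n => q i ^ n) ≠ 0 := by
  rw [lhs, prod_add_single]
  refine mul_ne_zero (mul_ne_zero ?_ ?_) (pow_ne_zero _ h₀)
  · rcases h₁ with h | h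
    · exact pow_ne_zero _ h
    · rw [Int.toNat_of_nonpos (by linarith [h u]), pow_zero]
      exact one_ne_zero
  · rcases h₂ with h | h
    · exact pow_ne_zero _ h
    · rw [Int.toNat_of_nonpos (by linarith [h u]), pow_zero]
      exact one_ne_zero

/-- The three corner coordinates are coordinates on the tangent space. They determine a tangent
vector because each binomial relation can be solved to first order for its point. They are arbitrary
because the monomial parametrization of the chart extends over the dual numbers. -/
theorem finrank_coneTangentSpace [Fintype ι] [Nonempty ι] {p : ℙ ℂ (ι → ℂ)}
    (hp : p ∈ toricVariety a) (h₀ : p.rep w₀ ≠ 0)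
    (h₁ : p.rep w₁ ≠ 0 ∨ ∀ u, 0 ≤ U.α (a u - a w₀))
    (h₂ : p.rep w₂ ≠ 0 ∨ ∀ u, 0 ≤ U.β (a u - a w₀)) :
    Module.finrank ℂ (coneTangentSpace (toricVariety a) p) = 3 := by
  classical
  let F : coneTangentSpace (toricVariety a) p →ₗ[ℂ] (Fin 3 → ℂ) :=
    { toFun := fun v => ![v.1 w₀, v.1 w₁, v.1 w₂]
      map_add' := fun v w => by ext i; fin_cases i <;> rfl
      map_smul' := fun c v => by ext i; fin_cases i <;> rfl }
  have hinj : Function.Injective F := by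
    rw [injective_iff_map_eq_zero]
    rintro ⟨v, hv⟩ hFv
    have hv0 : v w₀ = 0 := congrFun hFv 0
    have hv1 : v w₁ = 0 := congrFun hFv 1
    have hv2 : v w₂ = 0 := congrFun hFv 2
    refine Subtype.ext (funext fun u => ?_)
    have h1 := snd_aeval_of_mem_coneTangentSpace hv (U.relation_mem u)
    have hprod : ∀ x y z : ℕ, ((Finsupp.single w₁ x + Finsupp.single w₂ y +
        Finsupp.single w₀ z).prod fun i n => dual (p.rep i) (v i) ^ n) =
        TrivSqZeroExt.inl ((Finsupp.single w₁ x + Finsupp.single w₂ y +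
          Finsupp.single w₀ z).prod fun i n => p.rep i ^ n) := by
      intro x y z
      have hd : ∀ q : ℂ, dual q 0 = TrivSqZeroExt.inl q := fun q => by simp [dual]
      rw [prod_add_single, prod_add_single, hv0, hv1, hv2, hd, hd, hd, TrivSqZeroExt.inl_mul,
        TrivSqZeroExt.inl_mul, TrivSqZeroExt.inl_pow, TrivSqZeroExt.inl_pow, TrivSqZeroExt.inl_pow]
    rw [map_sub, map_mul, MvPolynomial.aeval_X, MvPolynomial.aeval_monomial,
      MvPolynomial.aeval_monomial, map_one, one_mul, one_mul, lhs, rhs, hprod, hprod,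
      TrivSqZeroExt.snd_sub, TrivSqZeroExt.snd_inl, sub_zero, TrivSqZeroExt.snd_mul,
      TrivSqZeroExt.snd_inl, smul_zero, add_zero, TrivSqZeroExt.fst_inl, snd_dual, smul_eq_mul] at h1
    exact (mul_eq_zero.1 h1).resolve_left (U.prod_lhs_ne_zero h₀ h₁ h₂ u)
  have hsurj : Function.Surjective F := by
    intro x
    let c : DualNumber ℂ := dual (p.rep w₀) (x 0)
    obtain ⟨c', hc'⟩ := isUnit_dual h₀ (x 0)
    have hdiv : ∀ r : DualNumber ℂ, c * ((↑c'⁻¹ : DualNumber ℂ) * r) = r := fun r => by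
      change dual (p.rep w₀) (x 0) * _ = r
      rw [← hc', Units.mul_inv_cancel_left]
    obtain ⟨P, hP0, hP1, hP⟩ := exists_powers
      ((↑c'⁻¹ : DualNumber ℂ) * dual (p.rep w₁) (x 1)) (fun u => U.α (a u - a w₀))
      (h₁.imp_left fun h => (Units.isUnit _).mul (isUnit_dual h _))
    obtain ⟨Q, hQ0, hQ1, hQ⟩ := exists_powers
      ((↑c'⁻¹ : DualNumber ℂ) * dual (p.rep w₂) (x 2)) (fun u => U.β (a u - a w₀))
      (h₂.imp_left fun h => (Units.isUnit _).mul (isUnit_dual h _))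
    -- The parametrization c·s^α·t^β with s and t the ratios of the prescribed dual numbers to c.
    -- Negative exponents occur only where the ratio is a unit.
    let g : ι → DualNumber ℂ := fun u => c * P u * Q u
    have hg0 : g w₀ = dual (p.rep w₀) (x 0) := by
      simp only [g]
      rw [hP0 w₀ (by simp), hQ0 w₀ (by simp), mul_one, mul_one]
    have hg1 : g w₁ = dual (p.rep w₁) (x 1) := by
      simp only [g]
      rw [hP1 w₁ U.α_one, hQ0 w₁ U.β_one, mul_one, hdiv]
    have hg2 : g w₂ = dual (p.rep w₂) (x 2) := by
      simp only [g]
      rw [hP0 w₂ U.α_two, hQ1 w₂ U.β_two, mul_one, hdiv]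
    have hker : ∀ f ∈ vanishingIdeal (toricVariety a), MvPolynomial.aeval g f = 0 := by
      intro f hf
      refine aeval_eq_zero_of_mem_ker g (fun e e' h => ?_)
        ((mem_vanishingIdeal_toricVariety a f).1 hf)
      rw [weight_homogenized_eq_iff] at h
      have hsplit : ∀ e : ι →₀ ℕ, (e.prod fun i n => g i ^ n) =
          c ^ e.degree * (e.prod fun i n => P i ^ n) * e.prod fun i n => Q i ^ n := by
        intro e
        simp [Finsupp.prod, g, mul_pow, Finset.prod_mul_distrib, Finset.prod_pow_eq_pow_sum,
          Finsupp.degree_apply]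
      rw [hsplit, hsplit, h.1, hP e e' (by rw [weight_functional, weight_functional, h.1, h.2]),
        hQ e e' (by rw [weight_functional, weight_functional, h.1, h.2])]
    -- The value part of `g` and the point agree at the corner and satisfy the same binomial
    -- relations, whose left factors do not vanish.
    have hfst : ∀ u, (g u).fst = p.rep u := by
      intro u
      have h1 := congrArg TrivSqZeroExt.fst (hker _ (U.relation_mem u))
      rw [(snd_aeval_dualNumber g _).1] at h1
      have h2 := eval_rep_of_mem_vanishingIdeal hp (U.relation_mem u)
      have hq0 : (g w₀).fst = p.rep w₀ := by rw [hg0, fst_dual]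
      have hq1 : (g w₁).fst = p.rep w₁ := by rw [hg1, fst_dual]
      have hq2 : (g w₂).fst = p.rep w₂ := by rw [hg2, fst_dual]
      have h3 := U.prod_lhs_ne_zero h₀ h₁ h₂ u
      rw [map_sub, map_mul, MvPolynomial.eval_X, MvPolynomial.eval_monomial,
        MvPolynomial.eval_monomial, one_mul, one_mul, lhs, rhs, prod_add_single,
        prod_add_single] at h1 h2
      rw [lhs, prod_add_single] at h3
      rw [hq0, hq1, hq2, TrivSqZeroExt.fst_zero] at h1
      exact mul_left_cancel₀ h3 ((sub_eq_zero.1 h1).trans (sub_eq_zero.1 h2).symm)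
    refine ⟨⟨fun u => (g u).snd, (mem_coneTangentSpace_iff hfst).2 fun f hf => by
      rw [hker f hf]; rfl⟩, ?_⟩
    funext i
    fin_cases i
    · change (g w₀).snd = x 0
      rw [hg0, snd_dual]
    · change (g w₁).snd = x 1
      rw [hg1, snd_dual]
    · change (g w₂).snd = x 2
      rw [hg2, snd_dual]
  rw [(LinearEquiv.ofBijective F ⟨hinj, hsurj⟩).finrank_eq, Module.finrank_fin_fun]

end UnimodularCorner

/-! ### Torus-fixed points -/

theorem exists_rep_coordPoint (i : ι) :
    ∃ c : ℂ, c ≠ 0 ∧ (coordPoint i).rep i = c ∧ ∀ j, j ≠ i → (coordPoint i).rep j = 0 := by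
  classical
  obtain ⟨c, hc⟩ := Projectivization.exists_smul_eq_mk_rep ℂ
    (Pi.single i 1 : ι → ℂ) (by simp)
  have h : (coordPoint i).rep = c • Pi.single i (1 : ℂ) := by
    rw [hc, coordPoint]
  refine ⟨c, c.ne_zero, ?_, fun j hj => ?_⟩
  · rw [h, Pi.smul_apply, Pi.single_eq_same, Units.smul_def, smul_eq_mul, mul_one]
  · rw [h, Pi.smul_apply, Pi.single_eq_of_ne hj, smul_zero]

theorem eq_coordPoint {p : ℙ ℂ (ι → ℂ)} {i : ι} (h : ∀ j, j ≠ i → p.rep j = 0) :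
    p = coordPoint i := by
  classical
  rw [← p.mk_rep, coordPoint, Projectivization.mk_eq_mk_iff']
  refine ⟨p.rep i, funext fun j => ?_⟩
  by_cases hj : j = i
  · subst hj
    simp
  · simp [h j hj, hj]

theorem coordPoint_injective : Function.Injective (coordPoint (ι := ι)) := by
  intro i j h
  by_contra hij
  obtain ⟨c, hc, hci, -⟩ := exists_rep_coordPoint i
  obtain ⟨-, -, -, hj⟩ := exists_rep_coordPoint j
  rw [h, hj i hij] at hci
  exact hc hci.symm

/-- A point of the configuration at which a linear functional has its strict minimum gives a
torus-fixed point. -/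
theorem coordPoint_mem_toricVariety [Nonempty ι] {a : ι → Fin m → ℤ} {l : (Fin m → ℤ) →+ ℤ}
    {i : ι} (hl : ∀ u, u ≠ i → l (a i) < l (a u)) : coordPoint i ∈ toricVariety a := by
  have hl' : ∀ u, l (a i) ≤ l (a u) := fun u => by
    by_cases h : u = i
    · rw [h]
    · exact (hl u h).le
  obtain ⟨c, hc, hci, hcj⟩ := exists_rep_coordPoint i
  refine mem_toricVariety_of_prod fun e e' hdeg hw => ?_
  -- Whether a monomial is a pure power of x_i is visible from its degree and weight, since `l` is
  -- minimal at a_i alone. All other monomials vanish at the fixed point.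
  have hzero : ∀ e : ι →₀ ℕ, l (Finsupp.weight a e) ≠ e.degree * l (a i) →
      (e.prod fun j n => (coordPoint i).rep j ^ n) = 0 := by
    intro e he
    rw [Ne, functional_eq_zero_of_mem_support hl'] at he
    push Not at he
    obtain ⟨u, hu, hur⟩ := he
    refine Finset.prod_eq_zero hu ?_
    beta_reduce
    rw [hcj u (fun h => hur (by rw [h])), zero_pow (Finsupp.mem_support_iff.1 hu)]
  by_cases he : l (Finsupp.weight a e) = e.degree * l (a i)
  · have he' : l (Finsupp.weight a e') = e'.degree * l (a i) := by rw [← hw, ← hdeg, he]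
    have hform : ∀ e : ι →₀ ℕ, (∀ u ∈ e.support, l (a u) = l (a i)) →
        e = Finsupp.single i e.degree := by
      intro e he
      have hsub : e.support ⊆ {i} := fun u hu => by
        by_contra h
        exact (hl u (by simpa using h)).ne' (he u hu)
      obtain ⟨n, hn⟩ : ∃ n, e = Finsupp.single i n := ⟨_, Finsupp.support_subset_singleton.1 hsub⟩
      rw [hn, Finsupp.degree_single]
    rw [hform e ((functional_eq_zero_of_mem_support hl').1 he),
      hform e' ((functional_eq_zero_of_mem_support hl').1 he'), hdeg]
  · rw [hzero e he, hzero e' (by rwa [← hw, ← hdeg])]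

theorem eq_single_add_erase (e : ι →₀ ℕ) (i : ι) : e = Finsupp.single i (e i) + e.erase i := by
  classical
  ext u
  by_cases h : u = i
  · subst h; simp
  · simp [h]

theorem exists_eq_single_of_degree_eq_one {e : ι →₀ ℕ} (h : e.degree = 1) :
    ∃ u, e = Finsupp.single u 1 := by
  classical
  obtain ⟨u, hu⟩ : e.support.Nonempty := by
    rw [Finsupp.support_nonempty_iff]
    rintro rfl
    simp at h
  have h1 := congrArg Finsupp.degree (eq_single_add_erase e u)
  rw [map_add, Finsupp.degree_single, h] at h1
  have h2 := Finsupp.mem_support_iff.1 hu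
  have h3 : (e.erase u).degree = 0 := by omega
  rw [Finsupp.degree_eq_zero_iff] at h3
  refine ⟨u, ?_⟩
  rw [eq_single_add_erase e u, h3, add_zero]
  congr 1
  rw [h3, map_zero] at h1
  omega

/-- The exponents of a monomial whose weight relative to a vertex is less than twice the minimal
value of a functional. -/
theorem eq_single_or_of_functional_lt {a : ι → Fin m → ℤ} {l : (Fin m → ℤ) →+ ℤ} {i : ι} {r : ℤ}
    (hr : 0 < r) (hl : ∀ u, u ≠ i → r ≤ l (a u - a i)) {e : ι →₀ ℕ}
    (he : l (Finsupp.weight (translated a (a i)) e) < 2 * r) :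
    (∃ n, e = Finsupp.single i n) ∨ ∃ n u, u ≠ i ∧
      e = Finsupp.single i n + Finsupp.single u 1 := by
  classical
  have h1 : l (Finsupp.weight (translated a (a i)) e) =
      l (Finsupp.weight (translated a (a i)) (e.erase i)) := by
    conv_lhs => rw [eq_single_add_erase e i]
    rw [map_add, Finsupp.weight_single, translated, sub_self, smul_zero, zero_add]
  have h2 : (e.erase i).degree * r ≤ l (Finsupp.weight (translated a (a i)) (e.erase i)) := by
    rw [Finsupp.weight_apply, map_finsuppSum, Finsupp.degree_apply]
    push_cast
    rw [Finset.sum_mul, Finsupp.sum]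
    refine Finset.sum_le_sum fun u hu => ?_
    rw [map_nsmul, nsmul_eq_mul]
    refine mul_le_mul_of_nonneg_left (hl u ?_) (by positivity)
    rintro rfl
    simp at hu
  have h3 : (e.erase i).degree < 2 := by
    by_contra h
    have : (2 : ℤ) ≤ (e.erase i).degree := by exact_mod_cast not_lt.1 h
    nlinarith
  have h4 : (e.erase i).degree = 0 ∨ (e.erase i).degree = 1 := by omega
  rcases h4 with h4 | h4
  · rw [Finsupp.degree_eq_zero_iff] at h4
    exact Or.inl ⟨e i, by conv_lhs => rw [eq_single_add_erase e i, h4, add_zero]⟩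
  · obtain ⟨u, hu⟩ := exists_eq_single_of_degree_eq_one h4
    refine Or.inr ⟨e i, u, ?_, by conv_lhs => rw [eq_single_add_erase e i, hu]⟩
    rintro rfl
    have := congrArg (fun f => f u) hu
    simp at this

/-- At a torus-fixed point the tangent space contains the directions of all points of the
configuration that are irreducible relative to the fixed point. -/
theorem single_mem_coneTangentSpace [Fintype ι] [DecidableEq ι] [Nonempty ι]
    {a : ι → Fin m → ℤ} (ha : Function.Injective a) {l : (Fin m → ℤ) →+ ℤ} {i k : ι} {r : ℤ}
    (hr : 0 < r) (hl : ∀ u, u ≠ i → r ≤ l (a u - a i)) (hk : l (a k - a i) < 2 * r)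
    (hki : k ≠ i) :
    Pi.single k (1 : ℂ) ∈ coneTangentSpace (toricVariety a) (coordPoint i) := by
  obtain ⟨c, hc, hci, hcj⟩ := exists_rep_coordPoint i
  -- The deformation with ε in place k. As ε² = 0, only the monomials x_i^n and x_i^n x_k can have
  -- nonzero value.
  let g : ι → DualNumber ℂ := fun j => dual ((coordPoint i).rep j) ((Pi.single k 1 : ι → ℂ) j)
  have hgi : g i = dual c 0 := by
    simp only [g, hci, Pi.single_eq_of_ne hki.symm]
  have hgk : g k = dual 0 1 := by
    simp only [g, hcj k hki, Pi.single_eq_same]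
  have hgj : ∀ j, j ≠ i → j ≠ k → g j = 0 := by
    intro j h1 h2
    simp only [g, hcj j h1, Pi.single_eq_of_ne h2]
    simp [dual]
  have hsq : g k ^ 2 = 0 := by
    rw [hgk]
    simp [dual, pow_two]
  have hzero : ∀ e : ι →₀ ℕ, (∀ n, e ≠ Finsupp.single i n) →
      (∀ n, e ≠ Finsupp.single i n + Finsupp.single k 1) → (e.prod fun j n => g j ^ n) = 0 := by
    intro e h1 h2
    by_cases hsupp : ∃ j ∈ e.support, j ≠ i ∧ j ≠ k
    · obtain ⟨j, hj, hji, hjk⟩ := hsupp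
      refine Finset.prod_eq_zero hj ?_
      beta_reduce
      rw [hgj j hji hjk, zero_pow (Finsupp.mem_support_iff.1 hj)]
    · push Not at hsupp
      have he : e = Finsupp.single i (e i) + Finsupp.single k (e k) := by
        ext j
        by_cases hji : j = i
        · subst hji; simp [hki]
        · by_cases hjk : j = k
          · subst hjk; simp [hki.symm]
          · have : e j = 0 := by
              by_contra h
              exact hjk (hsupp j (Finsupp.mem_support_iff.2 h) hji)
            simp [this, Ne.symm hji, Ne.symm hjk]
      have hk2 : 2 ≤ e k := by
        by_contra h
        have : e k = 0 ∨ e k = 1 := by omega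
        rcases this with h0 | h0
        · exact h1 (e i) (by conv_lhs => rw [he, h0, Finsupp.single_zero, add_zero])
        · exact h2 (e i) (by conv_lhs => rw [he, h0])
      refine Finset.prod_eq_zero (Finsupp.mem_support_iff.2 (by omega : e k ≠ 0)) ?_
      beta_reduce
      rw [← Nat.sub_add_cancel hk2, pow_add, hsq, mul_zero]
  -- The surviving monomials are alone in their weight classes: below 2r at most one factor differs
  -- from x_i, and that factor is then determined by the weight.
  have hprod : ∀ e e' : ι →₀ ℕ, e.degree = e'.degree → Finsupp.weight a e = Finsupp.weight a e' →
      ((∃ n, e = Finsupp.single i n) ∨ ∃ n, e = Finsupp.single i n + Finsupp.single k 1) →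
      e' = e := by
    intro e e' hdeg hw he
    have hwt : Finsupp.weight (translated a (a i)) e =
        Finsupp.weight (translated a (a i)) e' := by
      rw [weight_translated, weight_translated, hdeg, hw]
    have hwi : ∀ n : ℕ, Finsupp.weight (translated a (a i)) (Finsupp.single i n) = 0 := fun n => by
      rw [Finsupp.weight_single, translated, sub_self, smul_zero]
    have hwu : ∀ (n : ℕ) u, Finsupp.weight (translated a (a i))
        (Finsupp.single i n + Finsupp.single u 1) = a u - a i := fun n u => by
      rw [map_add, hwi, zero_add, Finsupp.weight_single, one_smul, translated]
    have hlt : l (Finsupp.weight (translated a (a i)) e') < 2 * r := by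
      rw [← hwt]
      rcases he with ⟨n, rfl⟩ | ⟨n, rfl⟩
      · rw [hwi, map_zero]; omega
      · rwa [hwu]
    rcases eq_single_or_of_functional_lt hr hl hlt with ⟨n', rfl⟩ | ⟨n', u, hu, rfl⟩ <;>
      rcases he with ⟨n, rfl⟩ | ⟨n, rfl⟩
    · rw [Finsupp.degree_single, Finsupp.degree_single] at hdeg
      rw [hdeg]
    · rw [hwi, hwu] at hwt
      exact absurd (ha (sub_eq_zero.1 hwt)) hki
    · rw [hwi, hwu] at hwt
      exact absurd (ha (sub_eq_zero.1 hwt.symm)) hu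
    · rw [hwu, hwu] at hwt
      have := ha (sub_left_injective hwt)
      subst this
      rw [degree_single_add_single, degree_single_add_single] at hdeg
      have : n = n' := by omega
      rw [this]
  have hker : ∀ f ∈ vanishingIdeal (toricVariety a), MvPolynomial.aeval g f = 0 := by
    intro f hf
    refine aeval_eq_zero_of_mem_ker g (fun e e' h => ?_)
      ((mem_vanishingIdeal_toricVariety a f).1 hf)
    rw [weight_homogenized_eq_iff] at h
    by_cases he : (∃ n, e = Finsupp.single i n) ∨
        ∃ n, e = Finsupp.single i n + Finsupp.single k 1
    · rw [hprod e e' h.1 h.2 he]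
    · by_cases he' : (∃ n, e' = Finsupp.single i n) ∨
          ∃ n, e' = Finsupp.single i n + Finsupp.single k 1
      · rw [hprod e' e h.1.symm h.2.symm he']
      · push Not at he he'
        rw [hzero e he.1 he.2, hzero e' he'.1 he'.2]
  have := (mem_coneTangentSpace_iff (X := toricVariety a) (p := coordPoint i) (g := g)
    fun j => fst_dual _ _).2 fun f hf => by rw [hker f hf, TrivSqZeroExt.snd_zero]
  have hv : (fun j => (g j).snd) = (Pi.single k 1 : ι → ℂ) := funext fun j => snd_dual _ _
  rwa [hv] at this

/-- Euler's relation: a point lies in the tangent space of the cone at this point. -/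
theorem rep_mem_coneTangentSpace [Fintype ι] [Nonempty ι] {a : ι → Fin m → ℤ} {p : ℙ ℂ (ι → ℂ)}
    (hp : p ∈ toricVariety a) : p.rep ∈ coneTangentSpace (toricVariety a) p := by
  let g : ι → DualNumber ℂ := fun j => dual 1 1 * algebraMap ℂ _ (p.rep j)
  have hg : ∀ j, g j = dual (p.rep j) (p.rep j) := fun j => by
    refine TrivSqZeroExt.ext ?_ ?_ <;> simp [g, TrivSqZeroExt.algebraMap_eq_inl]
  have hker : ∀ f ∈ vanishingIdeal (toricVariety a), MvPolynomial.aeval g f = 0 := by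
    intro f hf
    refine aeval_eq_zero_of_mem_ker g (fun e e' h => ?_)
      ((mem_vanishingIdeal_toricVariety a f).1 hf)
    rw [weight_homogenized_eq_iff] at h
    have hsplit : ∀ e : ι →₀ ℕ, (e.prod fun i n => g i ^ n) =
        dual 1 1 ^ e.degree * algebraMap ℂ _ (e.prod fun i n => p.rep i ^ n) := by
      intro e
      simp [Finsupp.prod, g, mul_pow, Finset.prod_mul_distrib, Finset.prod_pow_eq_pow_sum,
        Finsupp.degree_apply]
    rw [hsplit, hsplit, h.1, eval_monomial_eq_of_mem_toricVariety hp h.1 h.2]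
  have := (mem_coneTangentSpace_iff (X := toricVariety a) (p := p) (g := g)
    fun j => by rw [hg, fst_dual]).2 fun f hf => by rw [hker f hf]; rfl
  simpa [hg] using this

/-- If there are three irreducible points of the configuration relative to a torus-fixed point,
then the tangent space of the cone has dimension at least four. -/
theorem four_le_finrank_coneTangentSpace [Fintype ι] [DecidableEq ι] [Nonempty ι]
    {X : Set (ℙ ℂ (ι → ℂ))} {p : ℙ ℂ (ι → ℂ)} {i : ι} (k : Fin 3 → ι) (hk : Function.Injective k)
    (hki : ∀ j, k j ≠ i) (hi : p.rep i ≠ 0) (hp : p.rep ∈ coneTangentSpace X p)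
    (hmem : ∀ j, Pi.single (k j) (1 : ℂ) ∈ coneTangentSpace X p) :
    4 ≤ Module.finrank ℂ (coneTangentSpace X p) := by
  let v : Fin 4 → coneTangentSpace X p := Fin.cons ⟨p.rep, hp⟩ fun j => ⟨_, hmem j⟩
  have hli : LinearIndependent ℂ v := by
    rw [Fintype.linearIndependent_iff]
    intro c hc
    have h1 : ∀ u, ∑ j, c j * (v j).1 u = 0 := by
      intro u
      have := congrFun (congrArg Subtype.val hc) u
      simpa using this
    have h0 : c 0 = 0 := by
      have := h1 i
      rw [Fin.sum_univ_succ] at this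
      simp only [v, Fin.cons_zero, Fin.cons_succ] at this
      rw [Finset.sum_eq_zero fun j _ => by rw [Pi.single_eq_of_ne (hki j).symm, mul_zero],
        add_zero] at this
      exact (mul_eq_zero.1 this).resolve_right hi
    intro j
    refine Fin.cases h0 (fun j => ?_) j
    have := h1 (k j)
    rw [Fin.sum_univ_succ, h0, zero_mul, zero_add] at this
    simp only [v, Fin.cons_succ] at this
    rw [Finset.sum_eq_single j] at this
    · simpa using this
    · intro j' _ hj'
      rw [Pi.single_eq_of_ne (fun h => hj' (hk h).symm), mul_zero]
    · simp
  simpa using hli.fintype_card_le_finrank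

/-! ### The polygon of the second interpolant -/

section Polygon

variable {d : ℕ}

theorem interpolantPoints_zero (d : ℕ) (j : Fin (d + 1)) : interpolantPoints d j 0 = j := rfl

theorem two_mul_interpolantPoints_one (d : ℕ) (j : Fin (d + 1)) :
    2 * interpolantPoints d j 1 = (j : ℤ) * ((j : ℤ) - 1) := by
  change 2 * (((j : ℕ).choose 2 : ℕ) : ℤ) = _
  have h := Nat.triangle_succ ((j : ℕ) - 1)
  rcases Nat.eq_zero_or_pos (j : ℕ) with h0 | h0
  · simp [h0]
  · have h1 := Nat.choose_two_right (j : ℕ)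
    have h2 : 2 ∣ (j : ℕ) * ((j : ℕ) - 1) := (Nat.even_mul_pred_self _).two_dvd
    have h3 : 2 * (j : ℕ).choose 2 = j * (j - 1) := by omega
    have h4 : ((2 * (j : ℕ).choose 2 : ℕ) : ℤ) = ((j * (j - 1) : ℕ) : ℤ) := by rw [h3]
    push_cast [Nat.cast_sub h0] at h4
    exact h4

theorem interpolantPoints_eq_iff (d : ℕ) (j : Fin (d + 1)) (u : Fin 2 → ℤ) :
    interpolantPoints d j = u ↔ u 0 = j ∧ 2 * u 1 = (j : ℤ) * ((j : ℤ) - 1) := by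
  have h := two_mul_interpolantPoints_one d j
  constructor
  · rintro rfl
    exact ⟨rfl, h⟩
  · rintro ⟨h0, h1⟩
    funext i
    fin_cases i
    · exact h0.symm
    · change interpolantPoints d j 1 = u 1
      omega

theorem interpolantPoints_injective (d : ℕ) : Function.Injective (interpolantPoints d) := by
  intro i j h
  have := congrFun h 0
  rw [interpolantPoints_zero, interpolantPoints_zero] at this
  exact Fin.ext (by exact_mod_cast this)

theorem mul_sub_one_nonneg (k : ℤ) : 0 ≤ k * (k - 1) := by
  rcases le_or_gt k 0 with h | h <;> nlinarith

/-- The line through (k, k(k-1)/2) and its successor supports the polygon: at a_j the expression is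
(j - k)(j - k - 1), a product of consecutive integers. For 0 ≤ k < d these lines carry the lower
edges. -/
theorem le_of_mem_polytope {z : Fin 2 → ℝ} (hz : z ∈ polytope (interpolantPoints d)) (k : ℤ) :
    0 ≤ 2 * z 1 - 2 * k * z 0 + k * (k + 1) := by
  have hconv : Convex ℝ {z : Fin 2 → ℝ | 0 ≤ 2 * z 1 - 2 * k * z 0 + k * (k + 1)} := by
    intro x hx y hy a b ha hb hab
    simp only [Set.mem_ofPred_eq, Pi.add_apply, Pi.smul_apply, smul_eq_mul] at hx hy ⊢
    have h1 := mul_nonneg ha hx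
    have h2 := mul_nonneg hb hy
    have h3 : b = 1 - a := by linarith
    subst h3
    linarith
  refine convexHull_min ?_ hconv hz
  rintro _ ⟨j, rfl⟩
  have h := two_mul_interpolantPoints_one d j
  have h2 := mul_sub_one_nonneg ((j : ℤ) - k)
  have h3 : 0 ≤ 2 * interpolantPoints d j 1 - 2 * k * interpolantPoints d j 0 + k * (k + 1) := by
    rw [h, interpolantPoints_zero]
    linarith
  have h4 : ((0 : ℤ) : ℝ) ≤ ((2 * interpolantPoints d j 1 - 2 * k * interpolantPoints d j 0 +
    k * (k + 1) : ℤ) : ℝ) := by exact_mod_cast h3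
  push_cast at h4
  exact h4

theorem mem_polytope_le {z : Fin 2 → ℝ} (hz : z ∈ polytope (interpolantPoints d)) :
    2 * z 1 ≤ (d - 1) * z 0 := by
  have hconv : Convex ℝ {z : Fin 2 → ℝ | 2 * z 1 ≤ (d - 1) * z 0} := by
    intro x hx y hy a b ha hb hab
    simp only [Set.mem_ofPred_eq, Pi.add_apply, Pi.smul_apply, smul_eq_mul] at hx hy ⊢
    have h1 := mul_le_mul_of_nonneg_left hx ha
    have h2 := mul_le_mul_of_nonneg_left hy hb
    linarith
  refine convexHull_min ?_ hconv hz
  rintro _ ⟨j, rfl⟩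
  have h := two_mul_interpolantPoints_one d j
  have h0 : (j : ℤ) ≤ d := by
    have := j.2
    omega
  have h3 : 2 * interpolantPoints d j 1 ≤ ((d : ℤ) - 1) * interpolantPoints d j 0 := by
    rw [h, interpolantPoints_zero]
    nlinarith
  have h4 : ((2 * interpolantPoints d j 1 : ℤ) : ℝ) ≤
    ((((d : ℤ) - 1) * interpolantPoints d j 0 : ℤ) : ℝ) := by exact_mod_cast h3
  push_cast at h4
  exact h4

theorem abscissa_mem_Icc {u : Fin 2 → ℤ} (h : u 0 * (u 0 - 1) ≤ 2 * u 1)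
    (h' : 2 * u 1 ≤ (d - 1) * u 0) : 0 ≤ u 0 ∧ u 0 ≤ d := by
  have h1 : u 0 * (u 0 - d) ≤ 0 := by linarith
  constructor
  · by_contra hc
    nlinarith
  · by_contra hc
    nlinarith

/-- A multiple of a lattice point of the polygon is a sum of vertices. -/
theorem exists_weight_eq_smul {u : Fin 2 → ℤ} (h : u 0 * (u 0 - 1) ≤ 2 * u 1)
    (h' : 2 * u 1 ≤ (d - 1) * u 0) :
    ∃ n, 0 < n ∧ ∃ c : Fin (d + 1) →₀ ℕ, c.degree = n ∧
      Finsupp.weight (interpolantPoints d) c = n • u := by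
  obtain ⟨h0, hd⟩ := abscissa_mem_Icc h h'
  obtain ⟨x, hx⟩ := Int.eq_ofNat_of_zero_le h0
  have hxd : x ≤ d := by omega
  by_cases hend : x = 0 ∨ x = d
  · refine ⟨1, one_pos, Finsupp.single ⟨x, by omega⟩ 1, Finsupp.degree_single _ _, ?_⟩
    rw [Finsupp.weight_single, one_smul, one_smul, interpolantPoints_eq_iff]
    refine ⟨hx, ?_⟩
    rw [hx] at h h'
    rcases hend with h1 | h1
    · subst h1
      push_cast at *
      linarith
    · subst h1
      push_cast at *
      linarith
  · push Not at hend
    obtain ⟨k, hk⟩ := Int.eq_ofNat_of_zero_le (sub_nonneg.2 h)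
    obtain ⟨z, rfl⟩ : ∃ z, d = x + z := ⟨d - x, by omega⟩
    have hkH : k ≤ x * z := by
      have : (k : ℤ) ≤ x * z := by
        rw [← hk]
        push_cast at h'
        rw [hx] at h' ⊢
        linarith
      exact_mod_cast this
    obtain ⟨n, hn⟩ : ∃ n, x * z = k + n := ⟨x * z - k, by omega⟩
    have hxz : 0 < x * z := Nat.mul_pos (by omega) (by omega)
    -- On the vertical line through u, twice the height of the polygon is x z, split by u into k
    -- below and n above. So u is the mean of a_x and the point of the long edge above it with
    -- weights n and k, and that point is the mean of a_0 and a_d with weights z and x. The factor d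
    -- · x z clears denominators.
    refine ⟨(x + z) * (x * z), Nat.mul_pos (by omega) hxz,
      Finsupp.single ⟨x, by omega⟩ ((x + z) * n) + Finsupp.single 0 (k * z) +
        Finsupp.single (Fin.last _) (k * x), ?_, ?_⟩
    · simp only [map_add, Finsupp.degree_single]
      rw [hn]
      ring
    · simp only [map_add, Finsupp.weight_single]
      have hn' : (x : ℤ) * z = k + n := by exact_mod_cast hn
      have e1 := two_mul_interpolantPoints_one (x + z) ⟨x, by omega⟩
      have e2 := two_mul_interpolantPoints_one (x + z) 0
      have e3 := two_mul_interpolantPoints_one (x + z) (Fin.last _)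
      simp only [Fin.val_zero, Fin.val_last] at e1 e2 e3
      push_cast at e1 e2 e3
      rw [hx] at hk
      funext i
      fin_cases i
      · simp only [Fin.zero_eta, Pi.add_apply, Pi.smul_apply]
        simp only [interpolantPoints_zero, nsmul_eq_mul, Fin.val_zero, Fin.val_last, hx]
        push_cast
        rw [hn']
        ring
      · simp only [Fin.mk_one, Pi.add_apply, Pi.smul_apply]
        simp only [nsmul_eq_mul]
        push_cast
        refine mul_left_cancel₀ (two_ne_zero (α := ℤ)) ?_
        have e4 : 2 * u 1 = k + x * (x - 1) := by linarith
        calc _ = (x + z : ℤ) * n * (2 * interpolantPoints (x + z) ⟨x, by omega⟩ 1) +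
              k * z * (2 * interpolantPoints (x + z) 0 1) +
              k * x * (2 * interpolantPoints (x + z) (Fin.last _) 1) := by ring
          _ = (x + z : ℤ) * (x * z) * (2 * u 1) := by
            rw [e1, e2, e3, e4, hn']
            have : (n : ℤ) = x * z - k := by linarith
            rw [this]
            ring
          _ = _ := by ring

theorem mem_polytope_of_weight [Finite ι] {a : ι → Fin m → ℤ} {u : Fin m → ℤ} {n : ℕ}
    (hn : 0 < n) {c : ι →₀ ℕ} (hc : c.degree = n) (hw : Finsupp.weight a c = n • u) :
    toReal u ∈ polytope a := by
  have hn' : (n : ℝ) ≠ 0 := by positivity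
  have h1 : toReal u = ∑ j ∈ c.support, ((c j : ℝ) / n) • toReal (a j) := by
    funext i
    have h2 := congrFun hw i
    rw [Finsupp.weight_apply, Finsupp.sum, Finset.sum_apply] at h2
    have h3 : (∑ j ∈ c.support, (c j : ℝ) * (a j i : ℝ)) = n * u i := by
      have := congrArg (Int.cast : ℤ → ℝ) h2
      simpa using this
    simp only [Finset.sum_apply, Pi.smul_apply, toReal, smul_eq_mul, div_mul_eq_mul_div]
    rw [← Finset.sum_div, h3]
    field_simp
  rw [h1]
  refine (convex_convexHull ℝ _).sum_mem (fun j _ => by positivity) ?_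
    fun j _ => subset_convexHull ℝ _ ⟨j, rfl⟩
  rw [← Finset.sum_div, div_eq_one_iff_eq hn', ← hc, Finsupp.degree_apply]
  push_cast
  rfl

/-- At an integral abscissa the lower boundary passes through a point a_j, so one quadratic
inequality replaces all the lower edges. -/
theorem mem_latticePoints_iff {u : Fin 2 → ℤ} :
    u ∈ latticePoints (interpolantPoints d) ↔
      u 0 * (u 0 - 1) ≤ 2 * u 1 ∧ 2 * u 1 ≤ (d - 1) * u 0 := by
  constructor
  · intro hu
    have h1 := le_of_mem_polytope hu (u 0)
    have h2 := mem_polytope_le hu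
    simp only [toReal] at h1 h2
    constructor
    · have : (((u 0 * (u 0 - 1) : ℤ)) : ℝ) ≤ ((2 * u 1 : ℤ) : ℝ) := by
        push_cast
        linarith
      exact_mod_cast this
    · have : ((2 * u 1 : ℤ) : ℝ) ≤ ((((d : ℤ) - 1) * u 0 : ℤ) : ℝ) := by
        push_cast
        exact h2
      exact_mod_cast this
  · rintro ⟨h, h'⟩
    obtain ⟨n, hn, c, hc, hw⟩ := exists_weight_eq_smul h h'
    exact mem_polytope_of_weight hn hc hw

theorem le_of_mem_latticePoints {u : Fin 2 → ℤ} (hu : u ∈ latticePoints (interpolantPoints d))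
    (k : ℤ) : 0 ≤ 2 * u 1 - 2 * k * u 0 + k * (k + 1) := by
  have h1 := (mem_latticePoints_iff.1 hu).1
  have h2 := mul_sub_one_nonneg (u 0 - k)
  linarith

instance nonempty_latticePoints : Nonempty (latticePoints (interpolantPoints d)) :=
  ⟨toLatticePoint _ 0⟩

theorem saturation_injective (a : ι → Fin m → ℤ) : Function.Injective (saturation a) :=
  Subtype.val_injective

theorem toLatticePoint_injective (d : ℕ) :
    Function.Injective (toLatticePoint (interpolantPoints d)) := fun _ _ h =>
  interpolantPoints_injective d (congrArg Subtype.val h)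

theorem eq_toLatticePoint_iff (u : latticePoints (interpolantPoints d)) (j : Fin (d + 1)) :
    u = toLatticePoint (interpolantPoints d) j ↔
      u.1 0 = j ∧ 2 * u.1 1 = (j : ℤ) * ((j : ℤ) - 1) := by
  rw [← interpolantPoints_eq_iff, Subtype.ext_iff, eq_comm]
  rfl

/-- The linear functional with the given coefficients. -/
def functional (x y : ℤ) : (Fin 2 → ℤ) →+ ℤ where
  toFun w := x * w 0 + y * w 1
  map_zero' := by simp
  map_add' v w := by simp only [Pi.add_apply]; ring

theorem functional_apply (x y : ℤ) (w : Fin 2 → ℤ) : functional x y w = x * w 0 + y * w 1 := rfl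

/-- A unimodular corner in the plane. -/
def cornerOfDet {a : ι → Fin 2 → ℤ} {w₀ w₁ w₂ : ι} (D : ℤ) (hD : D * D = 1)
    (h : (a w₁ 0 - a w₀ 0) * (a w₂ 1 - a w₀ 1) - (a w₁ 1 - a w₀ 1) * (a w₂ 0 - a w₀ 0) = D) :
    UnimodularCorner a w₀ w₁ w₂ where
  α := functional (D * (a w₂ 1 - a w₀ 1)) (-(D * (a w₂ 0 - a w₀ 0)))
  β := functional (-(D * (a w₁ 1 - a w₀ 1))) (D * (a w₁ 0 - a w₀ 0))
  α_one := by
    simp only [functional_apply, Pi.sub_apply]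
    linear_combination D * h + hD
  α_two := by
    simp only [functional_apply, Pi.sub_apply]
    ring
  β_one := by
    simp only [functional_apply, Pi.sub_apply]
    ring
  β_two := by
    simp only [functional_apply, Pi.sub_apply]
    linear_combination D * h + hD
  eq_add w := by
    funext i
    fin_cases i
    · simp only [Fin.zero_eta, functional_apply, Pi.sub_apply, Pi.add_apply, Pi.smul_apply,
        smul_eq_mul]
      linear_combination (-D * w 0) * h - w 0 * hD
    · simp only [Fin.mk_one, functional_apply, Pi.sub_apply, Pi.add_apply, Pi.smul_apply,
        smul_eq_mul]
      linear_combination (-D * w 1) * h - w 1 * hD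

end Polygon

section Polygon

variable {d : ℕ}

/-! ### Dimension -/

theorem toLatticePoint_apply_zero (j : Fin (d + 1)) :
    (toLatticePoint (interpolantPoints d) j).1 0 = j := rfl

theorem two_mul_toLatticePoint_apply_one (j : Fin (d + 1)) :
    2 * (toLatticePoint (interpolantPoints d) j).1 1 = (j : ℤ) * ((j : ℤ) - 1) :=
  two_mul_interpolantPoints_one d j

/-- The corner of the polygon at the vertex `a_j`, for `0 < j < d`. -/
def innerCorner {j : ℕ} (h0 : 0 < j) (hd : j < d) :
    UnimodularCorner (saturation (interpolantPoints d))
      (toLatticePoint _ (⟨j, by omega⟩ : Fin (d + 1))) (toLatticePoint _ ⟨j + 1, by omega⟩)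
      (toLatticePoint _ ⟨j - 1, by omega⟩) :=
  cornerOfDet 1 (by norm_num) (by
    have e1 := two_mul_toLatticePoint_apply_one (⟨j, by omega⟩ : Fin (d + 1))
    have e2 := two_mul_toLatticePoint_apply_one (⟨j + 1, by omega⟩ : Fin (d + 1))
    have e3 := two_mul_toLatticePoint_apply_one (⟨j - 1, by omega⟩ : Fin (d + 1))
    simp only [saturation, toLatticePoint_apply_zero] at *
    push_cast [Nat.cast_sub (show 1 ≤ j from h0)] at *
    refine mul_left_cancel₀ (two_ne_zero (α := ℤ)) ?_
    linear_combination e3 - e1 + e2 - e1)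

/-- The two corner coordinates vanish on the two lower edges at a_j, so they are the supporting
functionals for k = j - 1 and k = j. -/
theorem innerCorner_nonneg {j : ℕ} (h0 : 0 < j) (hd : j < d)
    (u : latticePoints (interpolantPoints d)) :
    0 ≤ (innerCorner h0 hd).α (u.1 - interpolantPoints d ⟨j, by omega⟩) ∧
      0 ≤ (innerCorner h0 hd).β (u.1 - interpolantPoints d ⟨j, by omega⟩) := by
  have e1 := two_mul_interpolantPoints_one d ⟨j, by omega⟩
  have e2 := two_mul_toLatticePoint_apply_one (⟨j + 1, by omega⟩ : Fin (d + 1))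
  have e3 := two_mul_toLatticePoint_apply_one (⟨j - 1, by omega⟩ : Fin (d + 1))
  have e4 := two_mul_toLatticePoint_apply_one (⟨j, by omega⟩ : Fin (d + 1))
  have h1 := le_of_mem_latticePoints u.2 j
  have h2 := le_of_mem_latticePoints u.2 (j - 1)
  simp only [innerCorner, cornerOfDet, functional_apply, saturation, toLatticePoint_apply_zero,
    Pi.sub_apply, interpolantPoints_zero] at *
  push_cast [Nat.cast_sub (show 1 ≤ j from h0)] at *
  generalize (toLatticePoint (interpolantPoints d) ⟨j, by omega⟩).1 1 = y at *
  generalize (toLatticePoint (interpolantPoints d) ⟨j - 1, by omega⟩).1 1 = y' at *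
  generalize (toLatticePoint (interpolantPoints d) ⟨j + 1, by omega⟩).1 1 = y'' at *
  generalize interpolantPoints d ⟨j, by omega⟩ 1 = z at *
  have h3 : y' - y = -(j - 1) := by linarith
  have h4 : y'' - y = j := by linarith
  have h5 : z = y := by linarith
  rw [h3, h4, h5]
  constructor <;> nlinarith

theorem ringKrullDim_satInterpolant (hd : 3 ≤ d) :
    ringKrullDim (coordRing (satInterpolant d)) = 3 := by
  classical
  have U := innerCorner (d := d) (j := 1) one_pos (by omega)
  refine le_antisymm ?_ ?_
  · refine (ringKrullDim_coordRing_le _ _ fun u => ⟨U.lhs u, U.rhs u, U.support_lhs u,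
      U.support_rhs u, U.degree_lhs u, U.weight_lhs u⟩).trans ?_
    exact_mod_cast Finset.card_le_three
  · refine le_ringKrullDim_coordRing (l := functional 0 1) (r := 0)
      (u₀ := toLatticePoint _ 0) (u₁ := toLatticePoint _ ⟨1, by omega⟩) (u₂ := toLatticePoint _ ⟨2, by omega⟩)
      (fun u => ?_) (fun h => ?_) ?_ fun u => ?_
    · have := le_of_mem_latticePoints u.2 0
      simp only [functional_apply, saturation]
      linarith
    · have := interpolantPoints_injective d h
      have := congrArg Fin.val this
      simp at this
    · have := two_mul_toLatticePoint_apply_one (⟨2, by omega⟩ : Fin (d + 1))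
      simp only [functional_apply, saturation] at *
      push_cast at *
      linarith
    · rw [eq_toLatticePoint_iff, eq_toLatticePoint_iff]
      have h := (mem_latticePoints_iff.1 u.2).1
      have hnn := mul_sub_one_nonneg (u.1 0)
      simp only [functional_apply, saturation, Fin.val_zero]
      push_cast
      constructor
      · intro h2
        have h3 : u.1 0 * (u.1 0 - 1) = 0 := by linarith
        rcases mul_eq_zero.1 h3 with h4 | h4
        · exact Or.inl ⟨h4, by linarith⟩
        · exact Or.inr ⟨by linarith, by linarith⟩
      · rintro (⟨h2, h3⟩ | ⟨h2, h3⟩) <;> linarith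

/-! ### Normality -/

/-- The linear part of the affine involution of the polygon that exchanges its ends. -/
def reflection (d : ℕ) : (Fin 2 → ℤ) →+ (Fin 2 → ℤ) where
  toFun w := ![-w 0, w 1 - (d - 1) * w 0]
  map_zero' := by
    funext i
    fin_cases i <;> simp
  map_add' v w := by
    funext i
    fin_cases i
    · simp only [Fin.zero_eta, Pi.add_apply, Matrix.cons_val_zero]
      ring
    · simp only [Fin.mk_one, Pi.add_apply, Matrix.cons_val_one, Matrix.cons_val_zero]
      ring

theorem reflection_apply_zero (w : Fin 2 → ℤ) : reflection d w 0 = -w 0 := rfl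

theorem reflection_apply_one (w : Fin 2 → ℤ) : reflection d w 1 = w 1 - (d - 1) * w 0 := rfl

theorem reflection_reflection (w : Fin 2 → ℤ) : reflection d (reflection d w) = w := by
  funext i
  fin_cases i
  · simp only [Fin.zero_eta, reflection_apply_zero, neg_neg]
  · simp only [Fin.mk_one, reflection_apply_one, reflection_apply_zero]
    ring

theorem reflection_add_mem {u : Fin 2 → ℤ} (hu : u ∈ latticePoints (interpolantPoints d)) :
    reflection d u + interpolantPoints d (Fin.last d) ∈ latticePoints (interpolantPoints d) := by
  rw [mem_latticePoints_iff] at *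
  have h := two_mul_interpolantPoints_one d (Fin.last d)
  simp only [Pi.add_apply, reflection_apply_zero, reflection_apply_one, interpolantPoints_zero,
    Fin.val_last] at *
  constructor <;> linarith [hu.1, hu.2]

theorem reflection_sub_mem {u : Fin 2 → ℤ} (hu : u ∈ latticePoints (interpolantPoints d)) :
    reflection d (u - interpolantPoints d (Fin.last d)) ∈ latticePoints (interpolantPoints d) := by
  rw [mem_latticePoints_iff] at *
  have h := two_mul_interpolantPoints_one d (Fin.last d)
  simp only [Pi.sub_apply, reflection_apply_zero, reflection_apply_one, interpolantPoints_zero,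
    Fin.val_last] at *
  constructor <;> linarith [hu.1, hu.2]

theorem interpolantPoints_at_zero (d : ℕ) : interpolantPoints d 0 = 0 := by
  rw [interpolantPoints_eq_iff]
  simp

/-- The lattice points of the polygon generate the monoid of lattice points of its cone at the
origin. -/
theorem mem_closure_of_mem_cone (hd : 2 ≤ d) (w : Fin 2 → ℤ) (h0 : 0 ≤ w 1)
    (h1 : 2 * w 1 ≤ (d - 1) * w 0) :
    w ∈ AddSubmonoid.closure (latticePoints (interpolantPoints d)) := by
  have hw0 : 0 ≤ w 0 := by
    by_contra h
    have : (2 : ℤ) ≤ d := by exact_mod_cast hd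
    nlinarith
  obtain ⟨n, hn⟩ := Int.eq_ofNat_of_zero_le hw0
  induction n using Nat.strong_induction_on generalizing w with
  | _ n ih =>
    have hd2 : (2 : ℤ) ≤ d := by exact_mod_cast hd
    rcases Nat.eq_zero_or_pos n with rfl | hpos
    · have : w = 0 := by
        funext i
        fin_cases i
        · exact hn
        · change w 1 = 0
          rw [hn] at h1
          push_cast at h1
          linarith
      rw [this]
      exact zero_mem _
    have step : ∀ g : Fin 2 → ℤ, g ∈ latticePoints (interpolantPoints d) → 0 < g 0 →
        0 ≤ w 1 - g 1 → 2 * (w 1 - g 1) ≤ (d - 1) * (w 0 - g 0) →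
        w ∈ AddSubmonoid.closure (latticePoints (interpolantPoints d)) := by
      intro g hg hg0 h2 h3
      have h4 : 0 ≤ w 0 - g 0 := by
        by_contra h
        nlinarith
      obtain ⟨k, hk⟩ := Int.eq_ofNat_of_zero_le h4
      have h5 := ih k (by omega) (w - g) h2 h3 h4 hk
      rw [← sub_add_cancel w g]
      exact add_mem h5 (AddSubmonoid.subset_closure hg)
    have hn1 : (1 : ℤ) ≤ w 0 := by rw [hn]; exact_mod_cast hpos
    -- If column 1 of the polygon reaches the height of w, subtracting (1, w 1) leaves a point of
    -- the horizontal edge of the cone.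
    rcases le_or_gt (2 * w 1) (d - 1) with h2 | h2
    · refine step ![1, w 1] ?_ ?_ ?_ ?_
      · rw [mem_latticePoints_iff]
        simp only [Matrix.cons_val_zero, Matrix.cons_val_one]
        constructor <;> linarith
      · simp
      · simp
      · simp only [Matrix.cons_val_zero, Matrix.cons_val_one]
        nlinarith
    -- Otherwise the highest lattice point (1, h) of column 1 is to be subtracted.
    rcases Int.even_or_odd' (d - 1 : ℤ) with ⟨h, hh | hh⟩
    · refine step ![1, h] ?_ ?_ ?_ ?_
      · rw [mem_latticePoints_iff]
        simp only [Matrix.cons_val_zero, Matrix.cons_val_one]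
        constructor <;> linarith
      · simp
      · simp only [Matrix.cons_val_one, Matrix.cons_val_zero]
        linarith
      · simp only [Matrix.cons_val_zero, Matrix.cons_val_one]
        linarith
    -- For even d the point (1, h) lies strictly below the long edge. If w is on that edge, the
    -- primitive edge vector (2, d - 1) is subtracted instead; off the edge, integrality leaves just
    -- enough room for (1, h).
    · rcases eq_or_lt_of_le h1 with h3 | h3
      · have hw02 : 2 ≤ w 0 := by
          by_contra hc
          have : w 0 = 1 := by omega
          rw [this] at h3
          omega
        refine step ![2, d - 1] ?_ ?_ ?_ ?_
        · rw [mem_latticePoints_iff]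
          simp only [Matrix.cons_val_zero, Matrix.cons_val_one]
          constructor <;> linarith
        · simp
        · simp only [Matrix.cons_val_one, Matrix.cons_val_zero]
          nlinarith
        · simp only [Matrix.cons_val_zero, Matrix.cons_val_one]
          linarith
      · refine step ![1, h] ?_ ?_ ?_ ?_
        · rw [mem_latticePoints_iff]
          simp only [Matrix.cons_val_zero, Matrix.cons_val_one]
          constructor <;> linarith
        · simp
        · simp only [Matrix.cons_val_one, Matrix.cons_val_zero]
          linarith
        · simp only [Matrix.cons_val_zero, Matrix.cons_val_one]
          linarith

/-- At an inner vertex the cone semigroup is free. At the origin it is generated by the lattice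
points of the polygon, and the other end follows by reflection. -/
theorem isIntegrallyClosed_chartRing_satInterpolant (hd : 3 ≤ d) (j : Fin (d + 1)) :
    IsIntegrallyClosed
      (chartRing (satInterpolant d) (toLatticePoint (interpolantPoints d) j)) := by
  have hd3 : (3 : ℤ) ≤ d := by exact_mod_cast hd
  by_cases h0 : j = 0
  · subst h0
    have hz : saturation (interpolantPoints d) (toLatticePoint (interpolantPoints d) 0) = 0 :=
      interpolantPoints_at_zero d
    refine isIntegrallyClosed_chartRing _ _ (functional 0 1) (functional (d - 1) (-2)) ?_ ?_ ?_ ?_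
    · intro v w hvw
      simp only [functional_apply, Prod.mk.injEq] at hvw
      have h1 : v 1 = w 1 := by linarith [hvw.1]
      have h2 : ((d : ℤ) - 1) * (v 0 - w 0) = 0 := by linarith [hvw.2]
      have h3 := (mul_eq_zero.1 h2).resolve_left (by omega)
      funext i
      fin_cases i
      · change v 0 = w 0
        omega
      · exact h1
    · intro u
      have := le_of_mem_latticePoints u.2 0
      rw [hz]
      simp only [functional_apply, saturation, sub_zero]
      linarith
    · intro u
      have := (mem_latticePoints_iff.1 u.2).2
      rw [hz]
      simp only [functional_apply, saturation, sub_zero]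
      linarith
    · intro w h1 h2
      simp only [functional_apply] at h1 h2
      have h3 := mem_closure_of_mem_cone (d := d) (by omega) w (by linarith) (by linarith)
      refine AddSubmonoid.closure_mono ?_ h3
      intro u hu
      refine ⟨⟨u, hu⟩, ?_⟩
      beta_reduce
      rw [hz, sub_zero]
      rfl
  by_cases hl : j = Fin.last d
  · subst hl
    have hz : saturation (interpolantPoints d)
      (toLatticePoint (interpolantPoints d) (Fin.last d)) = interpolantPoints d (Fin.last d) := rfl
    have e := two_mul_interpolantPoints_one d (Fin.last d)
    rw [Fin.val_last] at e
    refine isIntegrallyClosed_chartRing _ _ (functional (1 - d) 1) (functional (d - 1) (-2))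
      ?_ ?_ ?_ ?_
    · intro v w hvw
      simp only [functional_apply, Prod.mk.injEq] at hvw
      have h1 : v 1 = w 1 := by linarith [hvw.1, hvw.2]
      have h2 : ((d : ℤ) - 1) * (v 0 - w 0) = 0 := by rw [h1] at hvw; linarith [hvw.2]
      have h3 := (mul_eq_zero.1 h2).resolve_left (by omega)
      funext i
      fin_cases i
      · change v 0 = w 0
        omega
      · exact h1
    · intro u
      have := le_of_mem_latticePoints u.2 (d - 1)
      rw [hz]
      simp only [functional_apply, saturation, Pi.sub_apply, interpolantPoints_zero, Fin.val_last]
      linarith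
    · intro u
      have := (mem_latticePoints_iff.1 u.2).2
      rw [hz]
      simp only [functional_apply, saturation, Pi.sub_apply, interpolantPoints_zero, Fin.val_last]
      linarith
    · intro w h1 h2
      simp only [functional_apply] at h1 h2
      have h3 := mem_closure_of_mem_cone (d := d) (by omega) (reflection d w)
        (by rw [reflection_apply_one]; linarith)
        (by rw [reflection_apply_zero, reflection_apply_one]; linarith)
      have h4 := AddSubmonoid.mem_map_of_mem (reflection d) h3
      rw [reflection_reflection, AddMonoidHom.map_mclosure] at h4
      refine AddSubmonoid.closure_mono ?_ h4
      rintro _ ⟨u, hu, rfl⟩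
      refine ⟨⟨_, reflection_add_mem hu⟩, ?_⟩
      rw [hz]
      simp [saturation]
  · obtain ⟨j, hj⟩ := j
    have hj0 : 0 < j := Nat.pos_of_ne_zero fun h => h0 (Fin.ext h)
    have hjd : j < d := by
      have : j ≠ d := fun h => hl (Fin.ext h)
      omega
    let U := innerCorner hj0 hjd
    have hU := innerCorner_nonneg hj0 hjd
    refine isIntegrallyClosed_chartRing _ _ U.α U.β ?_ (fun u => (hU u).1) (fun u => (hU u).2) ?_
    · intro v w hvw
      rw [U.eq_add v, U.eq_add w, show U.α v = U.α w from congrArg Prod.fst hvw,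
        show U.β v = U.β w from congrArg Prod.snd hvw]
    · intro w h1 h2
      obtain ⟨x, hx⟩ := Int.eq_ofNat_of_zero_le h1
      obtain ⟨y, hy⟩ := Int.eq_ofNat_of_zero_le h2
      rw [U.eq_add w, hx, hy]
      simp only [natCast_zsmul]
      exact add_mem
        (nsmul_mem (AddSubmonoid.subset_closure (Set.mem_range_self (toLatticePoint _ _))) _)
        (nsmul_mem (AddSubmonoid.subset_closure (Set.mem_range_self (toLatticePoint _ _))) _)

theorem isNormalizationByProjection_satInterpolant (hd : 3 ≤ d) :
    IsNormalizationByProjection (toLatticePoint (interpolantPoints d)) (satInterpolant d)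
      (interpolant d) := by
  refine isNormalizationByProjection_of_lattice (fun j => rfl)
    (isIntegrallyClosed_chartRing_satInterpolant hd) (fun u => ?_) fun u => ?_
  · obtain ⟨h, h'⟩ := mem_latticePoints_iff.1 u.2
    exact exists_weight_eq_smul h h'
  · have e0 := two_mul_interpolantPoints_one d ⟨0, by omega⟩
    have e1 := two_mul_interpolantPoints_one d ⟨1, by omega⟩
    have e2 := two_mul_interpolantPoints_one d ⟨2, by omega⟩
    generalize hx : u.1 0 = x
    generalize hy : u.1 1 = y
    -- The affine combination (x, y) = (1 - x + y) a_0 + (x - 2y) a_1 + y a_2, with negative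
    -- coefficients moved to the other side.
    refine ⟨Finsupp.single ⟨0, by omega⟩ (-(1 - x + y)).toNat +
        Finsupp.single ⟨1, by omega⟩ (-(x - 2 * y)).toNat + Finsupp.single ⟨2, by omega⟩ (-y).toNat,
      Finsupp.single ⟨0, by omega⟩ (1 - x + y).toNat +
        Finsupp.single ⟨1, by omega⟩ (x - 2 * y).toNat + Finsupp.single ⟨2, by omega⟩ y.toNat,
      ?_, ?_⟩
    · simp only [map_add, Finsupp.degree_single]
      omega
    · simp only [map_add, Finsupp.weight_single]
      funext i
      fin_cases i
      · simp only [Fin.zero_eta, Pi.add_apply, Pi.smul_apply, saturation]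
        simp only [interpolantPoints_zero, nsmul_eq_mul, hx]
        push_cast [Fin.val_zero]
        omega
      · simp only [Fin.mk_one, Pi.add_apply, Pi.smul_apply, saturation]
        push_cast at e0 e1 e2
        have f0 : interpolantPoints d ⟨0, by omega⟩ 1 = 0 := by linarith
        have f1 : interpolantPoints d ⟨1, by omega⟩ 1 = 0 := by linarith
        have f2 : interpolantPoints d ⟨2, by omega⟩ 1 = 1 := by linarith
        simp only [nsmul_eq_mul, hy, f0, f1, f2]
        omega

end Polygon

section Polygon

variable {d : ℕ}

/-! ### Singular points -/

theorem isNonsingularAt_satInterpolant_iff (hd : 3 ≤ d)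
    (p : ℙ ℂ (latticePoints (interpolantPoints d) → ℂ)) :
    IsNonsingularAt (satInterpolant d) p ↔
      Module.finrank ℂ (coneTangentSpace (satInterpolant d) p) = 3 := by
  rw [IsNonsingularAt, ringKrullDim_satInterpolant hd, eq_comm]
  norm_cast

/-- A lattice point with prescribed coordinates. -/
def latticePoint (x y : ℤ) (h : x * (x - 1) ≤ 2 * y) (h' : 2 * y ≤ (d - 1) * x) :
    latticePoints (interpolantPoints d) :=
  ⟨![x, y], mem_latticePoints_iff.2 ⟨h, h'⟩⟩

theorem latticePoint_apply_zero (x y : ℤ) (h : x * (x - 1) ≤ 2 * y)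
    (h' : 2 * y ≤ (d - 1) * x) : (latticePoint x y h h').1 0 = x := rfl

theorem latticePoint_apply_one (x y : ℤ) (h : x * (x - 1) ≤ 2 * y)
    (h' : 2 * y ≤ (d - 1) * x) : (latticePoint x y h h').1 1 = y := rfl

theorem isNonsingularAt_of_inner (hd : 3 ≤ d) {j : ℕ} (h0 : 0 < j) (hjd : j < d)
    {p : ℙ ℂ (latticePoints (interpolantPoints d) → ℂ)} (hp : p ∈ satInterpolant d)
    (hj : p.rep (toLatticePoint _ ⟨j, by omega⟩) ≠ 0) : IsNonsingularAt (satInterpolant d) p := by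
  rw [isNonsingularAt_satInterpolant_iff hd]
  exact (innerCorner h0 hjd).finrank_coneTangentSpace hp hj
    (Or.inr fun u => (innerCorner_nonneg h0 hjd u).1)
    (Or.inr fun u => (innerCorner_nonneg h0 hjd u).2)

/-- A power of the coordinate of any other lattice point u is a monomial in the coordinates of the
points a_i. It involves some i ≠ j, for otherwise u would be a_j. -/
theorem eq_fixedPoint_of_rep_eq_zero {p : ℙ ℂ (latticePoints (interpolantPoints d) → ℂ)}
    (hp : p ∈ satInterpolant d) {j : Fin (d + 1)}
    (h : ∀ i, i ≠ j → p.rep (toLatticePoint _ i) = 0) : p = fixedPoint d j := by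
  refine eq_coordPoint fun u hu => ?_
  obtain ⟨h1, h2⟩ := mem_latticePoints_iff.1 u.2
  obtain ⟨n, hn, c, hc, hcu⟩ := exists_weight_eq_smul h1 h2
  have h3 := eval_monomial_eq_of_mem_toricVariety hp (e := Finsupp.single u n)
    (e' := c.mapDomain (toLatticePoint _)) (by rw [degree_mapDomain, hc, Finsupp.degree_single])
    (by rw [weight_mapDomain (interpolantPoints d) (saturation (interpolantPoints d)) _ fun j => rfl,
          hcu, Finsupp.weight_single]
        rfl)
  rw [Finsupp.prod_single_index (h := fun i n => p.rep i ^ n) (pow_zero _),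
    Finsupp.prod_mapDomain_index (by simp) (by simp [pow_add])] at h3
  have h4 : (c.prod fun j k => p.rep (toLatticePoint _ j) ^ k) = 0 := by
    by_cases hs : ∃ i ∈ c.support, i ≠ j
    · obtain ⟨i, hi, hij⟩ := hs
      refine Finset.prod_eq_zero hi ?_
      beta_reduce
      rw [h i hij, zero_pow (Finsupp.mem_support_iff.1 hi)]
    · exfalso
      push Not at hs
      obtain ⟨k, rfl⟩ : ∃ k, c = Finsupp.single j k :=
        ⟨_, Finsupp.support_subset_singleton.1 fun i hi => Finset.mem_singleton.2 (hs i hi)⟩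
      rw [Finsupp.degree_single] at hc
      subst hc
      rw [Finsupp.weight_single] at hcu
      refine hu (Subtype.ext ?_)
      funext i
      have h5 := congrFun hcu i
      rw [Pi.smul_apply, Pi.smul_apply, nsmul_eq_mul, nsmul_eq_mul] at h5
      exact (mul_left_cancel₀ (by positivity : (k : ℤ) ≠ 0) h5).symm
  rw [h4] at h3
  exact eq_zero_of_pow_eq_zero h3

/-- Where both end coordinates are nonzero, so is that of the first lattice point on the long edge.
Its direction is then invertible, and one transversal direction completes a unimodular corner. -/
theorem isNonsingularAt_of_edge (hd : 3 ≤ d)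
    {p : ℙ ℂ (latticePoints (interpolantPoints d) → ℂ)} (hp : p ∈ satInterpolant d)
    (h0 : p.rep (toLatticePoint _ 0) ≠ 0) (h1 : p.rep (toLatticePoint _ (Fin.last d)) ≠ 0) :
    IsNonsingularAt (satInterpolant d) p := by
  rw [isNonsingularAt_satInterpolant_iff hd]
  have hd3 : (3 : ℤ) ≤ d := by exact_mod_cast hd
  -- The vector (g, q) is primitive on the long edge, which is K times as long. The equation q = g z
  -- + 1 makes (1, z) complete it to a basis of determinant -1.
  obtain ⟨g, q, K, z, hgK, hq, hz, hg⟩ : ∃ (g q : ℤ) (K : ℕ) (z : ℤ), g * K = d ∧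
      2 * q = (d - 1) * g ∧ 0 ≤ z ∧ (1 ≤ g ∧ (q = g * z + 1)) := by
    rcases Nat.even_or_odd' d with ⟨n, rfl | rfl⟩
    · refine ⟨2, 2 * n - 1, n, n - 1, by push_cast; ring, by push_cast; ring, ?_, by norm_num,
        by ring⟩
      push_cast at hd3
      omega
    · refine ⟨1, n, 2 * n + 1, n - 1, by push_cast; ring, by push_cast; ring, ?_, le_rfl, by ring⟩
      push_cast at hd3
      omega
  have hK : 1 ≤ K := by
    by_contra h
    obtain rfl : K = 0 := by omega
    simp at hgK
    omega
  have hgd : g ≤ d := by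
    have : (1 : ℤ) ≤ K := by exact_mod_cast hK
    nlinarith
  let w₁ : latticePoints (interpolantPoints d) := latticePoint g q (by nlinarith) hq.le
  let w₂ : latticePoints (interpolantPoints d) := latticePoint 1 z (by linarith) (by nlinarith)
  have hw₀ : (toLatticePoint (interpolantPoints d) 0).1 = 0 := interpolantPoints_at_zero d
  let U : UnimodularCorner (saturation (interpolantPoints d)) (toLatticePoint _ 0) w₁ w₂ :=
    cornerOfDet (-1) (by norm_num) (by
      simp only [saturation, w₁, w₂, latticePoint_apply_zero, latticePoint_apply_one, hw₀,
        Pi.zero_apply]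
      rw [hg.2]
      ring)
  refine U.finrank_coneTangentSpace hp h0 (Or.inl fun h => ?_) (Or.inr fun u => ?_)
  -- Along the long edge, K·w₁ + a_0 = K·a_0 + a_d, so the coordinate at w₁ cannot vanish.
  · have h3 := eval_monomial_eq_of_mem_toricVariety hp
      (e := Finsupp.single w₁ K + Finsupp.single (toLatticePoint _ 0) 1)
      (e' := Finsupp.single (toLatticePoint _ 0) K +
        Finsupp.single (toLatticePoint _ (Fin.last d)) 1)
      (by rw [degree_single_add_single, degree_single_add_single]) (by
        rw [weight_single_add_single, weight_single_add_single]
        have e := two_mul_interpolantPoints_one d (Fin.last d)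
        rw [Fin.val_last] at e
        funext i
        fin_cases i
        · simp only [Fin.zero_eta, Pi.add_apply, Pi.smul_apply, saturation, w₁,
            latticePoint_apply_zero, hw₀, Pi.zero_apply, toLatticePoint_apply_zero, Fin.val_last]
          simp only [nsmul_eq_mul]
          push_cast
          linarith
        · simp only [Fin.mk_one, Pi.add_apply, Pi.smul_apply, saturation, w₁,
            latticePoint_apply_one, hw₀, Pi.zero_apply]
          simp only [nsmul_eq_mul]
          change (K : ℤ) * q + _ = _ + _ * interpolantPoints d (Fin.last d) 1
          push_cast
          refine mul_left_cancel₀ (two_ne_zero (α := ℤ)) ?_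
          linear_combination (K : ℤ) * hq + ((d : ℤ) - 1) * hgK - e)
    have hsplit : ∀ (u v : latticePoints (interpolantPoints d)) (k n : ℕ),
        ((Finsupp.single u k + Finsupp.single v n).prod fun i n => p.rep i ^ n) =
          p.rep u ^ k * p.rep v ^ n := by
      intro u v k n
      rw [Finsupp.prod_add_index' (by simp) (by simp [pow_add]),
        Finsupp.prod_single_index (h := fun i n => p.rep i ^ n) (by simp),
        Finsupp.prod_single_index (h := fun i n => p.rep i ^ n) (by simp)]
    rw [hsplit, hsplit, h, zero_pow (by omega), zero_mul] at h3
    exact mul_ne_zero (pow_ne_zero _ h0) (pow_ne_zero _ h1) h3.symm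
  · have h := (mem_latticePoints_iff.1 u.2).2
    simp only [U, cornerOfDet, functional_apply, saturation, w₁, latticePoint_apply_zero,
      latticePoint_apply_one, hw₀, Pi.zero_apply, Pi.sub_apply]
    have h4 : 0 ≤ g * ((d - 1) * u.1 0 - 2 * u.1 1) := mul_nonneg (by omega) (by linarith)
    have h5 : 2 * q * u.1 0 = (d - 1) * g * u.1 0 := by rw [hq]
    linarith

/-- The lattice points that obstruct nonsingularity at the origin. -/
theorem exists_irreducible (hd : 4 ≤ d) : ∃ (k : Fin 3 → latticePoints (interpolantPoints d))
    (l : Fin 3 → (Fin 2 → ℤ) →+ ℤ) (r : Fin 3 → ℤ), Function.Injective k ∧ ∀ j,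
      k j ≠ toLatticePoint _ 0 ∧ 0 < r j ∧
      (∀ u : latticePoints (interpolantPoints d), u ≠ toLatticePoint _ 0 → r j ≤ l j u.1) ∧
      l j (k j).1 < 2 * r j := by
  have hpos : ∀ u : latticePoints (interpolantPoints d), u ≠ toLatticePoint _ 0 → 1 ≤ u.1 0 := by
    intro u hu
    obtain ⟨h1, h2⟩ := mem_latticePoints_iff.1 u.2
    have h3 := (abscissa_mem_Icc h1 h2).1
    by_contra hc
    have h4 : u.1 0 = 0 := by omega
    refine hu ((eq_toLatticePoint_iff u 0).2 ⟨by simpa using h4, ?_⟩)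
    rw [h4] at h1 h2
    simp only [Fin.val_zero]
    push_cast
    linarith
  have hne : ∀ u : latticePoints (interpolantPoints d), 1 ≤ u.1 0 → u ≠ toLatticePoint _ 0 := by
    intro u hu he
    rw [eq_toLatticePoint_iff] at he
    rw [he.1, Fin.val_zero] at hu
    omega
  have hd4 : (4 : ℤ) ≤ d := by exact_mod_cast hd
  rcases Nat.eq_or_lt_of_le hd with rfl | hd5
  -- For d = 4 column 1 has only two lattice points; the third irreducible is (2, 3), primitive on
  -- the long edge. The functional 4x - 2y is positive and even on the other lattice points, hence
  -- at least 2, and it equals 2 there.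
  · refine ⟨![latticePoint 1 0 (by norm_num) (by norm_num), latticePoint 1 1 (by norm_num)
      (by norm_num), latticePoint 2 3 (by norm_num) (by norm_num)],
      ![functional 1 0, functional 1 0, functional 4 (-2)], ![1, 1, 2], ?_, ?_⟩
    · intro i j hij
      have h0 := congrFun (congrArg Subtype.val hij) 0
      have h1 := congrFun (congrArg Subtype.val hij) 1
      fin_cases i <;> fin_cases j <;> simp [latticePoint] at h0 h1 ⊢
    · intro j
      fin_cases j
      · refine ⟨hne _ (le_refl (1 : ℤ)), by simp, fun u hu => ?_, ?_⟩
        · simpa [functional_apply] using hpos u hu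
        · simp [functional_apply, latticePoint]
      · refine ⟨hne _ (le_refl (1 : ℤ)), by simp, fun u hu => ?_, ?_⟩
        · simpa [functional_apply] using hpos u hu
        · simp [functional_apply, latticePoint]
      · refine ⟨hne _ (one_le_two : (1 : ℤ) ≤ 2), by simp, fun u hu => ?_, ?_⟩
        · have h1 := hpos u hu
          have h2 := (mem_latticePoints_iff.1 u.2).2
          change (2 : ℤ) ≤ functional 4 (-2) u.1
          simp only [functional_apply]
          push_cast at h2
          omega
        · change functional 4 (-2) ![2, 3] < 2 * 2
          simp [functional_apply]
  · have hd5' : (5 : ℤ) ≤ d := by exact_mod_cast hd5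
    -- For d ≥ 5 column 1 already has three lattice points, irreducible because every nonzero
    -- lattice point has abscissa at least 1.
    refine ⟨![latticePoint 1 0 (by norm_num) (by linarith), latticePoint 1 1 (by norm_num)
      (by linarith), latticePoint 1 2 (by norm_num) (by linarith)],
      fun _ => functional 1 0, fun _ => 1, ?_, ?_⟩
    · intro i j hij
      have h1 := congrFun (congrArg Subtype.val hij) 1
      fin_cases i <;> fin_cases j <;> simp [latticePoint] at h1 ⊢
    · intro j
      refine ⟨?_, by simp, fun u hu => ?_, ?_⟩
      · fin_cases j <;> exact hne _ (le_refl (1 : ℤ))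
      · simpa [functional_apply] using hpos u hu
      · fin_cases j <;> simp [functional_apply, latticePoint]

theorem singular_of_irreducible (hd : 3 ≤ d) {i : latticePoints (interpolantPoints d)}
    (hmem : coordPoint i ∈ satInterpolant d) {k : Fin 3 → latticePoints (interpolantPoints d)}
    {l : Fin 3 → (Fin 2 → ℤ) →+ ℤ} {r : Fin 3 → ℤ} (hk : Function.Injective k)
    (h : ∀ j, k j ≠ i ∧ 0 < r j ∧
      (∀ u : latticePoints (interpolantPoints d), u ≠ i → r j ≤ l j (u.1 - i.1)) ∧
      l j ((k j).1 - i.1) < 2 * r j) :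
    ¬ IsNonsingularAt (satInterpolant d) (coordPoint i) := by
  classical
  rw [isNonsingularAt_satInterpolant_iff hd]
  obtain ⟨c, hc, hci, -⟩ := exists_rep_coordPoint i
  have h4 := four_le_finrank_coneTangentSpace (X := satInterpolant d) (p := coordPoint i)
    (i := i) k hk (fun j => (h j).1) (by rw [hci]; exact hc) (rep_mem_coneTangentSpace hmem)
    fun j => single_mem_coneTangentSpace (saturation_injective _) (h j).2.1 (h j).2.2.1
      (h j).2.2.2 (h j).1
  omega

theorem fixedPoint_zero_mem : fixedPoint d 0 ∈ satInterpolant d := by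
  refine coordPoint_mem_toricVariety (l := functional 1 0) fun u hu => ?_
  obtain ⟨h1, h2⟩ := mem_latticePoints_iff.1 u.2
  have h3 := (abscissa_mem_Icc h1 h2).1
  simp only [functional_apply, saturation, toLatticePoint_apply_zero, Fin.val_zero]
  by_contra hc
  push_cast at hc
  have h4 : u.1 0 = 0 := by omega
  refine hu ((eq_toLatticePoint_iff u 0).2 ⟨by simpa using h4, ?_⟩)
  rw [h4] at h1 h2
  simp only [Fin.val_zero]
  push_cast
  linarith

theorem fixedPoint_last_mem : fixedPoint d (Fin.last d) ∈ satInterpolant d := by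
  refine coordPoint_mem_toricVariety (l := functional (-1) 0) fun u hu => ?_
  obtain ⟨h1, h2⟩ := mem_latticePoints_iff.1 u.2
  have h3 := (abscissa_mem_Icc h1 h2).2
  simp only [functional_apply, saturation, toLatticePoint_apply_zero, Fin.val_last]
  by_contra hc
  have h4 : u.1 0 = d := by linarith
  refine hu ((eq_toLatticePoint_iff u _).2 ⟨by simpa using h4, ?_⟩)
  rw [h4] at h1 h2
  simp only [Fin.val_last]
  linarith

theorem fixedPoint_zero_ne_last (hd : 1 ≤ d) : fixedPoint d 0 ≠ fixedPoint d (Fin.last d) := by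
  intro h
  have := congrArg Fin.val (toLatticePoint_injective d (coordPoint_injective h))
  simp at this
  omega

theorem not_isNonsingularAt_zero (hd : 4 ≤ d) :
    ¬ IsNonsingularAt (satInterpolant d) (fixedPoint d 0) := by
  obtain ⟨k, l, r, hk, h⟩ := exists_irreducible hd
  refine singular_of_irreducible (by omega) fixedPoint_zero_mem (l := l) (r := r) hk fun j => ?_
  have hz : (toLatticePoint (interpolantPoints d) 0).1 = 0 := interpolantPoints_at_zero d
  simpa only [hz, sub_zero] using h j

/-- The affine involution of the polygon transports the irreducible points and their functionals
from the origin to the other end. -/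
theorem not_isNonsingularAt_last (hd : 4 ≤ d) :
    ¬ IsNonsingularAt (satInterpolant d) (fixedPoint d (Fin.last d)) := by
  obtain ⟨k, l, r, hk, h⟩ := exists_irreducible hd
  have hz : (toLatticePoint (interpolantPoints d) 0).1 = 0 := interpolantPoints_at_zero d
  have hl : (toLatticePoint (interpolantPoints d) (Fin.last d)).1 =
    interpolantPoints d (Fin.last d) := rfl
  refine singular_of_irreducible (by omega) fixedPoint_last_mem
    (k := fun j => ⟨_, reflection_add_mem (k j).2⟩)
    (l := fun j => (l j).comp (reflection d)) (r := r) (fun i j hij => ?_) fun j =>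
      ⟨fun hj => (h j).1 ?_, (h j).2.1, fun u hu => ?_, ?_⟩
  · refine hk (Subtype.ext ?_)
    have h1 := add_right_cancel (congrArg Subtype.val hij)
    rw [← reflection_reflection (d := d) (k i).1, h1, reflection_reflection]
  · have h1 : reflection d (k j).1 = 0 := by simpa [hl] using congrArg Subtype.val hj
    refine Subtype.ext ?_
    rw [hz, ← reflection_reflection (d := d) (k j).1, h1, map_zero]
  · have h1 := (h j).2.2.1 ⟨_, reflection_sub_mem u.2⟩ fun h0 => hu (Subtype.ext ?_)
    · exact h1
    · have h2 := congrArg Subtype.val h0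
      rw [hz] at h2
      have h3 := congrArg (reflection d) h2
      rw [reflection_reflection, map_zero] at h3
      exact sub_eq_zero.1 h3
  · rw [hl]
    simpa only [add_sub_cancel_right, AddMonoidHom.comp_apply, reflection_reflection]
      using (h j).2.2.2

/-- A nonzero coordinate at an inner vertex, or nonzero coordinates at both ends, force
nonsingularity. In the remaining case all vertex coordinates except one end vanish, and the point is
a fixed point. -/
theorem singularLocus_satInterpolant (hd : 4 ≤ d) :
    singularLocus (satInterpolant d) = {fixedPoint d 0, fixedPoint d (Fin.last d)} := by
  ext p
  constructor
  · rintro ⟨hp, hsing⟩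
    have hinner : ∀ j : Fin (d + 1), j ≠ 0 → j ≠ Fin.last d →
        p.rep (toLatticePoint _ j) = 0 := by
      intro j h0 hl
      by_contra hj
      have h1 : 0 < j.1 := Nat.pos_of_ne_zero fun h => h0 (Fin.ext h)
      have h2 : j.1 ≠ d := fun h => hl (Fin.ext h)
      exact hsing (isNonsingularAt_of_inner (by omega) h1 (by omega) hp hj)
    by_cases h0 : p.rep (toLatticePoint _ 0) = 0
    · refine Or.inr (eq_fixedPoint_of_rep_eq_zero hp fun i hi => ?_)
      by_cases hi0 : i = 0
      · rwa [hi0]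
      · exact hinner i hi0 hi
    · by_cases hl : p.rep (toLatticePoint _ (Fin.last d)) = 0
      · refine Or.inl (eq_fixedPoint_of_rep_eq_zero hp fun i hi => ?_)
        by_cases hil : i = Fin.last d
        · rwa [hil]
        · exact hinner i hi hil
      · exact absurd (isNonsingularAt_of_edge (by omega) hp h0 hl) hsing
  · rintro (rfl | rfl)
    · exact ⟨fixedPoint_zero_mem, not_isNonsingularAt_zero hd⟩
    · exact ⟨fixedPoint_last_mem, not_isNonsingularAt_last hd⟩

/-- The long edge now has direction (1, 1), so both end corners are unimodular and corner charts
cover the surface. -/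
theorem isNonsingularAt_satInterpolant_three {p : ℙ ℂ (latticePoints (interpolantPoints 3) → ℂ)}
    (hp : p ∈ satInterpolant 3) : IsNonsingularAt (satInterpolant 3) p := by
  obtain ⟨j, hj⟩ := (isNormalizationByProjection_satInterpolant le_rfl).1 p hp
  have e0 : (toLatticePoint (interpolantPoints 3) 0).1 = 0 := interpolantPoints_at_zero 3
  have e2 := two_mul_toLatticePoint_apply_one (d := 3) 3
  have e3 : (toLatticePoint (interpolantPoints 3) 3).1 0 = 3 := rfl
  have e4 : (toLatticePoint (interpolantPoints 3) 3).1 1 = 3 := by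
    have : (((3 : Fin (3 + 1)) : ℕ) : ℤ) = 3 := rfl
    rw [this] at e2
    linarith
  have hc : j = 0 ∨ j = 3 ∨ 0 < j.1 ∧ j.1 < 3 := by
    fin_cases j <;> simp
  rcases hc with rfl | rfl | ⟨h1, h2⟩
  · rw [isNonsingularAt_satInterpolant_iff le_rfl]
    let U : UnimodularCorner (saturation (interpolantPoints 3)) (toLatticePoint _ 0)
        (latticePoint 1 0 (by norm_num) (by norm_num))
        (latticePoint 1 1 (by norm_num) (by norm_num)) :=
      cornerOfDet 1 (by norm_num) (by
        simp only [saturation, latticePoint_apply_zero, latticePoint_apply_one, e0, Pi.zero_apply]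
        norm_num)
    refine U.finrank_coneTangentSpace hp hj (Or.inr fun u => ?_) (Or.inr fun u => ?_)
    · have h := (mem_latticePoints_iff.1 u.2).2
      simp only [U, cornerOfDet, functional_apply, saturation, latticePoint_apply_zero,
        latticePoint_apply_one, e0, Pi.zero_apply, Pi.sub_apply]
      push_cast at h
      linarith
    · have h := le_of_mem_latticePoints u.2 0
      simp only [U, cornerOfDet, functional_apply, saturation, latticePoint_apply_zero,
        latticePoint_apply_one, e0, Pi.zero_apply, Pi.sub_apply]
      linarith
  · rw [isNonsingularAt_satInterpolant_iff le_rfl]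
    let U : UnimodularCorner (saturation (interpolantPoints 3)) (toLatticePoint _ 3)
        (latticePoint 2 1 (by norm_num) (by norm_num))
        (latticePoint 2 2 (by norm_num) (by norm_num)) :=
      cornerOfDet (-1) (by norm_num) (by
        simp only [saturation, latticePoint_apply_zero, latticePoint_apply_one, e3, e4]
        norm_num)
    refine U.finrank_coneTangentSpace hp hj (Or.inr fun u => ?_) (Or.inr fun u => ?_)
    · have h := (mem_latticePoints_iff.1 u.2).2
      simp only [U, cornerOfDet, functional_apply, saturation, latticePoint_apply_zero,
        latticePoint_apply_one, e3, e4, Pi.sub_apply]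
      push_cast at h
      linarith
    · have h := le_of_mem_latticePoints u.2 2
      simp only [U, cornerOfDet, functional_apply, saturation, latticePoint_apply_zero,
        latticePoint_apply_one, e3, e4, Pi.sub_apply]
      linarith
  · exact isNonsingularAt_of_inner le_rfl h1 h2 hp hj

end Polygon

/-! ### The Hilbert function of a toric variety -/

/-- The Hilbert function of a toric variety counts the sums of points of the configuration. -/
theorem hilbertFunction_toricVariety [Finite ι] [Nonempty ι] (a : ι → Fin m → ℤ) (n : ℕ)
    (s : Finset (Fin m → ℤ))
    (hs : ∀ w, w ∈ s ↔ ∃ e : ι →₀ ℕ, e.degree = n ∧ Finsupp.weight a e = w) :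
    hilbertFunction (toricVariety a) n = s.card := by
  classical
  have h1 : hilbertFunction (toricVariety a) n = Module.finrank ℂ
      ((MvPolynomial.homogeneousSubmodule ι ℂ n).map
        (monomialHom (homogenized a)).toLinearMap) := by
    have h2 : (monomialHom (homogenized a)).toLinearMap =
        (coordEmbedding a).toLinearMap ∘ₗ
          (Ideal.Quotient.mkₐ ℂ (vanishingIdeal (toricVariety a))).toLinearMap := rfl
    rw [h2, Submodule.map_comp, hilbertFunction]
    exact (Submodule.equivMapOfInjective _ (coordEmbedding_injective a) _).finrank_eq
  let v : (Fin m → ℤ) → AddMonoidAlgebra ℂ (ℤ × (Fin m → ℤ)) := fun w =>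
    AddMonoidAlgebra.single ((n : ℤ), w) 1
  have h3 : (MvPolynomial.homogeneousSubmodule ι ℂ n).map
      (monomialHom (homogenized a)).toLinearMap = Submodule.span ℂ (Set.range fun w : s => v w) := by
    refine le_antisymm ?_ ?_
    · rintro _ ⟨f, hf, rfl⟩
      rw [AlgHom.toLinearMap_apply, f.as_sum, map_sum]
      refine Submodule.sum_mem _ fun e he => ?_
      have hdeg : e.degree = n := by
        have h1 := (MvPolynomial.mem_homogeneousSubmodule n f).1 hf
          (MvPolynomial.mem_support_iff.1 he)
        rw [← h1, Finsupp.degree_eq_weight_one]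
        rfl
      have h4 : monomialHom (homogenized a) (MvPolynomial.monomial e (f.coeff e)) =
          f.coeff e • v (Finsupp.weight a e) := by
        rw [monomialHom_monomial, weight_homogenized, hdeg]
        simp [v]
      rw [h4]
      exact Submodule.smul_mem _ _ (Submodule.subset_span
        ⟨⟨Finsupp.weight a e, (hs _).2 ⟨e, hdeg, rfl⟩⟩, rfl⟩)
    · rw [Submodule.span_le]
      rintro _ ⟨⟨w, hw⟩, rfl⟩
      obtain ⟨e, he, rfl⟩ := (hs w).1 hw
      refine ⟨MvPolynomial.monomial e 1, MvPolynomial.isHomogeneous_monomial _ he, ?_⟩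
      rw [AlgHom.toLinearMap_apply, monomialHom_monomial, weight_homogenized, he]
  have hv : LinearIndependent ℂ fun w : s => v w := by
    rw [Fintype.linearIndependent_iff]
    intro c hc w
    have h4 := congrArg (fun x : AddMonoidAlgebra ℂ (ℤ × (Fin m → ℤ)) =>
      x.coeff ((n : ℤ), w.1)) hc
    simp only [v, AddMonoidAlgebra.coeff_sum, Finsupp.finsetSum_apply] at h4
    rw [Finset.sum_eq_single w] at h4
    · simpa using h4
    · intro w' _ hw'
      have : ((n : ℤ), w'.1) ≠ ((n : ℤ), w.1) := fun h =>
        hw' (Subtype.ext (congrArg Prod.snd h))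
      simp [this]
    · simp
  rw [h1, h3, finrank_span_eq_card hv, Fintype.card_coe]

/-! ### Lattice points of the dilated polygon and the degree for d = 3 -/

theorem le_functional_weight {a : ι → Fin m → ℤ} {l : (Fin m → ℤ) →+ ℤ} {r : ℤ}
    (hl : ∀ u, r ≤ l (a u)) (e : ι →₀ ℕ) : e.degree * r ≤ l (Finsupp.weight a e) := by
  rw [Finsupp.weight_apply, map_finsuppSum, Finsupp.degree_apply]
  push_cast
  rw [Finset.sum_mul, Finsupp.sum]
  refine Finset.sum_le_sum fun u _ => ?_
  rw [map_nsmul, nsmul_eq_mul]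
  exact mul_le_mul_of_nonneg_left (hl u) (by positivity)

/-- Integer decomposition: a lattice point of the dilate by n + 1 enters the dilate by n after
subtracting a lattice point of the polygon. That point is chosen by the excess in the inequalities x
- y ≤ n and 2x - y ≤ 3n. -/
theorem exists_weight_three (n : ℕ) (w : Fin 2 → ℤ) (h0 : w 1 ≤ w 0) (h1 : w 0 - w 1 ≤ n)
    (h2 : 0 ≤ w 1) (h3 : 2 * w 0 - w 1 ≤ 3 * n) :
    ∃ e : latticePoints (interpolantPoints 3) →₀ ℕ, e.degree = n ∧
      Finsupp.weight (saturation (interpolantPoints 3)) e = w := by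
  induction n generalizing w with
  | zero =>
    refine ⟨0, by simp, ?_⟩
    rw [map_zero]
    push_cast at h1 h3
    funext i
    fin_cases i
    · change 0 = w 0
      omega
    · change 0 = w 1
      omega
  | succ n ih =>
    push_cast at h1 h3
    have step : ∀ u : latticePoints (interpolantPoints 3), w 1 - u.1 1 ≤ w 0 - u.1 0 →
        (w 0 - u.1 0) - (w 1 - u.1 1) ≤ n → 0 ≤ w 1 - u.1 1 →
        2 * (w 0 - u.1 0) - (w 1 - u.1 1) ≤ 3 * n →
        ∃ e : latticePoints (interpolantPoints 3) →₀ ℕ, e.degree = n + 1 ∧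
          Finsupp.weight (saturation (interpolantPoints 3)) e = w := by
      intro u g0 g1 g2 g3
      obtain ⟨e, he, hw⟩ := ih (w - u.1) g0 g1 g2 g3
      refine ⟨e + Finsupp.single u 1, by rw [map_add, he, Finsupp.degree_single], ?_⟩
      rw [map_add, hw, Finsupp.weight_single, one_smul]
      exact sub_add_cancel _ _
    by_cases hz : w 0 - w 1 ≤ n
    · by_cases hx : 2 * w 0 - w 1 ≤ 3 * n
      · exact step (latticePoint 0 0 (by norm_num) (by norm_num)) (by simpa [latticePoint] using h0)
          (by simpa [latticePoint] using hz) (by simpa [latticePoint] using h2)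
          (by simpa [latticePoint] using hx)
      · have hx' : 2 * w 0 - w 1 - 3 * n = 1 ∨ 2 * w 0 - w 1 - 3 * n = 2 ∨
            2 * w 0 - w 1 - 3 * n = 3 := by omega
        rcases hx' with hx' | hx' | hx'
        · refine step (latticePoint 1 1 (by norm_num) (by norm_num)) ?_ ?_ ?_ ?_ <;>
            simp only [latticePoint_apply_zero, latticePoint_apply_one] <;> omega
        · refine step (latticePoint 2 2 (by norm_num) (by norm_num)) ?_ ?_ ?_ ?_ <;>
            simp only [latticePoint_apply_zero, latticePoint_apply_one] <;> omega
        · refine step (latticePoint 3 3 (by norm_num) (by norm_num)) ?_ ?_ ?_ ?_ <;>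
            simp only [latticePoint_apply_zero, latticePoint_apply_one] <;> omega
    · by_cases hx : w 0 ≤ 2 * n + 1
      · refine step (latticePoint 1 0 (by norm_num) (by norm_num)) ?_ ?_ ?_ ?_ <;>
          simp only [latticePoint_apply_zero, latticePoint_apply_one] <;> omega
      · refine step (latticePoint 2 1 (by norm_num) (by norm_num)) ?_ ?_ ?_ ?_ <;>
          simp only [latticePoint_apply_zero, latticePoint_apply_one] <;> omega

theorem exists_weight_three_iff (n : ℕ) (w : Fin 2 → ℤ) :
    (∃ e : latticePoints (interpolantPoints 3) →₀ ℕ, e.degree = n ∧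
      Finsupp.weight (saturation (interpolantPoints 3)) e = w) ↔
      w 1 ≤ w 0 ∧ w 0 - w 1 ≤ n ∧ 0 ≤ w 1 ∧ 2 * w 0 - w 1 ≤ 3 * n := by
  refine ⟨?_, fun h => exists_weight_three n w h.1 h.2.1 h.2.2.1 h.2.2.2⟩
  rintro ⟨e, rfl, rfl⟩
  have g0 := le_functional_weight (a := saturation (interpolantPoints 3))
    (l := functional 1 (-1)) (r := 0) (fun u => by
      have := (mem_latticePoints_iff.1 u.2).2
      simp only [functional_apply, saturation]
      push_cast at this
      linarith) e
  have g1 := le_functional_weight (a := saturation (interpolantPoints 3))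
    (l := functional (-1) 1) (r := -1) (fun u => by
      have := le_of_mem_latticePoints u.2 1
      simp only [functional_apply, saturation]
      linarith) e
  have g2 := le_functional_weight (a := saturation (interpolantPoints 3))
    (l := functional 0 1) (r := 0) (fun u => by
      have := le_of_mem_latticePoints u.2 0
      simp only [functional_apply, saturation]
      linarith) e
  have g3 := le_functional_weight (a := saturation (interpolantPoints 3))
    (l := functional (-2) 1) (r := -3) (fun u => by
      have := le_of_mem_latticePoints u.2 2
      simp only [functional_apply, saturation]
      linarith) e
  simp only [functional_apply] at g0 g1 g2 g3
  refine ⟨?_, ?_, ?_, ?_⟩ <;> linarith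

theorem card_latticePoints_three : Nat.card (latticePoints (interpolantPoints 3)) = 5 + 1 := by
  have h : latticePoints (interpolantPoints 3) =
      (({![0, 0], ![1, 0], ![1, 1], ![2, 1], ![2, 2], ![3, 3]} : Finset (Fin 2 → ℤ)) :
        Set (Fin 2 → ℤ)) := by
    ext u
    have hu : ∀ x y : ℤ, u = ![x, y] ↔ u 0 = x ∧ u 1 = y := fun x y => by
      constructor
      · rintro rfl
        exact ⟨rfl, rfl⟩
      · rintro ⟨rfl, rfl⟩
        funext i
        fin_cases i <;> rfl
    rw [mem_latticePoints_iff]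
    simp only [Finset.coe_insert, Finset.coe_singleton, Set.mem_insert_iff, Set.mem_singleton_iff,
      hu]
    push_cast
    constructor
    · rintro ⟨h1, h2⟩
      obtain ⟨h3, h4⟩ := abscissa_mem_Icc (d := 3) h1 (by push_cast; exact h2)
      generalize u 0 = x at *
      generalize u 1 = y at *
      push_cast at h4
      interval_cases x <;> omega
    · rintro (⟨h1, h2⟩ | ⟨h1, h2⟩ | ⟨h1, h2⟩ | ⟨h1, h2⟩ | ⟨h1, h2⟩ | ⟨h1, h2⟩) <;> rw [h1, h2] <;>
        norm_num
  rw [Nat.card_coe_set_eq, h, Set.ncard_coe_finset]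
  decide

/-- In the coordinates z = x - y and y the dilate is the trapezoid 0 ≤ z ≤ n, 0 ≤ y ≤ 3n - 2z,
counted by columns. -/
theorem hilbertFunction_satInterpolant_three (n : ℕ) :
    hilbertFunction (satInterpolant 3) n = 2 * n ^ 2 + 3 * n + 1 := by
  classical
  let φ : (Σ _ : ℕ, ℕ) → Fin 2 → ℤ := fun p => ![(p.1 : ℤ) + p.2, (p.2 : ℤ)]
  have hφ : Function.Injective φ := by
    rintro ⟨z, y⟩ ⟨z', y'⟩ h
    have h0 := congrFun h 0
    have h1 := congrFun h 1
    simp only [φ, Matrix.cons_val_zero, Matrix.cons_val_one] at h0 h1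
    obtain rfl : y = y' := by omega
    obtain rfl : z = z' := by omega
    rfl
  rw [hilbertFunction_toricVariety (saturation (interpolantPoints 3)) n
    (((Finset.range (n + 1)).sigma fun z => Finset.range (3 * n - 2 * z + 1)).image φ)
    fun w => ?_]
  · rw [Finset.card_image_of_injective _ hφ, Finset.card_sigma]
    simp only [Finset.card_range]
    -- The bound on k keeps the truncated subtraction exact; the square stands on the left to avoid
    -- another subtraction.
    have h : ∀ k, k ≤ n + 1 → (∑ z ∈ Finset.range k, (3 * n - 2 * z + 1)) + k * k =
        k * (3 * n + 2) := by
      intro k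
      induction k with
      | zero => simp
      | succ k ih =>
        intro hk
        have h1 := ih (by omega)
        rw [Finset.sum_range_succ]
        have h2 : 2 * k ≤ 3 * n := by omega
        obtain ⟨t, ht⟩ := Nat.exists_eq_add_of_le h2
        have h3 : 3 * n - 2 * k = t := by omega
        rw [h3]
        nlinarith
    have h1 := h (n + 1) le_rfl
    nlinarith
  · rw [exists_weight_three_iff, Finset.mem_image]
    constructor
    · rintro ⟨⟨z, y⟩, hzy, rfl⟩
      simp only [Finset.mem_sigma, Finset.mem_range] at hzy
      simp only [φ, Matrix.cons_val_zero, Matrix.cons_val_one]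
      omega
    · rintro ⟨h0, h1, h2, h3⟩
      refine ⟨⟨(w 0 - w 1).toNat, (w 1).toNat⟩, ?_, ?_⟩
      · simp only [Finset.mem_sigma, Finset.mem_range]
        omega
      · funext i
        fin_cases i
        · simp only [φ, Fin.zero_eta, Matrix.cons_val_zero]
          omega
        · simp only [φ, Fin.mk_one, Matrix.cons_val_one, Matrix.cons_val_zero]
          omega

theorem hasDegree_satInterpolant_three : HasDegree (satInterpolant 3) 4 := by
  refine ⟨Polynomial.C 2 * Polynomial.X ^ 2 + Polynomial.C 3 * Polynomial.X + Polynomial.C 1,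
    Filter.Eventually.of_forall fun n => ?_, ?_⟩
  · rw [hilbertFunction_satInterpolant_three]
    simp
  · rw [Polynomial.leadingCoeff_quadratic two_ne_zero, Polynomial.natDegree_quadratic two_ne_zero]
    norm_num [Nat.factorial]

/-! ### Edges at a vertex of a lattice polygon -/

theorem isUnit_of_eq_smul {f : Fin 2 → ℤ} (hf : IsCoprime (f 0) (f 1)) (k : ℤ) (w : Fin 2 → ℤ)
    (h : f = k • w) : IsUnit k :=
  hf.isUnit_of_dvd' ⟨w 0, congrFun h 0⟩ ⟨w 1, congrFun h 1⟩

/-- Two primitive vectors on the same ray are equal. -/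
theorem eq_of_primitive {u f : Fin 2 → ℤ} (hu : ∀ (k : ℤ) (w : Fin 2 → ℤ), u = k • w → IsUnit k)
    (hf : IsCoprime (f 0) (f 1)) {n : ℕ} (hn : 0 < n) {r : ℝ} (hr : 0 ≤ r)
    (h : toReal (n • u) = r • toReal f) : u = f := by
  have h0 : (n : ℝ) * u 0 = r * f 0 := by
    have := congrFun h 0
    simpa [toReal] using this
  have h1 : (n : ℝ) * u 1 = r * f 1 := by
    have := congrFun h 1
    simpa [toReal] using this
  have hn' : (0 : ℝ) < n := by exact_mod_cast hn
  have hdet : u 0 * f 1 = u 1 * f 0 := by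
    have : (n : ℝ) * (u 0 * f 1 - u 1 * f 0) = 0 := by linear_combination (f 1 : ℝ) * h0 - f 0 * h1
    have h2 := (mul_eq_zero.1 this).resolve_left hn'.ne'
    have h3 : (u 0 * f 1 : ℝ) = u 1 * f 0 := sub_eq_zero.1 h2
    exact_mod_cast h3
  obtain ⟨x, y, hxy⟩ := hf
  have huf : u = (x * u 0 + y * u 1) • f := by
    funext i
    fin_cases i
    · change u 0 = (x * u 0 + y * u 1) * f 0
      linear_combination (-u 0) * hxy + y * hdet
    · change u 1 = (x * u 0 + y * u 1) * f 1
      linear_combination (-u 1) * hxy - x * hdet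
  generalize x * u 0 + y * u 1 = k at huf
  rcases Int.isUnit_iff.1 (hu k f huf) with rfl | rfl
  · rw [huf, one_smul]
  · exfalso
    have e0 : u 0 = -f 0 := by rw [huf]; simp
    have e1 : u 1 = -f 1 := by rw [huf]; simp
    rw [e0] at h0
    rw [e1] at h1
    push_cast at h0 h1
    have hpos : (n : ℝ) + r ≠ 0 := by positivity
    have f0 : (f 0 : ℝ) = 0 := by
      have : ((n : ℝ) + r) * f 0 = 0 := by linarith
      exact (mul_eq_zero.1 this).resolve_left hpos
    have f1 : (f 1 : ℝ) = 0 := by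
      have : ((n : ℝ) + r) * f 1 = 0 := by linarith
      exact (mul_eq_zero.1 this).resolve_left hpos
    have f0' : f 0 = 0 := by exact_mod_cast f0
    have f1' : f 1 = 0 := by exact_mod_cast f1
    rw [f0', f1'] at hxy
    simp at hxy

theorem toReal_add (u v : Fin m → ℤ) : toReal (u + v) = toReal u + toReal v := by
  funext i
  simp [toReal]

theorem toReal_nsmul (n : ℕ) (u : Fin m → ℤ) : toReal (n • u) = (n : ℝ) • toReal u := by
  funext i
  simp [toReal]

/-- The primitive edge vectors at a vertex of a lattice polygon that spans the cone of two of its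
edges at this vertex. -/
theorem edgeVectors_eq {a : ι → Fin 2 → ℤ} {v f₁ f₂ : Fin 2 → ℤ} {n₁ n₂ : ℕ}
    (hn₁ : 0 < n₁) (hn₂ : 0 < n₂) (hf₁ : IsCoprime (f₁ 0) (f₁ 1)) (hf₂ : IsCoprime (f₂ 0) (f₂ 1))
    (he₁ : IsExtreme ℝ (polytope a) (segment ℝ (toReal v) (toReal (v + n₁ • f₁))))
    (he₂ : IsExtreme ℝ (polytope a) (segment ℝ (toReal v) (toReal (v + n₂ • f₂))))
    (hdet : f₁ 0 * f₂ 1 - f₁ 1 * f₂ 0 ≠ 0)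
    (hcone : ∀ z ∈ polytope a, ∃ α β : ℝ, 0 ≤ α ∧ 0 ≤ β ∧
      z = toReal v + (α • toReal f₁ + β • toReal f₂)) :
    edgeVectors a v = {f₁, f₂} := by
  have hdet' : (f₁ 0 * f₂ 1 - f₁ 1 * f₂ 0 : ℝ) ≠ 0 := by exact_mod_cast hdet
  have hli : ∀ x y : ℝ, x • toReal f₁ + y • toReal f₂ = 0 → x = 0 ∧ y = 0 := by
    intro x y h
    have h0 : x * f₁ 0 + y * f₂ 0 = 0 := by simpa [toReal] using congrFun h 0
    have h1 : x * f₁ 1 + y * f₂ 1 = 0 := by simpa [toReal] using congrFun h 1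
    constructor
    · refine (mul_eq_zero.1 (?_ : x * (f₁ 0 * f₂ 1 - f₁ 1 * f₂ 0 : ℝ) = 0)).resolve_right hdet'
      linear_combination (f₂ 1 : ℝ) * h0 - f₂ 0 * h1
    · refine (mul_eq_zero.1 (?_ : y * (f₁ 0 * f₂ 1 - f₁ 1 * f₂ 0 : ℝ) = 0)).resolve_right hdet'
      linear_combination (f₁ 0 : ℝ) * h1 - f₁ 1 * h0
  have hedge : ∀ (f : Fin 2 → ℤ) (n : ℕ), 0 < n →
      IsExtreme ℝ (polytope a) (segment ℝ (toReal v) (toReal (v + n • f))) →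
      ∀ c : ℝ, 0 ≤ c → c ≤ 1 → toReal v + c • toReal f ∈ polytope a := by
    intro f n hn he c hc0 hc1
    refine he.subset ?_
    rw [segment_eq_image']
    have hn' : (1 : ℝ) ≤ n := by exact_mod_cast hn
    refine ⟨c / n, ⟨by positivity, ?_⟩, ?_⟩
    · rw [div_le_one (by linarith)]
      linarith
    · beta_reduce
      rw [toReal_add, toReal_nsmul, add_sub_cancel_left, smul_smul, div_mul_cancel₀]
      linarith
  ext u
  constructor
  · rintro ⟨hu, n, hn, he⟩
    obtain ⟨α, β, hα, hβ, hz⟩ := hcone _ (he.subset (right_mem_segment ℝ _ _))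
    rw [toReal_add] at hz
    have hnu := add_left_cancel hz
    by_cases hβ0 : β = 0
    · left
      rw [hβ0, zero_smul, add_zero] at hnu
      exact eq_of_primitive hu hf₁ hn hα hnu
    by_cases hα0 : α = 0
    · right
      rw [hα0, zero_smul, zero_add] at hnu
      exact eq_of_primitive hu hf₂ hn hβ hnu
    exfalso
    have hα' : 0 < α := lt_of_le_of_ne hα (Ne.symm hα0)
    have hβ' : 0 < β := lt_of_le_of_ne hβ (Ne.symm hβ0)
    have hs : 0 < α + β := by linarith
    -- An edge strictly inside the cone would cross the segment joining v + c f₁ and v + c f₂. The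
    -- bound c ≤ 1 keeps these ends in the polygon, and c ≤ α + β puts the crossing point on the
    -- supposed edge. Extremality would then place v + c f₁ on it too.
    obtain ⟨c, hc0, hc1, hcs⟩ : ∃ c : ℝ, 0 < c ∧ c ≤ 1 ∧ c ≤ α + β :=
      ⟨min 1 (α + β), lt_min one_pos hs, min_le_left _ _, min_le_right _ _⟩
    have hA := hedge f₁ n₁ hn₁ he₁ c hc0.le hc1
    have hB := hedge f₂ n₂ hn₂ he₂ c hc0.le hc1
    have hQ : toReal v + (c / (α + β)) • toReal (n • u) ∈
        segment ℝ (toReal v) (toReal (v + n • u)) := by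
      rw [segment_eq_image', toReal_add]
      refine ⟨c / (α + β), ⟨by positivity, (div_le_one hs).2 hcs⟩, ?_⟩
      beta_reduce
      rw [add_sub_cancel_left]
    have hQ' : toReal v + (c / (α + β)) • toReal (n • u) ∈
        openSegment ℝ (toReal v + c • toReal f₁) (toReal v + c • toReal f₂) := by
      refine ⟨α / (α + β), β / (α + β), by positivity, by positivity, by field_simp, ?_⟩
      rw [hnu]
      have h1 : β / (α + β) = 1 - α / (α + β) := by field_simp; ring
      have h2 : c / (α + β) * α = α / (α + β) * c := by ring
      have h3 : c / (α + β) * β = β / (α + β) * c := by ring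
      rw [smul_add, smul_add, smul_add, smul_smul, smul_smul, smul_smul, smul_smul, h2, h3, h1]
      module
    have hA' := he.left_mem_of_mem_openSegment hA hB hQ hQ'
    rw [segment_eq_image', toReal_add] at hA'
    obtain ⟨τ, -, hτ⟩ := hA'
    beta_reduce at hτ
    rw [add_sub_cancel_left, hnu] at hτ
    have h4 := add_left_cancel hτ
    have h5 : (τ * α - c) • toReal f₁ + (τ * β) • toReal f₂ = 0 := by
      have := sub_eq_zero.2 h4
      rw [← this]
      module
    obtain ⟨h6, h7⟩ := hli _ _ h5
    rcases mul_eq_zero.1 h7 with h8 | h8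
    · rw [h8] at h6
      linarith
    · exact hβ0 h8
  · rintro (rfl | rfl)
    · exact ⟨isUnit_of_eq_smul hf₁, n₁, hn₁, he₁⟩
    · exact ⟨isUnit_of_eq_smul hf₂, n₂, hn₂, he₂⟩

/-- A face cut out by a supporting line is an edge. -/
theorem isExtreme_segment {P : Set (Fin 2 → ℝ)} (hP : Convex ℝ P) {v w : Fin 2 → ℝ} (x y r : ℝ)
    (hv : v ∈ P) (hw : w ∈ P) (hLv : x * v 0 + y * v 1 = r) (hLw : x * w 0 + y * w 1 = r)
    (hL : ∀ z ∈ P, r ≤ x * z 0 + y * z 1)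
    (hseg : ∀ z ∈ P, x * z 0 + y * z 1 = r → ∃ θ : ℝ, 0 ≤ θ ∧ θ ≤ 1 ∧ z = v + θ • (w - v)) :
    IsExtreme ℝ P (segment ℝ v w) := by
  refine ⟨hP.segment_subset hv hw, ?_⟩
  rintro z₁ h₁ z₂ h₂ z hz ⟨α, β, hα, hβ, hαβ, rfl⟩
  rw [segment_eq_image'] at hz ⊢
  obtain ⟨τ, -, hτ⟩ := hz
  beta_reduce at hτ
  have e0 : v 0 + τ * (w 0 - v 0) = α * z₁ 0 + β * z₂ 0 := by simpa using congrFun hτ 0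
  have e1 : v 1 + τ * (w 1 - v 1) = α * z₁ 1 + β * z₂ 1 := by simpa using congrFun hτ 1
  have g1 := hL z₁ h₁
  have g2 := hL z₂ h₂
  have e2 : α * (x * z₁ 0 + y * z₁ 1) + β * (x * z₂ 0 + y * z₂ 1) = r := by
    linear_combination (-x) * e0 - y * e1 + (1 - τ) * hLv + τ * hLw
  have g3 : x * z₁ 0 + y * z₁ 1 = r := by
    refine le_antisymm ?_ g1
    have h3 : β = 1 - α := by linarith
    have h4 := mul_le_mul_of_nonneg_left g2 hβ.le
    by_contra hc
    have h5 := mul_lt_mul_of_pos_left (not_le.1 hc) hα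
    rw [h3] at e2 h4
    linarith
  obtain ⟨θ, h0, h1, rfl⟩ := hseg z₁ h₁ g3
  exact ⟨θ, ⟨h0, h1⟩, rfl⟩

/-- The index of a plane sublattice in terms of a basis. -/
theorem index_closure_pair {f₁ f₂ : Fin 2 → ℤ} {N : ℕ} {s σ : ℤ} (hf₁ : f₁ 1 = s * f₁ 0)
    (hf₁' : f₁ 0 * f₁ 0 = 1) (hσ : σ * σ = 1) (hf₂ : f₂ 1 - s * f₂ 0 = σ * N) :
    (AddSubgroup.closure {f₁, f₂}).index = N := by
  -- The functional vanishes on f₁ = ±(1, s) and takes the value ±N on f₂, so modulo N its kernel is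
  -- the span of both.
  let δ : (Fin 2 → ℤ) →+ ZMod N := (Int.castAddHom (ZMod N)).comp (functional (-s) 1)
  have hδ : ∀ w, δ w = ((-s * w 0 + 1 * w 1 : ℤ) : ZMod N) := fun w => rfl
  have hker : AddSubgroup.closure {f₁, f₂} = δ.ker := by
    refine le_antisymm ?_ ?_
    · rw [AddSubgroup.closure_le]
      rintro w (rfl | rfl)
      · change δ w = 0
        rw [hδ, show -s * w 0 + 1 * w 1 = 0 by linarith, Int.cast_zero]
      · change δ w = 0
        rw [hδ, show -s * w 0 + 1 * w 1 = σ * N by linarith]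
        simp
    · intro w hw
      have h1 : δ w = 0 := hw
      rw [hδ, ZMod.intCast_zmod_eq_zero_iff_dvd] at h1
      obtain ⟨t, ht⟩ := h1
      have h2 : w = (σ * t) • f₂ + ((w 0 - σ * t * f₂ 0) * f₁ 0) • f₁ := by
        funext i
        fin_cases i
        · change w 0 = σ * t * f₂ 0 + (w 0 - σ * t * f₂ 0) * f₁ 0 * f₁ 0
          linear_combination (-(w 0 - σ * t * f₂ 0)) * hf₁'
        · change w 1 = σ * t * f₂ 1 + (w 0 - σ * t * f₂ 0) * f₁ 0 * f₁ 1
          rw [hf₁]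
          linear_combination ht - σ * t * hf₂ - (N * t) * hσ - s * (w 0 - σ * t * f₂ 0) * hf₁'
      rw [h2]
      exact add_mem (zsmul_mem (AddSubgroup.subset_closure (by simp)) _)
        (zsmul_mem (AddSubgroup.subset_closure (by simp)) _)
  have hsurj : Function.Surjective δ := by
    intro x
    obtain ⟨k, rfl⟩ := ZMod.intCast_surjective x
    exact ⟨![0, k], by rw [hδ]; simp⟩
  rw [hker, AddSubgroup.index_ker, AddMonoidHom.range_eq_top.2 hsurj]
  exact (Nat.card_congr AddSubgroup.topEquiv.toEquiv).trans (Nat.card_zmod N)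

/-! ### Multiplicities at the two ends of the long edge -/

section Polygon

variable {d : ℕ}

theorem toReal_mem_polytope {u : Fin 2 → ℤ} (h : u 0 * (u 0 - 1) ≤ 2 * u 1)
    (h' : 2 * u 1 ≤ (d - 1) * u 0) : toReal u ∈ polytope (interpolantPoints d) :=
  mem_latticePoints_iff.2 ⟨h, h'⟩

/-- The edges at the origin have primitive vectors (1, 0) and (g, q), of determinant q; the long
edge is K times the latter. -/
theorem vertexMultiplicity_zero (hd : 3 ≤ d) {g q K : ℕ} (hgK : g * K = d)
    (hq : 2 * (q : ℤ) = (d - 1) * g) (hcop : IsCoprime (g : ℤ) q) :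
    vertexMultiplicity (interpolantPoints d) (interpolantPoints d 0) = q := by
  have hd3 : (3 : ℝ) ≤ d := by exact_mod_cast hd
  have hK : 0 < K := Nat.pos_of_ne_zero fun h => by subst h; omega
  have hg : 0 < g := Nat.pos_of_ne_zero fun h => by subst h; omega
  have hgr : (0 : ℝ) < g := by exact_mod_cast hg
  have hqr : 2 * (q : ℝ) = (d - 1) * g := by exact_mod_cast hq
  have hgKr : (g : ℝ) * K = d := by exact_mod_cast hgK
  have hgKz : (g : ℤ) * K = d := by exact_mod_cast hgK
  have hqpos : (0 : ℝ) < q := by nlinarith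
  have hqz : (q : ℤ) ≠ 0 := by
    intro h
    have : (q : ℝ) = 0 := by exact_mod_cast h
    linarith
  have hKq : 2 * ((K : ℤ) * q) = (d - 1) * d := by
    linear_combination (K : ℤ) * hq + ((d : ℤ) - 1) * hgKz
  have hKqr : 2 * ((K : ℝ) * q) = (d - 1) * d := by exact_mod_cast hKq
  rw [interpolantPoints_at_zero, vertexMultiplicity,
    edgeVectors_eq (f₁ := ![1, 0]) (f₂ := ![(g : ℤ), q]) (n₁ := 1) (n₂ := K) one_pos hK
      (by simpa using isCoprime_one_left) (by simpa using hcop) ?_ ?_ (by simpa using hqz) ?_]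
  · exact index_closure_pair (s := 0) (σ := 1) (by simp) (by simp) (by simp) (by simp)
  · refine isExtreme_segment (convex_convexHull ℝ _) 0 1 0 (toReal_mem_polytope (by simp) (by simp))
      (toReal_mem_polytope (by simp) (by simp; omega)) (by simp [toReal]) (by simp [toReal])
      (fun z hz => ?_) fun z hz h => ?_
    · have := le_of_mem_polytope hz 0
      push_cast at this
      linarith
    · have h1 := le_of_mem_polytope hz 1
      have h2 := mem_polytope_le hz
      have h3 : z 1 = 0 := by linarith
      rw [h3] at h1 h2
      push_cast at h1
      refine ⟨z 0, by nlinarith, by linarith, ?_⟩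
      funext i
      fin_cases i <;> simp [toReal, h3]
  · refine isExtreme_segment (convex_convexHull ℝ _) (d - 1) (-2) 0
      (toReal_mem_polytope (by simp) (by simp)) (toReal_mem_polytope ?_ ?_) (by simp [toReal]) ?_
      (fun z hz => ?_) fun z hz h => ?_
    · simp
      linarith [mul_comm (K : ℤ) g, hgKz, hKq, show (K : ℤ) * g * (K * g - 1) = d * (d - 1) by
        rw [mul_comm (K : ℤ) g, hgKz]]
    · simp
      linarith [show ((d : ℤ) - 1) * (K * g) = (d - 1) * d by rw [mul_comm (K : ℤ) g, hgKz]]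
    · simp [toReal]
      linarith [show ((d : ℝ) - 1) * (K * g) = (d - 1) * d by rw [mul_comm (K : ℝ) g, hgKr]]
    · have := mem_polytope_le hz
      linarith
    · have h1 := le_of_mem_polytope hz 0
      have h2 := le_of_mem_polytope hz (d - 1)
      push_cast at h1 h2
      have h3 : z 1 = (d - 1) * z 0 / 2 := by linarith
      have hz0 : 0 ≤ z 0 := by nlinarith
      have hzd : z 0 ≤ d := by nlinarith
      refine ⟨z 0 / d, by positivity, (div_le_one (by linarith)).2 hzd, ?_⟩
      funext i
      fin_cases i
      · simp [toReal]
        rw [mul_comm (K : ℝ) g, hgKr]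
        field_simp
      · simp [toReal]
        rw [h3, show (K : ℝ) * q = (d - 1) * d / 2 by linarith]
        field_simp
  · intro z hz
    have h1 := le_of_mem_polytope hz 0
    have h2 := mem_polytope_le hz
    push_cast at h1
    refine ⟨z 0 - g * (z 1 / q), z 1 / q, ?_, div_nonneg (by linarith) hqpos.le, ?_⟩
    · rw [sub_nonneg, ← mul_div_assoc, div_le_iff₀ hqpos]
      nlinarith
    · funext i
      fin_cases i
      · simp [toReal]
        ring
      · simp [toReal]
        field_simp

/-- The edge vectors are -(1, d - 1) and -(g, q), and the determinant is (d - 1)g - q = q up to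
sign, because 2q = (d - 1)g. -/
theorem vertexMultiplicity_last (hd : 3 ≤ d) {g q K : ℕ} (hgK : g * K = d)
    (hq : 2 * (q : ℤ) = (d - 1) * g) (hcop : IsCoprime (g : ℤ) q) :
    vertexMultiplicity (interpolantPoints d) (interpolantPoints d (Fin.last d)) = q := by
  have hd3 : (3 : ℝ) ≤ d := by exact_mod_cast hd
  have hd3z : (3 : ℤ) ≤ d := by exact_mod_cast hd
  have hK : 0 < K := Nat.pos_of_ne_zero fun h => by subst h; omega
  have hg : 0 < g := Nat.pos_of_ne_zero fun h => by subst h; omega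
  have hgr : (0 : ℝ) < g := by exact_mod_cast hg
  have hqr : 2 * (q : ℝ) = (d - 1) * g := by exact_mod_cast hq
  have hgKr : (g : ℝ) * K = d := by exact_mod_cast hgK
  have hgKz : (g : ℤ) * K = d := by exact_mod_cast hgK
  have hqpos : (0 : ℝ) < q := by nlinarith
  have hqz : (q : ℤ) ≠ 0 := by
    intro h
    have : (q : ℝ) = 0 := by exact_mod_cast h
    linarith
  have hKq : 2 * ((K : ℤ) * q) = (d - 1) * d := by
    linear_combination (K : ℤ) * hq + ((d : ℤ) - 1) * hgKz
  have hKqr : 2 * ((K : ℝ) * q) = (d - 1) * d := by exact_mod_cast hKq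
  have hv0 : interpolantPoints d (Fin.last d) 0 = d := by simp [interpolantPoints]
  have hv1 : 2 * interpolantPoints d (Fin.last d) 1 = d * (d - 1) := by
    simpa using two_mul_interpolantPoints_one d (Fin.last d)
  generalize interpolantPoints d (Fin.last d) = v at hv0 hv1
  have hv0r : (v 0 : ℝ) = d := by exact_mod_cast hv0
  have hv1r : (v 1 : ℝ) = d * (d - 1) / 2 := by
    have : 2 * (v 1 : ℝ) = d * (d - 1) := by exact_mod_cast hv1
    linarith
  have hvmem : toReal v ∈ polytope (interpolantPoints d) :=
    toReal_mem_polytope (by rw [hv0, hv1]) (by rw [hv0, hv1, mul_comm])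
  rw [vertexMultiplicity,
    edgeVectors_eq (f₁ := ![-1, -((d : ℤ) - 1)]) (f₂ := ![-(g : ℤ), -(q : ℤ)]) (n₁ := 1) (n₂ := K)
      one_pos hK (by simpa using isCoprime_one_left.neg_left) (by simpa using hcop.neg_neg) ?_ ?_ ?_
      ?_]
  · exact index_closure_pair (s := d - 1) (σ := 1) (by simp) (by simp) (by simp)
      (by simp; linarith)
  · refine isExtreme_segment (convex_convexHull ℝ _) (-2 * (d - 1)) 2 (-(d * (d - 1))) hvmem
      (toReal_mem_polytope ?_ ?_) ?_ ?_ (fun z hz => ?_) fun z hz h => ?_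
    · simp [hv0]
      nlinarith
    · simp [hv0]
      nlinarith
    · simp only [toReal, hv0r, hv1r]
      ring
    · simp [toReal, hv0r, hv1r]
      ring
    · have := le_of_mem_polytope hz (d - 1)
      push_cast at this
      linarith
    · have h1 := le_of_mem_polytope hz (d - 2)
      have h2 := mem_polytope_le hz
      push_cast at h1
      have h3 : z 1 = (d - 1) * z 0 - d * (d - 1) / 2 := by linarith
      refine ⟨d - z 0, by nlinarith, by nlinarith, ?_⟩
      rw [toReal_add, toReal_nsmul, add_sub_cancel_left]
      funext i
      fin_cases i
      · simp [toReal, hv0r]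
      · simp [toReal, hv1r]
        rw [h3]
        ring
  · refine isExtreme_segment (convex_convexHull ℝ _) (d - 1) (-2) 0 hvmem
      (toReal_mem_polytope ?_ ?_) ?_ ?_ (fun z hz => ?_) fun z hz h => ?_
    · simp [hv0]
      have e : (K : ℤ) * g = d := by rw [mul_comm, hgKz]
      rw [e]
      linarith
    · simp [hv0]
      have e : (K : ℤ) * g = d := by rw [mul_comm, hgKz]
      rw [e]
      linarith
    · simp only [toReal, hv0r, hv1r]
      ring
    · simp [toReal, hv0r, hv1r]
      rw [mul_comm (K : ℝ) g, hgKr]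
      linarith
    · have := mem_polytope_le hz
      linarith
    · have h1 := le_of_mem_polytope hz 0
      have h2 := le_of_mem_polytope hz (d - 1)
      push_cast at h1 h2
      have h3 : z 1 = (d - 1) * z 0 / 2 := by linarith
      have hz0 : 0 ≤ z 0 := by nlinarith
      have hzd : z 0 ≤ d := by nlinarith
      refine ⟨(d - z 0) / d, div_nonneg (by linarith) (by linarith),
        (div_le_one (by linarith)).2 (by linarith), ?_⟩
      rw [toReal_add, toReal_nsmul, add_sub_cancel_left]
      funext i
      fin_cases i
      · simp [toReal, hv0r]
        rw [mul_comm (K : ℝ) g, hgKr]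
        field_simp
        ring
      · simp [toReal, hv1r]
        rw [h3, show (K : ℝ) * q = (d - 1) * d / 2 by linarith]
        field_simp
        ring
  · simp
    intro h
    apply hqz
    linarith
  · intro z hz
    have h1 := le_of_mem_polytope hz (d - 1)
    have h2 := mem_polytope_le hz
    push_cast at h1
    have hq' : (q : ℝ) = (d - 1) * g / 2 := by linarith
    obtain ⟨β, hβ⟩ : ∃ β : ℝ, β * q = (d - 1) * (d - z 0) - (d * (d - 1) / 2 - z 1) :=
      ⟨_, div_mul_cancel₀ _ hqpos.ne'⟩
    have hgβ : (d - 1) * (g * β) = 2 * ((d - 1) * (d - z 0) - (d * (d - 1) / 2 - z 1)) := by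
      rw [← hβ, hq']
      ring
    refine ⟨d - z 0 - g * β, β, ?_, ?_, ?_⟩
    · have : 0 ≤ (d - 1) * (d - z 0 - g * β) := by
        rw [mul_sub, hgβ]
        linarith
      exact nonneg_of_mul_nonneg_right this (by linarith)
    · refine nonneg_of_mul_nonneg_left (?_ : 0 ≤ β * q) hqpos
      rw [hβ]
      linarith
    · funext i
      fin_cases i
      · simp [toReal, hv0r]
        ring
      · simp [toReal, hv1r]
        linarith

theorem vertexMultiplicity_of_even (hd : 3 ≤ d) (he : Even d) {j : Fin (d + 1)}
    (hj : j = 0 ∨ j = Fin.last d) :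
    vertexMultiplicity (interpolantPoints d) (interpolantPoints d j) = d - 1 := by
  obtain ⟨n, hn⟩ := he
  have hgK : 2 * n = d := by omega
  have hq : 2 * ((d - 1 : ℕ) : ℤ) = (d - 1) * (2 : ℕ) := by
    push_cast [show 1 ≤ d by omega]
    ring
  -- For even d the primitive vector on the long edge is (2, d - 1), as d - 1 is odd; for odd d it
  -- is (1, (d - 1)/2).
  have hcop : IsCoprime ((2 : ℕ) : ℤ) (d - 1 : ℕ) :=
    ⟨1 - n, 1, by push_cast [show 1 ≤ d by omega]; rw [← hgK]; push_cast; ring⟩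
  rcases hj with rfl | rfl
  · exact vertexMultiplicity_zero hd hgK hq hcop
  · exact vertexMultiplicity_last hd hgK hq hcop

theorem vertexMultiplicity_of_odd (hd : 3 ≤ d) (ho : Odd d) {j : Fin (d + 1)}
    (hj : j = 0 ∨ j = Fin.last d) :
    vertexMultiplicity (interpolantPoints d) (interpolantPoints d j) = (d - 1) / 2 := by
  obtain ⟨n, hn⟩ := ho
  have hgK : 1 * d = d := one_mul d
  have hq : 2 * (((d - 1) / 2 : ℕ) : ℤ) = (d - 1) * (1 : ℕ) := by omega
  have hcop : IsCoprime ((1 : ℕ) : ℤ) ((d - 1) / 2 : ℕ) := by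
    rw [Nat.cast_one]
    exact isCoprime_one_left
  rcases hj with rfl | rfl
  · exact vertexMultiplicity_zero hd hgK hq hcop
  · exact vertexMultiplicity_last hd hgK hq hcop

end Polygon

end ToricInterp

end

theorem mainTheorem8 :
    (∀ d : ℕ, 3 ≤ d →
      ToricInterp.HasDim (ToricInterp.satInterpolant d) 2 ∧
      ToricInterp.IsNormalizationByProjection
        (ToricInterp.toLatticePoint (ToricInterp.interpolantPoints d))
        (ToricInterp.satInterpolant d) (ToricInterp.interpolant d)) ∧
    (Nat.card (ToricInterp.latticePoints (ToricInterp.interpolantPoints 3)) = 5 + 1 ∧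
      ToricInterp.HasDegree (ToricInterp.satInterpolant 3) 4 ∧
      ∀ p ∈ ToricInterp.satInterpolant 3,
        ToricInterp.IsNonsingularAt (ToricInterp.satInterpolant 3) p) ∧
    (∀ d : ℕ, 4 ≤ d →
      ToricInterp.singularLocus (ToricInterp.satInterpolant d) =
        {ToricInterp.fixedPoint d 0, ToricInterp.fixedPoint d (Fin.last d)} ∧
      ToricInterp.fixedPoint d 0 ≠ ToricInterp.fixedPoint d (Fin.last d) ∧
      ∀ j : Fin (d + 1), j = 0 ∨ j = Fin.last d →
        (Even d → ToricInterp.vertexMultiplicity (ToricInterp.interpolantPoints d)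
          (ToricInterp.interpolantPoints d j) = d - 1) ∧
        (Odd d → ToricInterp.vertexMultiplicity (ToricInterp.interpolantPoints d)
          (ToricInterp.interpolantPoints d j) = (d - 1) / 2)) := by
  refine ⟨fun d hd => ⟨ToricInterp.ringKrullDim_satInterpolant hd, ToricInterp.isNormalizationByProjection_satInterpolant hd⟩,
    ⟨ToricInterp.card_latticePoints_three, ToricInterp.hasDegree_satInterpolant_three, fun p hp =>
      ToricInterp.isNonsingularAt_satInterpolant_three hp⟩, fun d hd =>
    ⟨ToricInterp.singularLocus_satInterpolant hd, ToricInterp.fixedPoint_zero_ne_last (by omega), fun j hj =>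
      ⟨fun he => ToricInterp.vertexMultiplicity_of_even (by omega) he hj,
        fun ho => ToricInterp.vertexMultiplicity_of_odd (by omega) ho hj⟩⟩⟩
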